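/- Let $k$ be a field. All differential graded algebras (DGAs) are associative, unital, $\mathbb Z$-graded $k$-algebras with differential of degree $+1$. Let $I$ be a finite totally ordered set, and let $A=\{A_J\}$ be a strict cosimplicial graded commutative DGA indexed by $I$, that is, a covariant functor from the non-empty subsets of $I$ (ordered by inclusion) to graded commutative DGAs. Its total (Čech) DGA is $\check C(I,A)=\bigoplus_J A_J[-|J|]$, $|J|=\#J-1$, with differential the sum of the inner differential and of $(-1)^{|a|}$ times the Čech differential $(\delta a)_{i_0\dots i_n}=\sum_r(-1)^r a_{i_0\dots\widehat{i_r}\dots i_n}$, and with the Alexander–Whitney product $(a\cup b)_{i_0\dots i_n}=\sum_r(-1)^{r|b|}a_{i_0\dots i_r}b_{i_r\dots i_n}$; here $|a|,|b|$ are inner degrees. For a DGA $C$ with multiplication $\mu$, and $C[1]$ its shift, all signs below are given by the Koszul rule; $\mu$ is viewed as a map $C[1]\otimes C[1]\to C[2]$, $d_B=\sum_i 1\otimes\cdots\otimes\mu\otimes\cdots\otimes 1$ is the bar differential on $C[1]^{\otimes n}\cong C^{\otimes n}[n]$, and $\sigma$ denotes permutation of tensor factors. A homotopy shuffle system on $C$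 is a family of degree preserving $k$-linear maps $h^{l,m}:C^{\otimes l}[l]\otimes C^{\otimes m}[m]\to C[1]$ ($l,m\ge 0$, $l+m>0$) such that (1) $h^{1,0}=h^{0,1}=\mathrm{id}$ and $h^{p,0}=h^{0,p}=0$ for $p>1$; (2) $\mu+\mu\circ\sigma=-d\,h^{1,1}+h^{1,1}d$; (3) for $l,m>0$ and $l+m>2$, $$-d\,h^{l,m}+h^{l,m}d=\mu\circ\Big(\sum h^{l',m'}\otimes h^{l'',m''}\Big)\circ\sigma-h^{l-1,m}\circ(d_B\otimes 1)-h^{l,m-1}\circ(1\otimes d_B),$$ the sum being over $l'+l''=l$, $m'+m''=m$, $l'+m'\ge1$, $l''+m''\ge 1$. For an augmentation $\epsilon:C\to k$ with augmentation ideal $\bar C=\ker\epsilon$, the reduced bar complex is $B_{red}(C,\epsilon)=\bigoplus_{n\ge0}\bar C[1]^{\otimes n}$ with differential the sum of the inner differential and $d_B$. If the maps $h^{l,m}$ of a homotopy shuffle system on $C$ preserve $\bar C$, the homotopy shuffle product is the linear map $B_{red}(C,\epsilon)\otimes B_{red}(C,\epsilon)\to B_{red}(C,\epsilon)$ which on $\bar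 C[1]^{\otimes l}\otimes\bar C[1]^{\otimes m}$ is the sum, over all $n$ and all surjections $f:\{1,\dots,l\}\sqcup\{\bar1,\dots,\bar m\}\to\{1,\dots,n\}$ that are non-decreasing on each of the two parts, of the permutation of factors sorting them by the value of $f$ (within each fibre, the unbarred factors before the barred ones), followed by $h^{s'_1,s''_1}\otimes\cdots\otimes h^{s'_n,s''_n}$, where $s'_r$ and $s''_r$ are the numbers of unbarred and barred elements of $f^{-1}(r)$. **Theorem.** There are homotopy shuffle systems $\{h^{l,m}\}$ on the DGAs $\check C(I,A)$, for all finite totally ordered sets $I$ and all strict cosimplicial graded commutative DGAs $A$ indexed by $I$, such that: (a) $h^{l,m}=0$ for $l>1$; and if $I$ has at most one element, then $h^{l,m}=0$ for $l+m>1$; (b) they are functorial: let $\varphi:I\to I'$ be non-decreasing, let $A$ and $B$ be indexed by $I$ and $I'$, and let $\tau:B\to A$ be a $\varphi$-morphism, i.e. a compatible family of DGA morphisms $B_T\to A_S$ for $T\subset\varphi(S)$. Let $\varphi_*:\check C(I',B)\to\check C(I,A)$ be the induced map, for which $(\varphi_*b)_{i_0\dots i_p}$ is the image of $b_{\varphi(i_0)\dots\varphi(i_p)}$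 if $\varphi(i_0)<\dots<\varphi(i_p)$, and $0$ otherwise. Then $\varphi_*\circ h^{l,m}=h^{l,m}\circ(\varphi_*^{\otimes l}\otimes\varphi_*^{\otimes m})$. In particular (for $\varphi=\mathrm{id}$) they are functorial in $A$; (c) for every augmentation $\epsilon:\check C(I,A)\to k$ the maps $h^{l,m}$ preserve the augmentation ideal, and the homotopy shuffle product $$B_{red}(\check C(I,A),\epsilon)\otimes B_{red}(\check C(I,A),\epsilon)\to B_{red}(\check C(I,A),\epsilon)$$ is a morphism of complexes. -/

import Mathlib

universe u v w

open scoped TensorProduct DirectSum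

noncomputable section

namespace HomotopyShuffle

/-- An associative, unital differential graded algebra over `k`, graded by `ℤ`, with
differential of degree one. -/
structure DGA (k : Type u) [Field k] where
  carrier : Type v
  [ring : Ring carrier]
  [algebra : Algebra k carrier]
  deg : ℤ → Submodule k carrier
  [graded : GradedAlgebra deg]
  d : carrier →ₗ[k] carrier
  d_mem : ∀ {p : ℤ} {x : carrier}, x ∈ deg p → d x ∈ deg (p + 1)
  d_d : ∀ x : carrier, d (d x) = 0
  leibniz : ∀ {p : ℤ} {x : carrier} (y : carrier), x ∈ deg p →
    d (x * y) = d x * y + p.negOnePow • (x * d y)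

attribute [instance] DGA.ring DGA.algebra DGA.graded

instance (k : Type u) [Field k] : CoeSort (DGA.{u, v} k) (Type v) := ⟨DGA.carrier⟩

/-- Graded commutativity: `x y = (-1)^{|x||y|} y x`. -/
def DGA.IsGradedCommutative {k : Type u} [Field k] (A : DGA.{u, v} k) : Prop :=
  ∀ (p q : ℤ) (x y : A), x ∈ A.deg p → y ∈ A.deg q → x * y = (p * q).negOnePow • (y * x)

/-- Morphisms of differential graded algebras. -/
structure DGA.Hom {k : Type u} [Field k] (A B : DGA.{u, v} k) where
  toAlgHom : A.carrier →ₐ[k] B.carrier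
  map_deg : ∀ (p : ℤ) (x : A), x ∈ A.deg p → toAlgHom x ∈ B.deg p
  map_d : ∀ x : A, toAlgHom (A.d x) = B.d (toAlgHom x)

/-- The sign operator `x ↦ (-1)^{|x|} x`. -/
def DGA.sgn {k : Type u} [Field k] (A : DGA.{u, v} k) : A.carrier →ₗ[k] A.carrier :=
  DirectSum.toModule k ℤ A.carrier (fun p => p.negOnePow • (A.deg p).subtype) ∘ₗ
    (DirectSum.decomposeLinearEquiv A.deg).toLinearMap

section DGAFacts

variable {k : Type u} [Field k] (A B : DGA.{u, v} k)

theorem DGA.sgn_of_mem {p : ℤ} {x : A} (hx : x ∈ A.deg p) : A.sgn x = p.negOnePow • x := by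
  simp only [DGA.sgn, LinearMap.comp_apply, LinearEquiv.coe_coe,
    DirectSum.decomposeLinearEquiv_apply]
  rw [DirectSum.decompose_of_mem _ hx]
  erw [DirectSum.toModule_lof]
  rfl

theorem DGA.ext_of_deg {M : Type*} [AddCommGroup M] {f g : A.carrier →+ M}
    (h : ∀ (p : ℤ) (x : A), x ∈ A.deg p → f x = g x) (x : A) : f x = g x := by
  induction x using DirectSum.Decomposition.inductionOn A.deg with
  | zero => simp
  | homogeneous m => exact h _ _ m.2
  | add a b ha hb => simp [ha, hb]

theorem DGA.sgn_mem {p : ℤ} {x : A} (hx : x ∈ A.deg p) : A.sgn x ∈ A.deg p := by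
  rw [A.sgn_of_mem hx, Units.smul_def]
  exact zsmul_mem hx _

theorem DGA.sgn_sgn (x : A) : A.sgn (A.sgn x) = x := by
  refine A.ext_of_deg (f := (A.sgn.toAddMonoidHom.comp A.sgn.toAddMonoidHom))
    (g := AddMonoidHom.id _) (fun p x hx => ?_) x
  change A.sgn (A.sgn x) = x
  rw [A.sgn_of_mem (A.sgn_mem hx), A.sgn_of_mem hx, smul_smul, ← Int.negOnePow_add,
    Int.negOnePow_even _ (by simp), one_smul]

theorem DGA.sgn_mul (x y : A) : A.sgn (x * y) = A.sgn x * A.sgn y := by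
  refine A.ext_of_deg (f := A.sgn.toAddMonoidHom.comp (AddMonoidHom.mulRight y))
    (g := (AddMonoidHom.mulRight (A.sgn y)).comp A.sgn.toAddMonoidHom) (fun p x hx => ?_) x
  refine A.ext_of_deg (f := A.sgn.toAddMonoidHom.comp (AddMonoidHom.mulLeft x))
    (g := (AddMonoidHom.mulLeft (A.sgn x)).comp A.sgn.toAddMonoidHom) (fun q y hy => ?_) y
  change A.sgn (x * y) = A.sgn x * A.sgn y
  rw [A.sgn_of_mem hx, A.sgn_of_mem hy, A.sgn_of_mem (SetLike.mul_mem_graded hx hy),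
    smul_mul_smul_comm, Int.negOnePow_add]

theorem DGA.sgn_d (x : A) : A.sgn (A.d x) = -A.d (A.sgn x) := by
  refine A.ext_of_deg (f := A.sgn.toAddMonoidHom.comp A.d.toAddMonoidHom)
    (g := -(A.d.toAddMonoidHom.comp A.sgn.toAddMonoidHom)) (fun p x hx => ?_) x
  change A.sgn (A.d x) = -A.d (A.sgn x)
  rw [A.sgn_of_mem hx, A.sgn_of_mem (A.d_mem hx), Int.negOnePow_succ, Units.smul_def,
    Units.smul_def, map_zsmul]
  simp

theorem DGA.leibniz' (x y : A) : A.d (x * y) = A.d x * y + A.sgn x * A.d y := by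
  refine A.ext_of_deg (f := A.d.toAddMonoidHom.comp (AddMonoidHom.mulRight y))
    (g := (AddMonoidHom.mulRight y).comp A.d.toAddMonoidHom +
      (AddMonoidHom.mulRight (A.d y)).comp A.sgn.toAddMonoidHom) (fun p x hx => ?_) x
  change A.d (x * y) = A.d x * y + A.sgn x * A.d y
  rw [A.leibniz y hx, A.sgn_of_mem hx, smul_mul_assoc]

theorem DGA.Hom.map_sgn {A B : DGA.{u, v} k} (f : DGA.Hom A B) (x : A) :
    f.toAlgHom (A.sgn x) = B.sgn (f.toAlgHom x) := by
  refine A.ext_of_deg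
    (f := (f.toAlgHom.toLinearMap.toAddMonoidHom).comp A.sgn.toAddMonoidHom)
    (g := B.sgn.toAddMonoidHom.comp (f.toAlgHom.toLinearMap.toAddMonoidHom))
    (fun p x hx => ?_) x
  change f.toAlgHom (A.sgn x) = B.sgn (f.toAlgHom x)
  rw [A.sgn_of_mem hx, B.sgn_of_mem (f.map_deg p x hx), Units.smul_def, Units.smul_def,
    map_zsmul]

theorem DGA.sgn_pow_mul (n : ℕ) (x y : A) :
    (A.sgn ^ n) (x * y) = (A.sgn ^ n) x * (A.sgn ^ n) y := by
  induction n with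
  | zero => simp
  | succ n ih => simp only [pow_succ', Module.End.mul_apply, ih, A.sgn_mul]

theorem DGA.sgn_pow_mem (n : ℕ) {p : ℤ} {x : A} (hx : x ∈ A.deg p) :
    (A.sgn ^ n) x ∈ A.deg p := by
  induction n with
  | zero => simpa
  | succ n ih => simpa only [pow_succ', Module.End.mul_apply] using A.sgn_mem ih

theorem DGA.sgn_pow_d (n : ℕ) (x : A) :
    (A.sgn ^ n) (A.d x) = (n : ℤ).negOnePow • A.d ((A.sgn ^ n) x) := by
  induction n with
  | zero => simp
  | succ n ih =>
    simp only [pow_succ', Module.End.mul_apply, ih, Nat.cast_succ, Int.negOnePow_succ,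
      Units.smul_def, map_zsmul, A.sgn_d]
    simp

theorem DGA.sgn_one : A.sgn 1 = 1 := by
  rw [A.sgn_of_mem (SetLike.one_mem_graded A.deg)]; simp

theorem DGA.Hom.map_sgn_pow {A B : DGA.{u, v} k} (f : DGA.Hom A B) (n : ℕ) (x : A) :
    f.toAlgHom ((A.sgn ^ n) x) = (B.sgn ^ n) (f.toAlgHom x) := by
  induction n with
  | zero => simp
  | succ n ih => simp only [pow_succ', Module.End.mul_apply, ← ih, f.map_sgn]

end DGAFacts

section Cuts

variable {I : Type w} [LinearOrder I]

/-- The part of `S` up to `v` (included). -/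
def lowPart (S : Finset I) (v : I) : Finset I := S.filter (· ≤ v)

/-- The part of `S` from `v` on (included). -/
def highPart (S : Finset I) (v : I) : Finset I := S.filter (v ≤ ·)

/-- The position of `v` in `S`, counted from zero. -/
def posIn (S : Finset I) (v : I) : ℕ := (S.filter (· < v)).card

theorem card_lo {S : Finset I} {v : I} (hv : v ∈ S) : (lowPart S v).card = posIn S v + 1 := by
  have : lowPart S v = insert v (S.filter (· < v)) := by
    ext a; simp only [lowPart, Finset.mem_filter, Finset.mem_insert]; grind
  rw [this, Finset.card_insert_of_notMem (by simp), posIn]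

theorem card_hi {S : Finset I} {v : I} (_hv : v ∈ S) : (highPart S v).card + posIn S v = S.card := by
  rw [posIn, highPart, ← Finset.card_union_of_disjoint]
  · congr 1; ext a; simp only [Finset.mem_filter, Finset.mem_union]; grind
  · rw [Finset.disjoint_left]; intro a; simp only [Finset.mem_filter]; grind

theorem sum_cuts {M : Type*} [AddCommGroup M] (K : Finset I → M) (S : Finset I) :
    ∑ v ∈ S, (K (S.filter (· < v)) - K (lowPart S v)) = K ∅ - K S := by
  induction S using Finset.induction_on_max with
  | empty => simp
  | insert a S ha ih =>
    have hn : a ∉ S := fun h => lt_irrefl _ (ha a h)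
    rw [Finset.sum_insert hn]
    have e1 : (insert a S).filter (· < a) = S := by
      ext b; simp only [Finset.mem_filter, Finset.mem_insert]; grind
    have e2 : lowPart (insert a S) a = insert a S := by
      ext b; simp only [lowPart, Finset.mem_filter, Finset.mem_insert]; grind
    have e3 : ∑ v ∈ S, (K ((insert a S).filter (· < v)) - K (lowPart (insert a S) v)) =
        ∑ v ∈ S, (K (S.filter (· < v)) - K (lowPart S v)) := by
      refine Finset.sum_congr rfl fun v hv => ?_
      have := ha v hv
      congr 2
      · ext b; simp only [Finset.mem_filter, Finset.mem_insert]; grind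
      · ext b; simp only [lowPart, Finset.mem_filter, Finset.mem_insert]; grind
    rw [e1, e2, e3, ih]; abel

variable {k : Type u} [Field k] (R : DGA.{u, v} k)

theorem cut_assoc (F G H : Finset I → R) (S : Finset I) :
    ∑ x ∈ S, (∑ v ∈ lowPart S x, F (lowPart (lowPart S x) v) * (R.sgn ^ posIn (lowPart S x) v) (G (highPart (lowPart S x) v))) *
      (R.sgn ^ posIn S x) (H (highPart S x)) =
    ∑ v ∈ S, F (lowPart S v) * (R.sgn ^ posIn S v) (∑ x ∈ highPart S v,
      G (lowPart (highPart S v) x) * (R.sgn ^ posIn (highPart S v) x) (H (highPart (highPart S v) x))) := by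
  simp only [Finset.sum_mul, Finset.mul_sum, map_sum]
  rw [Finset.sum_comm' (t' := S) (s' := fun v => highPart S v)]
  · refine Finset.sum_congr rfl fun v hv => Finset.sum_congr rfl fun x hx => ?_
    simp only [highPart, Finset.mem_filter] at hx
    have e1 : lowPart (lowPart S x) v = lowPart S v := by ext a; simp only [lowPart, Finset.mem_filter]; grind
    have e2 : posIn (lowPart S x) v = posIn S v := by
      unfold posIn; congr 1; ext a; simp only [lowPart, Finset.mem_filter]; grind
    have e3 : highPart (lowPart S x) v = lowPart (highPart S v) x := by
      ext a; simp only [lowPart, highPart, Finset.mem_filter]; grind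
    have e4 : highPart (highPart S v) x = highPart S x := by ext a; simp only [highPart, Finset.mem_filter]; grind
    have e5 : posIn S x = posIn S v + posIn (highPart S v) x := by
      unfold posIn; rw [← Finset.card_union_of_disjoint]
      · congr 1; ext a; simp only [highPart, Finset.mem_filter, Finset.mem_union]; grind
      · rw [Finset.disjoint_left]; intro a; simp only [highPart, Finset.mem_filter]; grind
    rw [e1, e2, e3, e4, e5, R.sgn_pow_mul, pow_add, Module.End.mul_apply, mul_assoc]
  · intro x v; simp only [lowPart, highPart, Finset.mem_filter]; grind

/-- The total differential, for a family of elements of one algebra. -/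
def cutD (F : Finset I → R) (S : Finset I) : R :=
  R.d (F S) + ∑ v ∈ S, (posIn S v : ℤ).negOnePow • R.sgn (F (S.erase v))

theorem pos_erase_of_lt {S : Finset I} {u v : I} (hu : u ∈ S) (h : u < v) :
    posIn S v = posIn (S.erase u) v + 1 := by
  unfold posIn
  rw [← Finset.card_insert_of_notMem (a := u) (s := (S.erase u).filter (· < v)) (by simp)]
  congr 1; ext a; simp only [Finset.mem_filter, Finset.mem_insert, Finset.mem_erase]; grind

theorem pos_erase_of_le {S : Finset I} {u v : I} (h : v ≤ u) :
    posIn (S.erase u) v = posIn S v := by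
  unfold posIn
  congr 1; ext a; simp only [Finset.mem_filter, Finset.mem_erase]; grind

theorem cutD_cutD (F : Finset I → R) (S : Finset I) : cutD R (cutD R F) S = 0 := by
  have key : ∑ v ∈ S, ∑ u ∈ S.erase v, ((posIn S v : ℤ).negOnePow *
      (posIn (S.erase v) u : ℤ).negOnePow) • F ((S.erase v).erase u) = 0 := by
    rw [Finset.sum_sigma']
    refine Finset.sum_involution (fun x _ => ⟨x.2, x.1⟩) ?_ ?_ ?_ ?_
    · rintro ⟨v, u⟩ h
      simp only [Finset.mem_sigma, Finset.mem_erase] at h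
      obtain ⟨hv, huv, hu⟩ := h
      rw [Finset.erase_right_comm]
      rcases lt_or_gt_of_ne huv with h | h
      · rw [pos_erase_of_le h.le, pos_erase_of_lt hu h, Nat.cast_succ, Int.negOnePow_succ]
        simp [mul_comm]
      · rw [pos_erase_of_le h.le, pos_erase_of_lt hv h, Nat.cast_succ, Int.negOnePow_succ]
        simp [mul_comm]
    · rintro ⟨v, u⟩ h _ he
      simp only [Finset.mem_sigma, Finset.mem_erase] at h
      simp only [Sigma.mk.injEq] at he
      exact h.2.1 he.1
    · rintro ⟨v, u⟩ h
      simp only [Finset.mem_sigma, Finset.mem_erase] at h ⊢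
      exact ⟨h.2.2, fun e => h.2.1 e.symm, h.1⟩
    · rintro ⟨v, u⟩ h; rfl
  simp only [cutD, map_add, R.d_d, zero_add, map_sum, Units.smul_def, map_zsmul, smul_add,
    R.sgn_sgn, R.sgn_d, Finset.sum_add_distrib, smul_neg, Finset.sum_neg_distrib, Finset.smul_sum,
    smul_smul] at key ⊢
  simp only [Units.val_mul] at key
  rw [key]; simp

theorem cut_leibniz (F G : Finset I → R) (hF : F ∅ = 0) (hG : G ∅ = 0) (S : Finset I) :
    cutD R (fun T => ∑ v ∈ T, F (lowPart T v) * (R.sgn ^ posIn T v) (G (highPart T v))) S =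
    ∑ v ∈ S, cutD R F (lowPart S v) * (R.sgn ^ posIn S v) (G (highPart S v)) +
    ∑ v ∈ S, ((lowPart S v).card - 1 : ℤ).negOnePow • (R.sgn (F (lowPart S v)) *
      (R.sgn ^ posIn S v) (cutD R G (highPart S v))) := by
  have hcard : ∀ v ∈ S, ((lowPart S v).card - 1 : ℤ) = posIn S v := by
    intro v hv; rw [card_lo hv]; push_cast; ring
  have hR0 : ∑ v ∈ S, ((lowPart S v).card - 1 : ℤ).negOnePow • (R.sgn (F (lowPart S v)) *
      (R.sgn ^ posIn S v) (cutD R G (highPart S v))) =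
      ∑ v ∈ S, (posIn S v : ℤ).negOnePow • (R.sgn (F (lowPart S v)) *
      (R.sgn ^ posIn S v) (cutD R G (highPart S v))) :=
    Finset.sum_congr rfl (fun v hv => by rw [hcard v hv])
  have hsplit1 : ∀ v ∈ S, ∑ u ∈ lowPart S v, (posIn (lowPart S v) u : ℤ).negOnePow •
      (R.sgn (F ((lowPart S v).erase u)) * (R.sgn ^ posIn S v) (G (highPart S v))) =
      (∑ u ∈ S, if u < v then (posIn S u : ℤ).negOnePow • (R.sgn (F (lowPart (S.erase u) v)) *
        (R.sgn ^ (posIn (S.erase u) v + 1)) (G (highPart (S.erase u) v))) else 0) +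
      (posIn S v : ℤ).negOnePow • (R.sgn (F (S.filter (· < v))) *
        (R.sgn ^ posIn S v) (G (highPart S v))) := by
    intro v hv
    have e : lowPart S v = insert v (S.filter (· < v)) := by
      ext a; simp only [lowPart, Finset.mem_filter, Finset.mem_insert]; grind
    conv_lhs => rw [show ∑ u ∈ lowPart S v, (posIn (lowPart S v) u : ℤ).negOnePow •
      (R.sgn (F ((lowPart S v).erase u)) * (R.sgn ^ posIn S v) (G (highPart S v))) =
      ∑ u ∈ insert v (S.filter (· < v)), (posIn (lowPart S v) u : ℤ).negOnePow •
      (R.sgn (F ((lowPart S v).erase u)) * (R.sgn ^ posIn S v) (G (highPart S v))) from by rw [← e]]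
    rw [Finset.sum_insert (by simp), add_comm, Finset.sum_filter]
    congr 1
    · refine Finset.sum_congr rfl fun u hu => ?_
      split_ifs with h
      · have e1 : posIn (lowPart S v) u = posIn S u := by
          unfold posIn; congr 1; ext a; simp only [lowPart, Finset.mem_filter]; grind
        have e2 : (lowPart S v).erase u = lowPart (S.erase u) v := by
          ext a; simp only [lowPart, Finset.mem_filter, Finset.mem_erase]; grind
        have e3 : highPart (S.erase u) v = highPart S v := by
          ext a; simp only [highPart, Finset.mem_filter, Finset.mem_erase]; grind
        rw [e1, e2, e3, pos_erase_of_lt hu h]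
      · rfl
    · have e1 : posIn (lowPart S v) v = posIn S v := by
        unfold posIn; congr 1; ext a; simp only [lowPart, Finset.mem_filter]; grind
      have e2 : (lowPart S v).erase v = S.filter (· < v) := by
        ext a; simp only [lowPart, Finset.mem_filter, Finset.mem_erase]; grind
      rw [e1, e2]
  have hsplit2 : ∀ v ∈ S, (posIn S v : ℤ).negOnePow • ∑ u ∈ highPart S v,
      (posIn (highPart S v) u : ℤ).negOnePow •
      (R.sgn (F (lowPart S v)) * (R.sgn ^ (posIn S v + 1)) (G ((highPart S v).erase u))) =
      (∑ u ∈ S, if v < u then (posIn S u : ℤ).negOnePow • (R.sgn (F (lowPart (S.erase u) v)) *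
        (R.sgn ^ (posIn (S.erase u) v + 1)) (G (highPart (S.erase u) v))) else 0) +
      (posIn S v : ℤ).negOnePow • (R.sgn (F (lowPart S v)) *
        (R.sgn ^ (posIn S v + 1)) (G (S.filter (v < ·)))) := by
    intro v hv
    have e : highPart S v = insert v (S.filter (v < ·)) := by
      ext a; simp only [highPart, Finset.mem_filter, Finset.mem_insert]; grind
    conv_lhs => rw [show ∑ u ∈ highPart S v, (posIn (highPart S v) u : ℤ).negOnePow •
      (R.sgn (F (lowPart S v)) * (R.sgn ^ (posIn S v + 1)) (G ((highPart S v).erase u))) =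
      ∑ u ∈ insert v (S.filter (v < ·)), (posIn (highPart S v) u : ℤ).negOnePow •
      (R.sgn (F (lowPart S v)) * (R.sgn ^ (posIn S v + 1)) (G ((highPart S v).erase u)))
      from by rw [← e]]
    rw [Finset.sum_insert (by simp), smul_add, add_comm, Finset.sum_filter, Finset.smul_sum]
    congr 1
    · refine Finset.sum_congr rfl fun u hu => ?_
      split_ifs with h
      · have e1 : posIn S u = posIn S v + posIn (highPart S v) u := by
          unfold posIn; rw [← Finset.card_union_of_disjoint]
          · congr 1; ext a; simp only [highPart, Finset.mem_filter, Finset.mem_union]; grind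
          · rw [Finset.disjoint_left]; intro a; simp only [highPart, Finset.mem_filter]; grind
        have e2 : (highPart S v).erase u = highPart (S.erase u) v := by
          ext a; simp only [highPart, Finset.mem_filter, Finset.mem_erase]; grind
        have e3 : lowPart (S.erase u) v = lowPart S v := by
          ext a; simp only [lowPart, Finset.mem_filter, Finset.mem_erase]; grind
        rw [e1, e2, e3, pos_erase_of_le h.le, smul_smul, Nat.cast_add, Int.negOnePow_add]
      · simp
    · have e1 : posIn (highPart S v) v = 0 := by
        unfold posIn; rw [Finset.card_eq_zero]; ext a; simp only [highPart, Finset.mem_filter]; grind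
      have e2 : (highPart S v).erase v = S.filter (v < ·) := by
        ext a; simp only [highPart, Finset.mem_filter, Finset.mem_erase]; grind
      rw [e1, e2]; simp
  have htel := sum_cuts (fun P => ((P.card : ℤ).negOnePow • (R.sgn (F P) *
    (R.sgn ^ P.card) (G (S \ P))))) S
  have hdiag : ∑ v ∈ S, ((posIn S v : ℤ).negOnePow • (R.sgn (F (S.filter (· < v))) *
        (R.sgn ^ posIn S v) (G (highPart S v))) + (posIn S v : ℤ).negOnePow • (R.sgn (F (lowPart S v)) *
        (R.sgn ^ (posIn S v + 1)) (G (S.filter (v < ·))))) = 0 := by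
    rw [← sub_self (0 : R), show (0 : R) - 0 = _ - _ from ?_]
    rotate_left 1
    · exact ((S.card : ℤ).negOnePow • (R.sgn (F S) * (R.sgn ^ S.card) (G (S \ S))))
    · exact ((S.card : ℤ).negOnePow • (R.sgn (F S) * (R.sgn ^ S.card) (G (S \ S))))
    · simp
    · rw [show ∑ v ∈ S, _ = _ from (Finset.sum_congr rfl fun v hv => ?_).trans htel]
      · simp [hF, hG]
      · have e1 : S \ S.filter (· < v) = highPart S v := by
          ext a; simp only [highPart, Finset.mem_filter, Finset.mem_sdiff]; grind
        have e2 : S \ lowPart S v = S.filter (v < ·) := by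
          ext a; simp only [lowPart, Finset.mem_filter, Finset.mem_sdiff]; grind
        rw [e1, e2, card_lo hv, Nat.cast_succ, Int.negOnePow_succ]
        simp [posIn, Units.neg_smul]
  have hsum : ∑ u ∈ S, ∑ v ∈ S.erase u, (posIn S u : ℤ).negOnePow •
        (R.sgn (F (lowPart (S.erase u) v)) *
        (R.sgn ^ (posIn (S.erase u) v + 1)) (G (highPart (S.erase u) v))) =
      ∑ v ∈ S, ((∑ u ∈ S, if u < v then (posIn S u : ℤ).negOnePow • (R.sgn (F (lowPart (S.erase u) v)) *
        (R.sgn ^ (posIn (S.erase u) v + 1)) (G (highPart (S.erase u) v))) else 0) +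
       (∑ u ∈ S, if v < u then (posIn S u : ℤ).negOnePow • (R.sgn (F (lowPart (S.erase u) v)) *
        (R.sgn ^ (posIn (S.erase u) v + 1)) (G (highPart (S.erase u) v))) else 0)) := by
    simp only [← Finset.sum_add_distrib]
    rw [Finset.sum_comm]
    refine Finset.sum_congr rfl fun u hu => ?_
    have : S.erase u = S.filter (· ≠ u) := by
      ext a; simp only [Finset.mem_filter, Finset.mem_erase]; grind
    conv_lhs => rw [show ∑ v ∈ S.erase u, (posIn S u : ℤ).negOnePow •
        (R.sgn (F (lowPart (S.erase u) v)) *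
        (R.sgn ^ (posIn (S.erase u) v + 1)) (G (highPart (S.erase u) v))) =
        ∑ v ∈ S.filter (· ≠ u), (posIn S u : ℤ).negOnePow •
        (R.sgn (F (lowPart (S.erase u) v)) *
        (R.sgn ^ (posIn (S.erase u) v + 1)) (G (highPart (S.erase u) v))) from by rw [← this]]
    rw [Finset.sum_filter]
    refine Finset.sum_congr rfl fun v hv => ?_
    rcases lt_trichotomy u v with h | h | h
    · simp [h, h.ne', h.not_gt]
    · simp [h]
    · simp [h, h.ne, h.not_gt]
  have hL : cutD R (fun T => ∑ v ∈ T, F (lowPart T v) * (R.sgn ^ posIn T v) (G (highPart T v))) S =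
      ∑ v ∈ S, (R.d (F (lowPart S v)) * (R.sgn ^ posIn S v) (G (highPart S v)) +
        R.sgn (F (lowPart S v)) * R.d ((R.sgn ^ posIn S v) (G (highPart S v)))) +
      ∑ u ∈ S, ∑ v ∈ S.erase u, (posIn S u : ℤ).negOnePow •
        (R.sgn (F (lowPart (S.erase u) v)) *
        (R.sgn ^ (posIn (S.erase u) v + 1)) (G (highPart (S.erase u) v))) := by
    simp only [cutD, map_sum, R.leibniz', R.sgn_mul, Finset.smul_sum, pow_succ',
      Module.End.mul_apply]
  have hR1 : ∑ v ∈ S, cutD R F (lowPart S v) * (R.sgn ^ posIn S v) (G (highPart S v)) =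
      ∑ v ∈ S, (R.d (F (lowPart S v)) * (R.sgn ^ posIn S v) (G (highPart S v)) +
        ∑ u ∈ lowPart S v, (posIn (lowPart S v) u : ℤ).negOnePow •
      (R.sgn (F ((lowPart S v).erase u)) * (R.sgn ^ posIn S v) (G (highPart S v)))) := by
    simp only [cutD, add_mul, Finset.sum_mul, smul_mul_assoc]
  have hR2 : ∑ v ∈ S, (posIn S v : ℤ).negOnePow • (R.sgn (F (lowPart S v)) *
      (R.sgn ^ posIn S v) (cutD R G (highPart S v))) =
      ∑ v ∈ S, (R.sgn (F (lowPart S v)) * R.d ((R.sgn ^ posIn S v) (G (highPart S v))) +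
        (posIn S v : ℤ).negOnePow • ∑ u ∈ highPart S v,
      (posIn (highPart S v) u : ℤ).negOnePow •
      (R.sgn (F (lowPart S v)) * (R.sgn ^ (posIn S v + 1)) (G ((highPart S v).erase u)))) := by
    refine Finset.sum_congr rfl fun v _ => ?_
    simp only [cutD, map_add, mul_add, smul_add, R.sgn_pow_d, mul_smul_comm, smul_smul,
      ← Int.negOnePow_add, map_sum, Finset.mul_sum, pow_succ, Module.End.mul_apply]
    rw [Int.negOnePow_even _ (by simp), one_smul]
    simp only [Units.smul_def, map_zsmul, mul_smul_comm]
  rw [hR0, hL, hR1, hR2, hsum]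
  simp only [Finset.sum_add_distrib, Finset.sum_congr rfl hsplit1,
    Finset.sum_congr rfl hsplit2] at hdiag ⊢
  rw [← sub_eq_zero, ← neg_eq_zero, ← hdiag]
  abel

end Cuts

/-- The non-empty finite subsets of `I`; `I` will be a finite ordered set. -/
abbrev Simplex (I : Type w) := {J : Finset I // J.Nonempty}

/-- A strict cosimplicial graded commutative differential graded algebra indexed by `I`: a
covariant functor from the non-empty subsets of `I`, ordered by inclusion, to graded commutative
differential graded algebras. -/
structure StrictCosimplicialCDGA (k : Type u) [Field k] (I : Type w) where
  obj : Simplex I → DGA.{u, v} k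
  comm : ∀ J : Simplex I, (obj J).IsGradedCommutative
  map : ∀ {S T : Simplex I}, S.1 ⊆ T.1 → DGA.Hom (obj S) (obj T)
  map_id : ∀ (S : Simplex I) (x : obj S), (map (Finset.Subset.refl S.1)).toAlgHom x = x
  map_comp : ∀ {S T U : Simplex I} (hST : S.1 ⊆ T.1) (hTU : T.1 ⊆ U.1) (x : obj S),
    (map hTU).toAlgHom ((map hST).toAlgHom x) = (map (hST.trans hTU)).toAlgHom x

section Cech

variable {k : Type u} [Field k] {I : Type w} (A : StrictCosimplicialCDGA.{u, v, w} k I)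

/-- The module `∏_J A_J` underlying the total Čech complex. -/
@[ext] structure CechCarrier : Type (max v w) where
  val : ∀ J : Simplex I, (A.obj J).carrier

instance : CoeFun (CechCarrier A) (fun _ => ∀ J : Simplex I, (A.obj J).carrier) :=
  ⟨CechCarrier.val⟩

/-- Čech cochains as families. -/
def cechEquiv : CechCarrier A ≃ ∀ J : Simplex I, (A.obj J).carrier where
  toFun := CechCarrier.val
  invFun := CechCarrier.mk
  left_inv _ := rfl
  right_inv _ := rfl

instance : AddCommGroup (CechCarrier A) := (cechEquiv A).addCommGroup

instance : Module k (CechCarrier A) := (cechEquiv A).module k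

/-- The component at `J`. -/
def cechProj (J : Simplex I) : CechCarrier A →ₗ[k] (A.obj J).carrier where
  toFun a := a J
  map_add' _ _ := rfl
  map_smul' _ _ := rfl

variable {A}

theorem cech_ext {a b : CechCarrier A} (h : ∀ J, a J = b J) : a = b :=
  CechCarrier.ext (funext h)

@[simp] theorem CechCarrier.zero_apply (J : Simplex I) : (0 : CechCarrier A) J = 0 := rfl

@[simp] theorem CechCarrier.add_apply (a b : CechCarrier A) (J : Simplex I) :
    (a + b) J = a J + b J := rfl

@[simp] theorem CechCarrier.smul_apply (c : k) (a : CechCarrier A) (J : Simplex I) :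
    (c • a) J = c • a J := rfl

@[simp] theorem CechCarrier.units_smul_apply (c : ℤˣ) (a : CechCarrier A) (J : Simplex I) :
    (c • a) J = c • a J := by
  rw [Units.smul_def, Units.smul_def]
  exact map_zsmul (cechProj A J) _ a

open Classical in
/-- The image in `A_T` of the component of `a` at `S`, for `∅ ≠ S ⊆ T` (and `0` otherwise). -/
def CechCarrier.res (a : CechCarrier A) (S : Finset I) (T : Simplex I) : A.obj T :=
  if h : S.Nonempty ∧ S ⊆ T.1 then
    (A.map (S := ⟨S, h.1⟩) (T := T) h.2).toAlgHom (a ⟨S, h.1⟩) else 0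

theorem CechCarrier.res_empty (a : CechCarrier A) (T : Simplex I) : a.res ∅ T = 0 := by
  simp [CechCarrier.res]

theorem CechCarrier.res_self (a : CechCarrier A) (T : Simplex I) : a.res T.1 T = a T := by
  rw [CechCarrier.res, dif_pos ⟨T.2, Finset.Subset.refl _⟩]
  exact A.map_id T _

theorem CechCarrier.res_add (a b : CechCarrier A) (S : Finset I) (T : Simplex I) :
    (a + b).res S T = a.res S T + b.res S T := by
  unfold CechCarrier.res; split_ifs <;> simp

theorem CechCarrier.res_smul (c : k) (a : CechCarrier A) (S : Finset I) (T : Simplex I) :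
    (c • a).res S T = c • a.res S T := by
  unfold CechCarrier.res; split_ifs <;> simp

theorem CechCarrier.res_units_smul (c : ℤˣ) (a : CechCarrier A) (S : Finset I) (T : Simplex I) :
    (c • a).res S T = c • a.res S T := by
  unfold CechCarrier.res
  split_ifs
  · rw [CechCarrier.units_smul_apply, Units.smul_def, Units.smul_def, map_zsmul]
  · rw [smul_zero]

theorem CechCarrier.map_res (a : CechCarrier A) {S : Finset I} {T U : Simplex I}
    (hS : S ⊆ T.1) (h : T.1 ⊆ U.1) : (A.map h).toAlgHom (a.res S T) = a.res S U := by
  unfold CechCarrier.res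
  by_cases hn : S.Nonempty
  · rw [dif_pos ⟨hn, hS⟩, dif_pos ⟨hn, hS.trans h⟩, A.map_comp]
  · rw [dif_neg (fun e => hn e.1), dif_neg (fun e => hn e.1), map_zero]

theorem CechCarrier.res_mem (a : CechCarrier A) {S : Finset I} {T : Simplex I} {p : ℤ}
    (h : ∀ J : Simplex I, a J ∈ (A.obj J).deg (p - (J.1.card - 1))) :
    a.res S T ∈ (A.obj T).deg (p - (S.card - 1)) := by
  unfold CechCarrier.res
  split_ifs with hS
  · exact (A.map hS.2).map_deg _ _ (h ⟨S, hS.1⟩)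
  · exact zero_mem _

variable [LinearOrder I] (A)

/-- The unit: `1` on vertices, `0` on simplices of positive dimension. -/
instance : One (CechCarrier A) := ⟨⟨fun J => if J.1.card = 1 then 1 else 0⟩⟩

/-- The Alexander–Whitney product on the total complex. With `J = (i_0 < ... < i_n)`, the
component at `J` is the sum over `v = i_r` of `(-1)^{r |b|} a_{i_0 ... i_r} b_{i_r ... i_n}`, where
`|b|` is the inner degree of `b`. -/
instance : Mul (CechCarrier A) := ⟨fun a b => ⟨fun J =>
  ∑ v ∈ J.1, a.res (lowPart J.1 v) J * ((A.obj J).sgn ^ posIn J.1 v) (b.res (highPart J.1 v) J)⟩⟩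

/-- The total differential: the inner differential plus the Čech differential
`∑_r (-1)^r a_{i_0 ... î_r ... i_n}`, the latter multiplied by `(-1)^{|a|}` with `|a|` the inner
degree. -/
def cechD : CechCarrier A →ₗ[k] CechCarrier A where
  toFun a := ⟨fun J => (A.obj J).d (a J) +
    ∑ v ∈ J.1, (posIn J.1 v : ℤ).negOnePow • (A.obj J).sgn (a.res (J.1.erase v) J)⟩
  map_add' a b := by
    refine cech_ext fun J => ?_
    simp only [CechCarrier.res_add, map_add, smul_add, Finset.sum_add_distrib,
      CechCarrier.add_apply]
    abel
  map_smul' c a := by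
    refine cech_ext fun J => ?_
    simp only [CechCarrier.res_smul, map_smul, CechCarrier.smul_apply, RingHom.id_apply, smul_add,
      Finset.smul_sum]
    congr 1
    exact Finset.sum_congr rfl fun v _ => smul_comm _ _ _

variable {A}

theorem CechCarrier.one_res {S : Finset I} {T : Simplex I} (hS : S ⊆ T.1) :
    (1 : CechCarrier A).res S T = if S.card = 1 then 1 else 0 := by
  unfold CechCarrier.res
  by_cases h : S.card = 1
  · have hn : S.Nonempty := Finset.card_pos.1 (by omega)
    rw [dif_pos ⟨hn, hS⟩, if_pos h]
    change (A.map _).toAlgHom (if S.card = 1 then 1 else 0) = 1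
    rw [if_pos h, map_one]
  · rw [if_neg h]
    split_ifs with hn
    · change (A.map _).toAlgHom (if S.card = 1 then 1 else 0) = 0
      rw [if_neg h, map_zero]
    · rfl

theorem CechCarrier.mul_apply (a b : CechCarrier A) (J : Simplex I) :
    (a * b) J = ∑ v ∈ J.1, a.res (lowPart J.1 v) J *
      ((A.obj J).sgn ^ posIn J.1 v) (b.res (highPart J.1 v) J) := rfl

theorem lo_subset (S : Finset I) (v : I) : lowPart S v ⊆ S := Finset.filter_subset _ _

theorem hi_subset (S : Finset I) (v : I) : highPart S v ⊆ S := Finset.filter_subset _ _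

theorem CechCarrier.mul_res (a b : CechCarrier A) {S : Finset I} {T : Simplex I} (hS : S ⊆ T.1) :
    (a * b).res S T = ∑ v ∈ S, a.res (lowPart S v) T *
      ((A.obj T).sgn ^ posIn S v) (b.res (highPart S v) T) := by
  rcases S.eq_empty_or_nonempty with rfl | hn
  · simp [CechCarrier.res_empty]
  · rw [CechCarrier.res, dif_pos ⟨hn, hS⟩, CechCarrier.mul_apply, map_sum]
    refine Finset.sum_congr rfl fun v _ => ?_
    rw [map_mul, DGA.Hom.map_sgn_pow, CechCarrier.map_res _ (lo_subset S v),
      CechCarrier.map_res _ (hi_subset S v)]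

theorem cechD_res (a : CechCarrier A) {S : Finset I} {T : Simplex I} (hS : S ⊆ T.1) :
    (cechD A a).res S T = cutD (A.obj T) (fun U => a.res U T) S := by
  rcases S.eq_empty_or_nonempty with rfl | hn
  · simp [CechCarrier.res_empty, cutD]
  · rw [CechCarrier.res, dif_pos ⟨hn, hS⟩]
    change (A.map _).toAlgHom ((A.obj ⟨S, hn⟩).d (a ⟨S, hn⟩) + ∑ v ∈ S, (posIn S v : ℤ).negOnePow •
      (A.obj ⟨S, hn⟩).sgn (a.res (S.erase v) ⟨S, hn⟩)) = _
    rw [map_add, DGA.Hom.map_d, map_sum, cutD]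
    congr 1
    · rw [← CechCarrier.map_res a (T := ⟨S, hn⟩) (Finset.Subset.refl _) hS,
        CechCarrier.res_self a ⟨S, hn⟩]
    · refine Finset.sum_congr rfl fun v _ => ?_
      rw [Units.smul_def, map_zsmul, DGA.Hom.map_sgn,
        CechCarrier.map_res _ (Finset.erase_subset v S), Units.smul_def]

theorem cechD_apply (a : CechCarrier A) (J : Simplex I) :
    cechD A a J = cutD (A.obj J) (fun U => a.res U J) J.1 := by
  rw [← CechCarrier.res_self (cechD A a) J, cechD_res a (Finset.Subset.refl _)]

theorem cech_mul_assoc (a b c : CechCarrier A) : a * b * c = a * (b * c) := by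
  refine cech_ext fun J => ?_
  rw [CechCarrier.mul_apply, CechCarrier.mul_apply a (b * c)]
  have h := cut_assoc (A.obj J) (fun U => a.res U J) (fun U => b.res U J) (fun U => c.res U J) J.1
  refine Eq.trans ?_ (h.trans ?_)
  · exact Finset.sum_congr rfl (fun v _ => by rw [CechCarrier.mul_res a b (lo_subset J.1 v)])
  · exact Finset.sum_congr rfl (fun v _ => by rw [CechCarrier.mul_res b c (hi_subset J.1 v)])

theorem cech_one_mul (a : CechCarrier A) : 1 * a = a := by
  refine cech_ext fun J => ?_
  have hm := J.1.min'_mem J.2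
  rw [CechCarrier.mul_apply, Finset.sum_eq_single (J.1.min' J.2)]
  · have h0 : posIn J.1 (J.1.min' J.2) = 0 := by
      rw [posIn, Finset.card_eq_zero, Finset.filter_eq_empty_iff]
      intro x hx; exact not_lt.2 (J.1.min'_le x hx)
    have h1 : highPart J.1 (J.1.min' J.2) = J.1 := by
      rw [highPart, Finset.filter_eq_self]; exact fun x hx => J.1.min'_le x hx
    rw [CechCarrier.one_res (lo_subset _ _), card_lo hm, h0, h1, CechCarrier.res_self]
    simp
  · intro v hv hne
    rw [CechCarrier.one_res (lo_subset _ _), card_lo hv, if_neg, zero_mul]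
    have : 0 < posIn J.1 v := by
      rw [posIn, Finset.card_pos]
      exact ⟨J.1.min' J.2, Finset.mem_filter.2 ⟨hm, lt_of_le_of_ne (J.1.min'_le v hv) hne.symm⟩⟩
    omega
  · exact fun h => absurd hm h

theorem cech_mul_one (a : CechCarrier A) : a * 1 = a := by
  refine cech_ext fun J => ?_
  have hm := J.1.max'_mem J.2
  have hs : ∀ (R : DGA.{u, v} k) (n : ℕ), (R.sgn ^ n) 1 = 1 := by
    intro R n
    induction n with
    | zero => simp
    | succ n ih => rw [pow_succ', Module.End.mul_apply, ih, R.sgn_one]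
  rw [CechCarrier.mul_apply, Finset.sum_eq_single (J.1.max' J.2)]
  · have h0 : lowPart J.1 (J.1.max' J.2) = J.1 := by
      rw [lowPart, Finset.filter_eq_self]; exact fun x hx => J.1.le_max' x hx
    have h1 : (highPart J.1 (J.1.max' J.2)).card = 1 := by
      have e := card_hi hm
      have e' := card_lo hm
      rw [h0] at e'
      omega
    rw [CechCarrier.one_res (hi_subset _ _), if_pos h1, hs, mul_one, h0, CechCarrier.res_self]
  · intro v hv hne
    rw [CechCarrier.one_res (hi_subset _ _), if_neg, map_zero, mul_zero]
    have : 1 < (highPart J.1 v).card := by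
      rw [Finset.one_lt_card]
      exact ⟨v, Finset.mem_filter.2 ⟨hv, le_rfl⟩, J.1.max' J.2,
        Finset.mem_filter.2 ⟨hm, J.1.le_max' v hv⟩, hne⟩
    omega
  · exact fun h => absurd hm h

instance : Ring (CechCarrier A) where
  left_distrib a b c := by
    refine cech_ext fun J => ?_
    simp only [CechCarrier.mul_apply, CechCarrier.res_add, map_add, mul_add,
      Finset.sum_add_distrib, CechCarrier.add_apply]
  right_distrib a b c := by
    refine cech_ext fun J => ?_
    simp only [CechCarrier.mul_apply, CechCarrier.res_add, add_mul,
      Finset.sum_add_distrib, CechCarrier.add_apply]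
  zero_mul a := by
    refine cech_ext fun J => ?_
    have h : ∀ S : Finset I, (0 : CechCarrier A).res S J = 0 := fun S => by
      rw [← zero_smul k (0 : CechCarrier A), CechCarrier.res_smul, zero_smul]
    simp only [CechCarrier.mul_apply, h, zero_mul, Finset.sum_const_zero, CechCarrier.zero_apply]
  mul_zero a := by
    refine cech_ext fun J => ?_
    have h : ∀ S : Finset I, (0 : CechCarrier A).res S J = 0 := fun S => by
      rw [← zero_smul k (0 : CechCarrier A), CechCarrier.res_smul, zero_smul]
    simp only [CechCarrier.mul_apply, h, map_zero, mul_zero, Finset.sum_const_zero,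
      CechCarrier.zero_apply]
  mul_assoc := cech_mul_assoc
  one_mul := cech_one_mul
  mul_one := cech_mul_one
  zsmul := fun n a => n • a
  nsmul := fun n a => n • a
  neg_add_cancel := neg_add_cancel
  sub_eq_add_neg := sub_eq_add_neg
  zsmul_zero' := SubNegMonoid.zsmul_zero'
  zsmul_succ' := SubNegMonoid.zsmul_succ'
  zsmul_neg' := SubNegMonoid.zsmul_neg'
  nsmul_zero := AddMonoid.nsmul_zero
  nsmul_succ := AddMonoid.nsmul_succ

instance : Algebra k (CechCarrier A) :=
  Algebra.ofModule
    (fun c a b => by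
      refine cech_ext fun J => ?_
      simp only [CechCarrier.mul_apply, CechCarrier.res_smul, CechCarrier.smul_apply,
        smul_mul_assoc, Finset.smul_sum])
    (fun c a b => by
      refine cech_ext fun J => ?_
      simp only [CechCarrier.mul_apply, CechCarrier.res_smul, CechCarrier.smul_apply, map_smul,
        mul_smul_comm, Finset.smul_sum])

variable (A)

/-- The elements of total degree `p`: those whose component at `J` has inner degree
`p - |J|`, where `|J| = card J - 1`. -/
def cechDeg (p : ℤ) : Submodule k (CechCarrier A) where
  carrier := {a | ∀ J : Simplex I, a J ∈ (A.obj J).deg (p - (J.1.card - 1))}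
  add_mem' ha hb := fun J => add_mem (ha J) (hb J)
  zero_mem' := fun _ => zero_mem _
  smul_mem' c _ ha := fun J => Submodule.smul_mem _ c (ha J)

instance : SetLike.GradedMonoid (cechDeg A) where
  one_mem := fun (J : Simplex I) => by
    change (if J.1.card = 1 then (1 : A.obj J) else 0) ∈ _
    split_ifs with h
    · rw [h]; simpa using SetLike.one_mem_graded (A.obj J).deg
    · exact zero_mem _
  mul_mem p q a b ha hb := fun J => by
    rw [CechCarrier.mul_apply]
    refine sum_mem fun v hv => ?_
    have h1 := CechCarrier.res_mem a (S := lowPart J.1 v) (T := J) ha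
    have h2 := (A.obj J).sgn_pow_mem (posIn J.1 v)
      (CechCarrier.res_mem b (S := highPart J.1 v) (T := J) hb)
    have h3 := SetLike.mul_mem_graded h1 h2
    have e1 := card_lo hv
    have e2 := card_hi hv
    convert h3 using 2
    omega

theorem cechD_mem {p : ℤ} {a : CechCarrier A} (ha : a ∈ cechDeg A p) :
    cechD A a ∈ cechDeg A (p + 1) := by
  intro J
  rw [cechD_apply, cutD, CechCarrier.res_self]
  refine add_mem ?_ (sum_mem fun v hv => ?_)
  · have := (A.obj J).d_mem (ha J)
    convert this using 2; ring
  · have := (A.obj J).sgn_mem (CechCarrier.res_mem a (S := J.1.erase v) (T := J) ha)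
    rw [Units.smul_def]
    refine zsmul_mem ?_ _
    have e := Finset.card_erase_add_one hv
    convert this using 2
    omega

theorem cechD_cechD (a : CechCarrier A) : cechD A (cechD A a) = 0 := by
  refine cech_ext fun J => ?_
  rw [cechD_apply, CechCarrier.zero_apply, ← cutD_cutD (A.obj J) (fun U => a.res U J) J.1, cutD,
    cutD, cechD_res a (Finset.Subset.refl _)]
  congr 1
  exact Finset.sum_congr rfl fun v _ => by rw [cechD_res a (Finset.erase_subset v _)]

theorem cechD_leibniz {p : ℤ} {a : CechCarrier A} (b : CechCarrier A) (ha : a ∈ cechDeg A p) :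
    cechD A (a * b) = cechD A a * b + p.negOnePow • (a * cechD A b) := by
  refine cech_ext fun J => ?_
  have h := cut_leibniz (A.obj J) (fun U => a.res U J) (fun U => b.res U J)
    (a.res_empty J) (b.res_empty J) J.1
  rw [cechD_apply, CechCarrier.add_apply, CechCarrier.units_smul_apply, CechCarrier.mul_apply,
    CechCarrier.mul_apply]
  have h1 : cutD (A.obj J) (fun U => (a * b).res U J) J.1 = cutD (A.obj J) (fun T => ∑ v ∈ T,
      a.res (lowPart T v) J * ((A.obj J).sgn ^ posIn T v) (b.res (highPart T v) J)) J.1 := by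
    unfold cutD
    beta_reduce
    rw [CechCarrier.mul_res a b (Finset.Subset.refl _)]
    congr 1
    exact Finset.sum_congr rfl fun v _ => by
      rw [CechCarrier.mul_res a b (Finset.erase_subset v _)]
  rw [h1, h, Finset.smul_sum]
  congr 1
  · exact Finset.sum_congr rfl fun v _ => by rw [cechD_res a (lo_subset _ _)]
  · refine Finset.sum_congr rfl fun v _ => ?_
    rw [cechD_res b (hi_subset _ _),
      (A.obj J).sgn_of_mem (CechCarrier.res_mem a (S := lowPart J.1 v) (T := J) ha), smul_mul_assoc,
      smul_smul, ← Int.negOnePow_add]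
    congr 2
    ring

variable [Finite I]

open Classical in
/-- The inclusion of one factor of the product, on homogeneous elements. -/
def cechSingle (J : Simplex I) (p : ℤ) :
    (A.obj J).deg p →ₗ[k] cechDeg A (p + (J.1.card - 1)) where
  toFun x := ⟨⟨Pi.single (M := fun K : Simplex I => (A.obj K).carrier) J x.1⟩, fun K => by
    by_cases h : K = J
    · subst h; simp
    · simp [h]⟩
  map_add' x y := Subtype.ext (cech_ext fun K => by
    by_cases h : K = J
    · subst h; simp
    · simp [h])
  map_smul' c x := Subtype.ext (cech_ext fun K => by
    by_cases h : K = J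
    · subst h; simp
    · simp [h])

/-- Decomposition of a Čech cochain into its homogeneous parts. -/
def cechDecompose : CechCarrier A →ₗ[k] ⨁ p, cechDeg A p :=
  letI : Fintype I := Fintype.ofFinite I
  ∑ J : Simplex I, (DirectSum.toModule k ℤ _ (fun p =>
    DirectSum.lof k ℤ (fun q => cechDeg A q) (p + (J.1.card - 1)) ∘ₗ cechSingle A J p)) ∘ₗ
      (DirectSum.decomposeLinearEquiv (A.obj J).deg).toLinearMap ∘ₗ
      cechProj A J

theorem cechDecompose_of_mem {p : ℤ} {a : CechCarrier A} (ha : a ∈ cechDeg A p) :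
    cechDecompose A a = DirectSum.lof k ℤ (fun q => cechDeg A q) p ⟨a, ha⟩ := by
  classical
  let _ : Fintype I := Fintype.ofFinite I
  have hcast : ∀ (q r : ℤ) (h : q = r) (x : CechCarrier A) (hx : x ∈ cechDeg A q),
      DirectSum.lof k ℤ (fun q => cechDeg A q) q ⟨x, hx⟩ =
        DirectSum.lof k ℤ (fun q => cechDeg A q) r ⟨x, h ▸ hx⟩ := by
    rintro q r rfl x hx; rfl
  have hmem : ∀ J : Simplex I,
      (⟨Pi.single (M := fun K : Simplex I => (A.obj K).carrier) J (a J)⟩ : CechCarrier A) ∈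
        cechDeg A p := by
    intro J K
    by_cases h : K = J
    · subst h; simpa using ha K
    · simp [h]
  have hJ : ∀ J : Simplex I, (DirectSum.toModule k ℤ _ (fun p =>
      DirectSum.lof k ℤ (fun q => cechDeg A q) (p + (J.1.card - 1)) ∘ₗ cechSingle A J p))
        (DirectSum.decompose (A.obj J).deg (a J)) =
      DirectSum.lof k ℤ (fun q => cechDeg A q) p ⟨_, hmem J⟩ := by
    intro J
    rw [DirectSum.decompose_of_mem _ (ha J)]
    erw [DirectSum.toModule_lof]
    exact hcast _ p (by ring) _ _
  have hsum : ∑ J : Simplex I, (⟨_, hmem J⟩ : cechDeg A p) = ⟨a, ha⟩ := by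
    refine Subtype.ext (cech_ext fun K => ?_)
    rw [AddSubmonoidClass.coe_finsetSum]
    change cechProj A K _ = a K
    rw [map_sum, Finset.sum_eq_single K]
    · exact Pi.single_eq_same (M := fun K : Simplex I => (A.obj K).carrier) K (a K)
    · intro J _ h
      exact Pi.single_eq_of_ne (M := fun K : Simplex I => (A.obj K).carrier) h.symm (a J)
    · simp
  rw [← hsum, map_sum, cechDecompose, LinearMap.sum_apply]
  exact Finset.sum_congr rfl fun J _ => hJ J

theorem coe_cechDecompose (a : CechCarrier A) :
    DirectSum.coeLinearMap (cechDeg A) (cechDecompose A a) = a := by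
  classical
  let _ : Fintype I := Fintype.ofFinite I
  have hJ : ∀ (J : Simplex I) (x : A.obj J), DirectSum.coeLinearMap (cechDeg A)
      ((DirectSum.toModule k ℤ _ (fun p =>
      DirectSum.lof k ℤ (fun q => cechDeg A q) (p + (J.1.card - 1)) ∘ₗ cechSingle A J p))
        (DirectSum.decompose (A.obj J).deg x)) =
      ⟨Pi.single (M := fun K : Simplex I => (A.obj K).carrier) J x⟩ := by
    intro J x
    induction x using DirectSum.Decomposition.inductionOn (A.obj J).deg with
    | zero =>
      rw [DirectSum.decompose_zero, map_zero, map_zero, Pi.single_zero]; rfl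
    | homogeneous m =>
      rw [DirectSum.decompose_coe]
      erw [DirectSum.toModule_lof]
      exact DirectSum.coeLinearMap_lof (cechDeg A) _ _
    | add x y hx hy =>
      rw [DirectSum.decompose_add, map_add, map_add, hx, hy, Pi.single_add]; rfl
  rw [cechDecompose, LinearMap.sum_apply, map_sum]
  refine (Finset.sum_congr rfl fun J _ => hJ J (a J)).trans (cech_ext fun K => ?_)
  change cechProj A K _ = a K
  rw [map_sum, Finset.sum_eq_single K]
  · exact Pi.single_eq_same (M := fun K : Simplex I => (A.obj K).carrier) K (a K)
  · intro J _ h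
    exact Pi.single_eq_of_ne (M := fun K : Simplex I => (A.obj K).carrier) h.symm (a J)
  · simp

instance : DirectSum.Decomposition (cechDeg A) :=
  DirectSum.Decomposition.ofLinearMap (cechDeg A) (cechDecompose A)
    (LinearMap.ext (coe_cechDecompose A))
    (DirectSum.linearMap_ext k fun p => LinearMap.ext fun x => by
      simp only [LinearMap.comp_apply, DirectSum.coeLinearMap_lof, LinearMap.id_apply]
      exact cechDecompose_of_mem A x.2)

instance : GradedAlgebra (cechDeg A) where

/-- The total (Čech) differential graded algebra `Č(I, A)`: the simple complex
`⨁_J A_J[-|J|]` with the Alexander–Whitney product. -/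
def cech : DGA.{u, max v w} k where
  carrier := CechCarrier A
  deg := cechDeg A
  d := cechD A
  d_mem := cechD_mem A
  d_d := cechD_cechD A
  leibniz b ha := cechD_leibniz A b ha

end Cech

section PhiMorphisms

variable {k : Type u} [Field k] {I J : Type w} [LinearOrder I] [LinearOrder J]

/-- For a non-decreasing map `φ : I → J`, a `φ`-morphism from `B` (indexed by `J`) to `A` (indexed
by `I`): compatible morphisms `B_T → A_S` for `T ⊆ φ(S)`. For `φ = id` these are the morphisms of
strict cosimplicial differential graded algebras. -/
structure PhiHom (φ : I →o J) (B : StrictCosimplicialCDGA.{u, v, w} k J)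
    (A : StrictCosimplicialCDGA.{u, v, w} k I) where
  app : ∀ {S : Simplex I} {T : Simplex J}, T.1 ⊆ S.1.image φ → DGA.Hom (B.obj T) (A.obj S)
  natural : ∀ {S S' : Simplex I} {T T' : Simplex J} (h : T.1 ⊆ S.1.image φ)
    (h' : T'.1 ⊆ S'.1.image φ) (hS : S.1 ⊆ S'.1) (hT : T.1 ⊆ T'.1) (x : B.obj T),
    (A.map hS).toAlgHom ((app h).toAlgHom x) = (app h').toAlgHom ((B.map hT).toAlgHom x)

open Classical in
/-- The map `φ_* : Č(J, B) → Č(I, A)` induced by a `φ`-morphism: the component of `φ_* b` at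
`i_0 < ... < i_p` is the image of `b_{φ(i_0) ... φ(i_p)}` if `φ(i_0) < ... < φ(i_p)`, and `0`
otherwise. -/
def PhiHom.induced {φ : I →o J} {B : StrictCosimplicialCDGA.{u, v, w} k J}
    {A : StrictCosimplicialCDGA.{u, v, w} k I} (τ : PhiHom φ B A) :
    CechCarrier B →ₗ[k] CechCarrier A where
  toFun b := ⟨fun S => if Set.InjOn φ (S.1 : Set I) then
    (τ.app (S := S) (T := ⟨S.1.image φ, S.2.image φ⟩) (Finset.Subset.refl _)).toAlgHom
      (b ⟨S.1.image φ, S.2.image φ⟩) else 0⟩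
  map_add' a b := by
    refine cech_ext fun S => ?_
    simp only [CechCarrier.add_apply]
    split_ifs <;> simp
  map_smul' c b := by
    refine cech_ext fun S => ?_
    simp only [CechCarrier.smul_apply, RingHom.id_apply]
    split_ifs <;> simp

end PhiMorphisms

section Shuffle

variable {k : Type u} [Field k]

/-- Families of `k`-linear maps `A^{⊗ l} ⊗ A^{⊗ m} → A`, for all `l` and `m`, written as
multilinear maps. -/
abbrev ShuffleMaps (A : DGA.{u, v} k) : Type v :=
  ∀ l m : ℕ, MultilinearMap k (fun _ : Fin l => A.carrier)
    (MultilinearMap k (fun _ : Fin m => A.carrier) A.carrier)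

/-- `h^{l,m}(x_0 ⊗ ... ⊗ x_{l-1} ⊗ y_0 ⊗ ... ⊗ y_{m-1})` for sequences `x` and `y`. -/
def ShuffleMaps.app {A : DGA.{u, v} k} (h : ShuffleMaps A) (l m : ℕ) (x y : ℕ → A) : A :=
  h l m (fun i => x i) (fun j => y j)

/-- The multiplication `μ : A[1] ⊗ A[1] → A[2]`, as an operator of degree one on `A[1]`. In this
form its sign is `(-1)^{|x|}`, with `|x|` the degree of `x` in `A`. -/
def DGA.cup (A : DGA.{u, v} k) : A.carrier →ₗ[k] A.carrier →ₗ[k] A.carrier :=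
  (LinearMap.mul k A.carrier).comp A.sgn

/-- The degree in `A[1]^{⊗ n}` of a tensor whose factors have degrees `p_0, ..., p_{n-1}`
in `A`. -/
def shiftDeg (p : ℕ → ℤ) (n : ℕ) : ℤ := ∑ i ∈ Finset.range n, (p i - 1)

/-- Replace the entries `x_i, x_{i+1}` of a sequence by the single entry `μ(x_i ⊗ x_{i+1})`. -/
def DGA.mergeAt (A : DGA.{u, v} k) (x : ℕ → A) (i : ℕ) : ℕ → A :=
  fun j => if j < i then x j else if j = i then A.cup (x i) (x (i + 1)) else x (j + 1)

/-- The composite `h^{l,m} ∘ d`, with `d` the differential of `A[1]^{⊗ l} ⊗ A[1]^{⊗ m}`, on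
tensors of elements of degrees `p_i` and `q_j`. -/
def ShuffleMaps.compD {A : DGA.{u, v} k} (h : ShuffleMaps A) (l m : ℕ) (p q : ℕ → ℤ)
    (x y : ℕ → A) : A :=
  ∑ i ∈ Finset.range l, (shiftDeg p i).negOnePow •
    h.app l m (Function.update x i (A.d (x i))) y +
  ∑ j ∈ Finset.range m, (shiftDeg p l + shiftDeg q j).negOnePow •
    h.app l m x (Function.update y j (A.d (y j)))

/-- The map `α = μ ∘ ∑ (h^{l',m'} ⊗ h^{l'',m''}) ∘ σ`. The sign is that of the permutation moving
the first `m'` of the `y`'s past the last `l''` of the `x`'s. -/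
def ShuffleMaps.alpha {A : DGA.{u, v} k} (h : ShuffleMaps A) (l m : ℕ) (p q : ℕ → ℤ)
    (x y : ℕ → A) : A :=
  ∑ l' ∈ Finset.range (l + 1), ∑ m' ∈ Finset.range (m + 1),
    if 0 < l' + m' ∧ l' + m' < l + m then
      (shiftDeg (fun i => p (l' + i)) (l - l') * shiftDeg q m').negOnePow •
        A.cup (h.app l' m' x y)
          (h.app (l - l') (m - m') (fun i => x (l' + i)) (fun j => y (m' + j)))
    else 0

/-- The map `β = h^{l-1,m} ∘ (-d_B ⊗ 1)`, with `d_B = ∑_i 1 ⊗ ... ⊗ μ ⊗ ... ⊗ 1`. -/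
def ShuffleMaps.beta {A : DGA.{u, v} k} (h : ShuffleMaps A) (l m : ℕ) (p _q : ℕ → ℤ)
    (x y : ℕ → A) : A :=
  -∑ i ∈ Finset.range (l - 1), (shiftDeg p i).negOnePow • h.app (l - 1) m (A.mergeAt x i) y

/-- The map `γ = h^{l,m-1} ∘ (-1 ⊗ d_B)`. -/
def ShuffleMaps.gamma {A : DGA.{u, v} k} (h : ShuffleMaps A) (l m : ℕ) (p q : ℕ → ℤ)
    (x y : ℕ → A) : A :=
  -∑ j ∈ Finset.range (m - 1), (shiftDeg p l + shiftDeg q j).negOnePow •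
    h.app l (m - 1) x (A.mergeAt y j)

/-- Homotopy shuffle systems `h^{l,m} : A^{⊗ l}[l] ⊗ A^{⊗ m}[m] → A[1]`. All degrees are degrees
in `A`, so that an element of degree `p` of `A` has degree `p - 1` in `A[1]`; all maps into `A[2]`
are written as maps of degree one into `A[1]`, and the signs are those of the Koszul rule. The
system is indexed by `l + m > 0`; the irrelevant member `h^{0,0}` is put equal to zero. -/
structure IsHomotopyShuffleSystem (A : DGA.{u, v} k) (h : ShuffleMaps A) : Prop where
  zero_zero : h 0 0 = 0
  /-- The maps preserve degrees. -/
  map_deg : ∀ (l m : ℕ) (p q : ℕ → ℤ) (x y : ℕ → A), (∀ i, x i ∈ A.deg (p i)) →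
    (∀ j, y j ∈ A.deg (q j)) → h.app l m x y ∈ A.deg (shiftDeg p l + shiftDeg q m + 1)
  one_zero : ∀ x y : ℕ → A, h.app 1 0 x y = x 0
  zero_one : ∀ x y : ℕ → A, h.app 0 1 x y = y 0
  left_zero : ∀ n : ℕ, 1 < n → h n 0 = 0
  right_zero : ∀ n : ℕ, 1 < n → h 0 n = 0
  /-- `μ + μ ∘ σ = -d h^{1,1} + h^{1,1} d`. -/
  homotopy_comm : ∀ (p q : ℤ) (x y : A), x ∈ A.deg p → y ∈ A.deg q →
    A.cup x y + ((p - 1) * (q - 1)).negOnePow • A.cup y x =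
      -A.d (h 1 1 (fun _ => x) (fun _ => y)) +
        (h 1 1 (fun _ => A.d x) (fun _ => y) +
          (p - 1).negOnePow • h 1 1 (fun _ => x) (fun _ => A.d y))
  /-- `-d h^{l,m} + h^{l,m} d = α + β + γ`. -/
  higher : ∀ l m : ℕ, 0 < l → 0 < m → 2 < l + m → ∀ (p q : ℕ → ℤ) (x y : ℕ → A),
    (∀ i, x i ∈ A.deg (p i)) → (∀ j, y j ∈ A.deg (q j)) →
    -A.d (h.app l m x y) + h.compD l m p q x y =
      h.alpha l m p q x y + h.beta l m p q x y + h.gamma l m p q x y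

end Shuffle

section BarComplex

variable {k : Type u} [Field k] {A : DGA.{u, v} k}

/-- An augmentation: a morphism of differential graded algebras from `A` to `k` (placed in degree
zero, with zero differential). -/
structure Augmentation (A : DGA.{u, v} k) where
  toAlgHom : A.carrier →ₐ[k] k
  map_deg : ∀ (p : ℤ) (x : A), p ≠ 0 → x ∈ A.deg p → toAlgHom x = 0
  map_d : ∀ x : A, toAlgHom (A.d x) = 0

variable (ε : Augmentation A)

/-- The augmentation ideal. -/
def Augmentation.ideal : Submodule k A.carrier := LinearMap.ker ε.toAlgHom.toLinearMap

theorem Augmentation.mem_ideal {x : A} : x ∈ ε.ideal ↔ ε.toAlgHom x = 0 := LinearMap.mem_ker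

theorem Augmentation.map_sgn (x : A) : ε.toAlgHom (A.sgn x) = ε.toAlgHom x := by
  refine A.ext_of_deg (f := (ε.toAlgHom.toLinearMap.toAddMonoidHom).comp A.sgn.toAddMonoidHom)
    (g := ε.toAlgHom.toLinearMap.toAddMonoidHom) (fun p x hx => ?_) x
  change ε.toAlgHom (A.sgn x) = ε.toAlgHom x
  by_cases hp : p = 0
  · subst hp; rw [A.sgn_of_mem hx]; simp
  · rw [ε.map_deg p x hp hx, ε.map_deg p _ hp (A.sgn_mem hx)]

/-- The differential of the augmentation ideal. -/
def Augmentation.idealD : ε.ideal →ₗ[k] ε.ideal :=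
  A.d.restrict fun x _ => ε.mem_ideal.2 (ε.map_d x)

/-- The sign operator of `I[1]`, i.e. `x ↦ (-1)^{|x| - 1} x` with `|x|` the degree in `A`. -/
def Augmentation.idealSgn : ε.ideal →ₗ[k] ε.ideal :=
  -A.sgn.restrict fun x hx => ε.mem_ideal.2 ((ε.map_sgn x).trans (ε.mem_ideal.1 hx))

/-- The multiplication `μ` on the augmentation ideal, as an operator of degree one on `I[1]`. -/
def Augmentation.idealCup : ε.ideal →ₗ[k] ε.ideal →ₗ[k] ε.ideal :=
  LinearMap.mk₂ k
    (fun x y => ⟨A.cup x y, ε.mem_ideal.2 (by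
      change ε.toAlgHom (A.sgn x.1 * y.1) = 0
      rw [map_mul, ε.mem_ideal.1 y.2, mul_zero])⟩)
    (fun _ _ _ => Subtype.ext (by simp)) (fun _ _ _ => Subtype.ext (by simp))
    (fun _ _ _ => Subtype.ext (by simp)) (fun _ _ _ => Subtype.ext (by simp))

/-- The reduced bar complex `B_red(A, ε) = ⨁_n (I[1])^{⊗ n}`, with `I` the augmentation ideal. -/
abbrev Bar : Type (max u v) := ⨁ n : ℕ, ⨂[k]^n ε.ideal

/-- The inner differential on `(I[1])^{⊗ n}`: the sum over `i` of `1 ⊗ ... ⊗ d ⊗ ... ⊗ 1`, with the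
Koszul signs. -/
def barInner (n : ℕ) : (⨂[k]^n ε.ideal) →ₗ[k] ⨂[k]^n ε.ideal :=
  ∑ i : Fin n, PiTensorProduct.map fun j =>
    if j < i then ε.idealSgn else if j = i then ε.idealD else LinearMap.id

/-- The sequence of factors of `(1 ⊗ ... ⊗ μ ⊗ ... ⊗ 1)(x_0 ⊗ ... ⊗ x_n)`, with `μ` applied to
`x_i ⊗ x_{i+1}`, with the Koszul sign. -/
def barMerge {n : ℕ} (i : Fin n) (x : Fin (n + 1) → ε.ideal) : Fin n → ε.ideal :=
  fun j => if j < i then ε.idealSgn (x j.castSucc)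
    else if j = i then ε.idealCup (x i.castSucc) (x i.succ) else x j.succ

theorem barMerge_update {n : ℕ} (i : Fin n) (x : Fin (n + 1) → ε.ideal) (a : Fin (n + 1)) :
    ∃ (b : Fin n) (L : ε.ideal →ₗ[k] ε.ideal), ∀ v,
      barMerge ε i (Function.update x a v) = Function.update (barMerge ε i x) b (L v) := by
  have hu : ∀ (c : Fin (n + 1)) (v : ε.ideal), Function.update x a v c = if c = a then v else x c :=
    fun c v => by simp [Function.update_apply]
  have hi := i.2
  have ha := a.2
  rcases lt_trichotomy a.1 i.1 with h | h | h
  · refine ⟨⟨a.1, by omega⟩, ε.idealSgn, fun v => funext fun j => ?_⟩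
    simp only [barMerge, hu, Function.update_apply, Fin.ext_iff, Fin.lt_def, Fin.val_castSucc,
      Fin.val_succ]
    split_ifs <;> first | rfl | omega
  · refine ⟨i, ε.idealCup.flip (x i.succ), fun v => funext fun j => ?_⟩
    simp only [barMerge, hu, Function.update_apply, Fin.ext_iff, Fin.lt_def, Fin.val_castSucc,
      Fin.val_succ]
    split_ifs <;> first | rfl | omega
  · by_cases h' : a.1 = i.1 + 1
    · refine ⟨i, ε.idealCup (x i.castSucc), fun v => funext fun j => ?_⟩
      simp only [barMerge, hu, Function.update_apply, Fin.ext_iff, Fin.lt_def, Fin.val_castSucc,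
        Fin.val_succ]
      split_ifs <;> first | rfl | omega
    · refine ⟨⟨a.1 - 1, by omega⟩, LinearMap.id, fun v => funext fun j => ?_⟩
      simp only [barMerge, hu, Function.update_apply, Fin.ext_iff, Fin.lt_def, Fin.val_castSucc,
        Fin.val_succ]
      split_ifs <;> first | rfl | omega

/-- The bar differential `(I[1])^{⊗ (n+1)} → (I[1])^{⊗ n}`. -/
def barOuter (n : ℕ) : (⨂[k]^(n + 1) ε.ideal) →ₗ[k] ⨂[k]^n ε.ideal :=
  ∑ i : Fin n, PiTensorProduct.lift (MultilinearMap.mk'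
    (fun x => PiTensorProduct.tprod k (barMerge ε i x))
    (fun x a v w => by
      obtain ⟨b, L, h⟩ := barMerge_update ε i x a
      simp only [h, map_add, MultilinearMap.map_update_add])
    (fun x a c v => by
      obtain ⟨b, L, h⟩ := barMerge_update ε i x a
      simp only [h, map_smul, MultilinearMap.map_update_smul]))

/-- The inclusion of `(I[1])^{⊗ n}` in the reduced bar complex. -/
abbrev barIncl (n : ℕ) : (⨂[k]^n ε.ideal) →ₗ[k] Bar ε :=
  DirectSum.lof k ℕ (fun n => ⨂[k]^n ε.ideal) n

/-- The differential of the reduced bar complex. -/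
def barD : Bar ε →ₗ[k] Bar ε :=
  DirectSum.toModule k ℕ (Bar ε) fun n =>
    match n with
    | 0 => 0
    | n + 1 => barIncl ε (n + 1) ∘ₗ barInner ε (n + 1) + barIncl ε n ∘ₗ barOuter ε n

/-- The sign operator `z ↦ (-1)^{|z|} z` of the reduced bar complex. -/
def barSgn : Bar ε →ₗ[k] Bar ε :=
  DirectSum.toModule k ℕ (Bar ε) fun n =>
    barIncl ε n ∘ₗ PiTensorProduct.map fun _ => ε.idealSgn

/-- The elements of degree `r` of the reduced bar complex. -/
def barDeg (r : ℤ) : Submodule k (Bar ε) :=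
  Submodule.span k {z | ∃ (n : ℕ) (p : Fin n → ℤ) (x : Fin n → ε.ideal),
    (∀ i, (x i : A.carrier) ∈ A.deg (p i)) ∧ ∑ i, (p i - 1) = r ∧
      z = barIncl ε n (PiTensorProduct.tprod k x)}

/-- The differential `d ⊗ 1 + 1 ⊗ d` of `B_red ⊗ B_red`, with the Koszul sign. -/
def barTensorD : Bar ε ⊗[k] Bar ε →ₗ[k] Bar ε ⊗[k] Bar ε :=
  TensorProduct.map (barD ε) LinearMap.id + TensorProduct.map (barSgn ε) (barD ε)

/-- A morphism of complexes `B_red ⊗ B_red → B_red`. -/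
def IsBarComplexHom (μ : Bar ε ⊗[k] Bar ε →ₗ[k] Bar ε) : Prop :=
  (∀ (r s : ℤ) (z w : Bar ε), z ∈ barDeg ε r → w ∈ barDeg ε s →
    μ (z ⊗ₜ[k] w) ∈ barDeg ε (r + s)) ∧
  μ ∘ₗ barTensorD ε = barD ε ∘ₗ μ

end BarComplex

section ShuffleProduct

open Classical in
/-- The set of maps `f : {1, ..., l} ⊔ {1', ..., m'} → {1, ..., n}` which are surjective and
non-decreasing on both parts. -/
def shuffleSet (l m n : ℕ) : Finset (Fin l ⊕ Fin m → Fin n) :=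
  Finset.univ.filter fun f => Function.Surjective f ∧
    (∀ i j, i ≤ j → f (Sum.inl i) ≤ f (Sum.inl j)) ∧
    (∀ i j, i ≤ j → f (Sum.inr i) ≤ f (Sum.inr j))

/-- The part of the fibre of `f` over `r` in `{1, ..., l}`. -/
def leftFiber {l m n : ℕ} (f : Fin l ⊕ Fin m → Fin n) (r : Fin n) : Finset (Fin l) :=
  Finset.univ.filter fun i => f (Sum.inl i) = r

/-- The part of the fibre of `f` over `r` in `{1', ..., m'}`. -/
def rightFiber {l m n : ℕ} (f : Fin l ⊕ Fin m → Fin n) (r : Fin n) : Finset (Fin m) :=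
  Finset.univ.filter fun j => f (Sum.inr j) = r

/-- The exponent of the sign of the permutation `σ` which sorts the factors `x_i`, `y_j` by the
value of `f` (with the `x`'s before the `y`'s in each fibre): the sum, over all pairs which are
interchanged, of the products of the degrees in `A[1]`. -/
def koszulExponent {l m n : ℕ} (f : Fin l ⊕ Fin m → Fin n) (p : Fin l → ℤ) (q : Fin m → ℤ) : ℤ :=
  ∑ i, ∑ j, if f (Sum.inr j) < f (Sum.inl i) then (p i - 1) * (q j - 1) else 0

variable {k : Type u} [Field k] {A : DGA.{u, v} k} (ε : Augmentation A)

/-- The maps `h^{l,m}` restrict to the augmentation ideal. -/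
def ShuffleMaps.PreservesIdeal (h : ShuffleMaps A) : Prop :=
  ∀ (l m : ℕ) (x : Fin l → ε.ideal) (y : Fin m → ε.ideal),
    h l m (fun i => (x i : A.carrier)) (fun j => (y j : A.carrier)) ∈ ε.ideal

/-- `H(f)(x ⊗ y)` up to the sign of the permutation: the tensor product over the points `r` of the
target of `f` of the values of `h^{s',s''}` on the factors in the fibre over `r`. -/
def shuffleTerm {h : ShuffleMaps A} (hI : h.PreservesIdeal ε) {l m n : ℕ}
    (f : Fin l ⊕ Fin m → Fin n) (x : Fin l → ε.ideal) (y : Fin m → ε.ideal) : ⨂[k]^n ε.ideal :=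
  PiTensorProduct.tprod k fun r =>
    ⟨h (leftFiber f r).card (rightFiber f r).card
      (fun i => (x ((leftFiber f r).orderEmbOfFin rfl i) : A.carrier))
      (fun j => (y ((rightFiber f r).orderEmbOfFin rfl j) : A.carrier)),
      hI _ _ (fun i => x ((leftFiber f r).orderEmbOfFin rfl i))
        (fun j => y ((rightFiber f r).orderEmbOfFin rfl j))⟩

/-- The homotopy shuffle product attached to `h`: the linear map `B_red ⊗ B_red → B_red` with
`x ⊗ y ↦ ∑_n ∑_f ± H(f)(x ⊗ y)` for `x`, `y` tensors of homogeneous elements of `I`, where `f` runs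
over the shuffle maps with target `{1, ..., n}`. Such tensors span, so that this determines
the map. -/
def IsHomotopyShuffleProduct {h : ShuffleMaps A} (hI : h.PreservesIdeal ε)
    (μ : Bar ε ⊗[k] Bar ε →ₗ[k] Bar ε) : Prop :=
  ∀ (l m : ℕ) (p : Fin l → ℤ) (q : Fin m → ℤ) (x : Fin l → ε.ideal) (y : Fin m → ε.ideal),
    (∀ i, (x i : A.carrier) ∈ A.deg (p i)) → (∀ j, (y j : A.carrier) ∈ A.deg (q j)) →
    μ (barIncl ε l (PiTensorProduct.tprod k x) ⊗ₜ[k] barIncl ε m (PiTensorProduct.tprod k y)) =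
      ∑ n ∈ Finset.range (l + m + 1), ∑ f ∈ shuffleSet l m n,
        (koszulExponent f p q).negOnePow • barIncl ε n (shuffleTerm ε hI f x y)

end ShuffleProduct

end HomotopyShuffle

end

open HomotopyShuffle

/-!
The homotopies are brace operations. For Čech cochains `x, y_0, …, y_{m-1}` the brace
`x{y_0, …, y_{m-1}}` is the signed sum over all choices of intervals
`a_0 < b_0 ≤ a_1 < b_1 ≤ …` among the vertices of a simplex: `y_j` is evaluated on the interval
`[a_j, b_j]`, `x` on the simplex without the interiors of the intervals, and the values are
multiplied. Put `h^{0,1} = id`, let `h^{1,m}` be the brace with `m` arguments, so that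
`h^{1,0} = id`, and let all other maps vanish (`cechShuffle`).

*The system relations.* All components of the cochains at the faces of a simplex `J` may be moved to
the one algebra `A_J`, so that the relations are identities between cochains with values in a fixed
graded commutative algebra. These are proved for cochains on arbitrary lists of vertices, where
contraction with the last vertex gives simple recursions for the differential, for the product and
for the braces (`lastVertex_listD`, `lastVertex_listCup`, `lastVertex_brace_succ`). Since only
`h^{0,1}` and the `h^{1,m}` are non-zero, two families of identities remain
(`isHomotopyShuffleSystem_of_braces`). In the first one the differential of a brace produces the
products of the shorter brace with the outer arguments (`listD_brace_succ`); here graded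
commutativity enters only through the case of one argument, where the last value of `x` is moved
past a value of `y_0`. The second one is the distributivity of the braces over products in the first
entry (`brace_listCup`); here the values of the arguments inserted in the first factor are moved
past those of the second factor.

*Functoriality.* Pulling cochains on lists back along a map of vertices commutes with the braces
(`brace_map`), and braces of cochains which vanish on the lists that are not strictly ordered have
the same property. As `φ` is non-decreasing, this gives the compatibility with `φ_*`
(`PhiHom.induced_cechBrace`).

*Augmentations.* A brace with at least one argument vanishes on vertices. Cochains vanishing on
vertices are nilpotent, because `I` is finite, and hence lie in the kernel of every augmentation
(`augmentation_eq_zero`). If `I` has at most one element, all simplices are vertices, so that the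
braces with arguments are zero.

*The shuffle product is a chain map.* This holds for every homotopy shuffle system which preserves
the augmentation ideal. Functions of pairs of words in homogeneous letters form a convolution
algebra, and transposing the differential of the bar complex gives a derivation `biD` of the
convolution products, as the differential is a coderivation for deconcatenation (`biD_conv`). The
system relations say that the function `H` with values `h^{l,m}` satisfies `biD H = d H + H * H`,
the convolution being taken with respect to `μ` (`biD_wordApp`). Splitting off the first fibre of a
surjection shows that the sum over the surjections onto `n` elements is the `n`-th convolution power
of `H` with respect to the tensor product (`wordShuffle_ofFn`). The homotopy shuffle product is
therefore the geometric series, i.e. the solution `P` of `P = 1 + H * P` (`wordProduct_eq`). With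
this equation and the relation for `H`, the equation `biD P = d P` follows by induction on the
number of letters (`barD_wordProduct`): the terms `H * H` are cancelled by the bar differential,
which multiplies the first two factors. Finally, the signs depend only on the parities of the
degrees, so that the formula on homogeneous tensors extends to a linear map (`shuffleProduct`).
-/

noncomputable section

namespace HomotopyShuffle

/-! ### Cochains on lists -/

section ListCochains

variable {k : Type u} [Field k] {I : Type w} (R : DGA.{u, v} k)

/-- Cochains with values in `R` on the simplex of all lists of vertices. A list is read from its
last vertex to its first one, and repetitions are allowed, so that the identities below hold on
all lists, whether or not they are ordered. -/
abbrev ListCochain (I : Type w) (R : DGA.{u, v} k) : Type (max v w) := List I → R.carrier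

variable {R}

/-- The contraction `F ↦ F(- , v)` with the last vertex `v`. -/
def lastVertex (v : I) : ListCochain I R →ₗ[k] ListCochain I R :=
  LinearMap.funLeft k R.carrier (List.cons v)

/-- The sign operator of the shift: `(-1)^{p - 1}` on cochains of total degree `p`. -/
def shiftSign : ListCochain I R →ₗ[k] ListCochain I R :=
  LinearMap.pi fun w => ((-1 : k) ^ w.length) • (R.sgn ∘ₗ LinearMap.proj w)

/-- Multiplication on the right by a constant `c`, moved past the `w.length` vertices. -/
def rightMul (c : R) : ListCochain I R →ₗ[k] ListCochain I R :=
  LinearMap.pi fun w => LinearMap.mulRight k ((R.sgn ^ w.length) c) ∘ₗ LinearMap.proj w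

/-- Multiplication on the left by a constant. -/
def leftMul (c : R) : ListCochain I R →ₗ[k] ListCochain I R :=
  LinearMap.pi fun w => LinearMap.mulLeft k c ∘ₗ LinearMap.proj w

/-- The value of the total differential at a list. -/
def listDAt : List I → (ListCochain I R →ₗ[k] R.carrier)
  | [] => R.d ∘ₗ LinearMap.proj []
  | v :: w => listDAt w ∘ₗ lastVertex v + LinearMap.proj w ∘ₗ shiftSign

/-- The total differential: the inner differential plus the signed alternating sum of faces. -/
def listD : ListCochain I R →ₗ[k] ListCochain I R := LinearMap.pi listDAt

/-- The value of the cup product at a list. -/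
def listCupAt : List I → (ListCochain I R →ₗ[k] ListCochain I R →ₗ[k] R.carrier)
  | [] => 0
  | v :: w => (listCupAt w).compl₂ (lastVertex v) +
      (LinearMap.mul k R.carrier).compl₁₂ (LinearMap.proj (v :: w))
        ((R.sgn ^ w.length) ∘ₗ LinearMap.proj [v])

/-- The Alexander–Whitney product. The cuts are taken at the vertices of the list, so that the
product vanishes on the empty list. -/
def listCup : ListCochain I R →ₗ[k] ListCochain I R →ₗ[k] ListCochain I R :=
  LinearMap.mk₂ k (fun F G w => listCupAt w F G)
    (fun _ _ _ => by ext; simp) (fun _ _ _ => by ext; simp)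
    (fun _ _ _ => by ext; simp) (fun _ _ _ => by ext; simp)

/-- The recursion which produces a brace with one more argument `y` from the braces `β`. -/
def braceStep (β : ListCochain I R → (ℕ → ListCochain I R) → ListCochain I R) (m : ℕ) :
    List I → ListCochain I R → (ℕ → ListCochain I R) → R.carrier
  | [], _, _ => 0
  | v :: w, F, y => braceStep β m w (lastVertex v F) (fun j => shiftSign (y j)) -
      listCup (β (lastVertex v F) (fun j => shiftSign (y j))) (lastVertex v (y m)) w

/-- The brace `F{y_0, ..., y_{m-1}}`: the signed sum over all `a_0 < b_0 ≤ a_1 < b_1 ≤ ...` of the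
products of the values of the `y_j` on the intervals `[a_j, b_j]` with the value of `F` on the
simplex from which the interiors of these intervals are removed. The recursion distinguishes
whether the last vertex is the end of the last interval. -/
def brace : ℕ → ListCochain I R → (ℕ → ListCochain I R) → ListCochain I R
  | 0, F, _ => F
  | m + 1, F, y => fun w => braceStep (brace m) m w F y

@[simp] theorem lastVertex_apply (v : I) (F : ListCochain I R) (w : List I) :
    lastVertex v F w = F (v :: w) := rfl

theorem shiftSign_apply (F : ListCochain I R) (w : List I) :
    shiftSign F w = ((-1 : k) ^ w.length) • R.sgn (F w) := rfl

theorem rightMul_apply (c : R) (F : ListCochain I R) (w : List I) :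
    rightMul c F w = F w * (R.sgn ^ w.length) c := rfl

theorem leftMul_apply (c : R) (F : ListCochain I R) (w : List I) :
    leftMul c F w = c * F w := rfl

@[simp] theorem listD_nil (F : ListCochain I R) : listD F [] = R.d (F []) := rfl

theorem lastVertex_listD (v : I) (F : ListCochain I R) :
    lastVertex v (listD F) = listD (lastVertex v F) + shiftSign F := rfl

@[simp] theorem listCup_nil (F G : ListCochain I R) : listCup F G [] = 0 := rfl

theorem lastVertex_listCup (v : I) (F G : ListCochain I R) :
    lastVertex v (listCup F G) = listCup F (lastVertex v G) + rightMul (G [v]) (lastVertex v F) :=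
  rfl

@[simp] theorem brace_zero (F : ListCochain I R) (y : ℕ → ListCochain I R) : brace 0 F y = F := rfl

@[simp] theorem brace_succ_nil (m : ℕ) (F : ListCochain I R) (y : ℕ → ListCochain I R) :
    brace (m + 1) F y [] = 0 := rfl

theorem lastVertex_brace_succ (v : I) (m : ℕ) (F : ListCochain I R) (y : ℕ → ListCochain I R) :
    lastVertex v (brace (m + 1) F y) =
      brace (m + 1) (lastVertex v F) (fun j => shiftSign (y j)) -
        listCup (brace m (lastVertex v F) (fun j => shiftSign (y j))) (lastVertex v (y m)) :=
  rfl

/-- The value at `v :: w` is a value of the contraction with `v`. In this form identities of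
cochains are proved by induction on the list. -/
theorem cochain_cons {F G : ListCochain I R} {v : I} {w : List I}
    (h : lastVertex v F w = lastVertex v G w) : F (v :: w) = G (v :: w) := h

theorem lastVertex_shiftSign (v : I) (F : ListCochain I R) :
    lastVertex v (shiftSign F) = -shiftSign (lastVertex v F) := by
  ext w; simp [shiftSign_apply, pow_succ]

@[simp] theorem shiftSign_shiftSign (F : ListCochain I R) : shiftSign (shiftSign F) = F := by
  ext w
  rw [shiftSign_apply, shiftSign_apply, map_smul, R.sgn_sgn, smul_smul, ← mul_pow]
  simp

theorem lastVertex_rightMul (v : I) (c : R) (F : ListCochain I R) :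
    lastVertex v (rightMul c F) = rightMul (R.sgn c) (lastVertex v F) := by
  ext w; simp [rightMul_apply, pow_succ]

theorem lastVertex_leftMul (v : I) (c : R) (F : ListCochain I R) :
    lastVertex v (leftMul c F) = leftMul c (lastVertex v F) := rfl

theorem sgn_sgn_pow (n : ℕ) (c : R) : R.sgn ((R.sgn ^ n) c) = (R.sgn ^ n) (R.sgn c) := by
  rw [← Module.End.mul_apply, ← pow_succ', pow_succ, Module.End.mul_apply]

theorem shiftSign_rightMul (c : R) (F : ListCochain I R) :
    shiftSign (rightMul c F) = rightMul (R.sgn c) (shiftSign F) := by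
  ext w; simp [shiftSign_apply, rightMul_apply, R.sgn_mul, sgn_sgn_pow]

theorem rightMul_add (c c' : R) (F : ListCochain I R) :
    rightMul (c + c') F = rightMul c F + rightMul c' F := by
  ext w; simp [rightMul_apply, mul_add]

@[simp] theorem rightMul_zero (F : ListCochain I R) : rightMul (0 : R) F = 0 := by
  ext w; simp [rightMul_apply]

theorem rightMul_neg (c : R) (F : ListCochain I R) : rightMul (-c) F = -rightMul c F := by
  ext w; simp [rightMul_apply]

theorem rightMul_smul (a : k) (c : R) (F : ListCochain I R) :
    rightMul (a • c) F = a • rightMul c F := by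
  ext w; simp [rightMul_apply]

theorem shiftSign_listCup (F G : ListCochain I R) :
    shiftSign (listCup F G) = -listCup (shiftSign F) (shiftSign G) := by
  funext w
  induction w generalizing F G with
  | nil => simp [shiftSign_apply]
  | cons v w ih =>
    refine cochain_cons ?_
    simp only [lastVertex_shiftSign, lastVertex_listCup, map_add, map_neg, Pi.add_apply,
      Pi.neg_apply, ih, shiftSign_rightMul]
    simp [shiftSign_apply, rightMul_neg]

theorem shiftSign_listD (F : ListCochain I R) : shiftSign (listD F) = -listD (shiftSign F) := by
  funext w
  induction w generalizing F with
  | nil => simp [shiftSign_apply, R.sgn_d]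
  | cons v w ih =>
    refine cochain_cons ?_
    simp only [lastVertex_shiftSign, lastVertex_listD, map_add, map_neg, Pi.add_apply,
      Pi.neg_apply, ih, shiftSign_shiftSign]

theorem listD_rightMul (c : R) (F : ListCochain I R) :
    listD (rightMul c F) = rightMul c (listD F) + rightMul (R.d c) (shiftSign F) := by
  funext w
  induction w generalizing F c with
  | nil => simp [shiftSign_apply, rightMul_apply, R.leibniz']
  | cons v w ih =>
    refine cochain_cons ?_
    simp only [lastVertex_listD, lastVertex_rightMul, map_add, map_neg, Pi.add_apply,
      Pi.neg_apply, ih, shiftSign_rightMul, lastVertex_shiftSign, R.sgn_d, rightMul_neg]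
    abel

/-- The Leibniz rule, with correction terms for cochains which do not vanish on the empty list. -/
theorem listD_listCup (F G : ListCochain I R) :
    listD (listCup F G) = listCup (listD F) G - listCup (shiftSign F) (listD G) -
      leftMul (R.sgn (F [])) G + rightMul (G []) (shiftSign F) := by
  funext w
  induction w generalizing F G with
  | nil => simp [shiftSign_apply, rightMul_apply, leftMul_apply]
  | cons v w ih =>
    refine cochain_cons ?_
    have h1 : listD G [v] = R.d (G [v]) + R.sgn (G []) := by
      change lastVertex v (listD G) [] = _
      rw [lastVertex_listD]; simp [shiftSign_apply]
    have h2 : lastVertex v G [] = G [v] := rfl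
    simp only [lastVertex_listD, lastVertex_listCup, map_add, map_sub, map_neg, Pi.add_apply,
      Pi.neg_apply, Pi.sub_apply, ih, shiftSign_listCup, lastVertex_shiftSign, lastVertex_leftMul,
      lastVertex_rightMul, listD_rightMul, h1, h2, rightMul_add]
    abel

theorem listCup_rightMul (c : R) (F G : ListCochain I R) :
    listCup F (rightMul c G) = rightMul c (listCup F G) := by
  funext w
  induction w generalizing F G c with
  | nil => simp [rightMul_apply]
  | cons v w ih =>
    refine cochain_cons ?_
    simp only [lastVertex_listCup, lastVertex_rightMul, map_add, Pi.add_apply, ih]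
    simp [rightMul_apply, R.sgn_pow_mul, mul_assoc]

theorem listCup_assoc (F G H : ListCochain I R) :
    listCup (listCup F G) H = listCup F (listCup G H) := by
  funext w
  induction w generalizing F G H with
  | nil => simp
  | cons v w ih =>
    refine cochain_cons ?_
    have h1 : listCup G H [v] = G [v] * H [v] := by
      change lastVertex v (listCup G H) [] = _
      rw [lastVertex_listCup]; simp [rightMul_apply]
    simp only [lastVertex_listCup, map_add, Pi.add_apply, ih, h1, listCup_rightMul]
    simp [rightMul_apply, R.sgn_pow_mul, mul_assoc]
    abel

end ListCochains

/-! ### Multilinearity of the braces -/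

section BraceLinear

variable {k : Type u} [Field k] {I : Type w} {R : DGA.{u, v} k}

theorem brace_congr {m : ℕ} (F : ListCochain I R) {y z : ℕ → ListCochain I R}
    (h : ∀ j < m, y j = z j) : brace m F y = brace m F z := by
  induction m generalizing F y z with
  | zero => rfl
  | succ m ihm =>
    funext w
    induction w generalizing F y z with
    | nil => rfl
    | cons v w ih =>
      refine cochain_cons ?_
      have h' : ∀ j < m + 1, shiftSign (y j) = shiftSign (z j) := fun j hj => by rw [h j hj]
      simp only [lastVertex_brace_succ, Pi.sub_apply]
      rw [ih _ h', ihm _ (fun j hj => h' j (by omega)), h m (by omega)]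

theorem brace_add_left (m : ℕ) (F G : ListCochain I R) (y : ℕ → ListCochain I R) :
    brace m (F + G) y = brace m F y + brace m G y := by
  induction m generalizing F G y with
  | zero => rfl
  | succ m ihm =>
    funext w
    induction w generalizing F G y with
    | nil => simp
    | cons v w ih =>
      refine cochain_cons ?_
      simp only [lastVertex_brace_succ, Pi.sub_apply, map_add, ih, ihm, Pi.add_apply,
        LinearMap.add_apply]
      abel

theorem brace_smul (m : ℕ) (a : k) (c : ℕ → k) (F : ListCochain I R) (y : ℕ → ListCochain I R) :
    brace m (a • F) (fun j => c j • y j) = (a * ∏ j ∈ Finset.range m, c j) • brace m F y := by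
  induction m generalizing F y with
  | zero => simp
  | succ m ihm =>
    funext w
    induction w generalizing F y with
    | nil => simp
    | cons v w ih =>
      refine cochain_cons ?_
      simp only [lastVertex_brace_succ, Pi.sub_apply, map_smul, ih, ihm, Pi.smul_apply,
        LinearMap.smul_apply, smul_sub, Finset.prod_range_succ, smul_smul]
      congr 2
      ring

theorem brace_smul_left (m : ℕ) (a : k) (F : ListCochain I R) (y : ℕ → ListCochain I R) :
    brace m (a • F) y = a • brace m F y := by
  simpa using brace_smul m a (fun _ => 1) F y

theorem brace_neg_left (m : ℕ) (F : ListCochain I R) (y : ℕ → ListCochain I R) :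
    brace m (-F) y = -brace m F y := by
  rw [← neg_one_smul k F, brace_smul_left, neg_one_smul]

/-- The scalar by which one argument is multiplied can be pulled out. -/
theorem brace_smul_right {m i : ℕ} (hi : i < m) (a : k) (F : ListCochain I R)
    {y z : ℕ → ListCochain I R} (h : y i = a • z i) (h' : ∀ j ≠ i, y j = z j) :
    brace m F y = a • brace m F z := by
  have hy : y = fun j => (if j = i then a else 1) • z j := by
    funext j
    split_ifs with hj
    · rw [hj, h]
    · rw [one_smul, h' j hj]
  have := brace_smul m 1 (fun j => if j = i then a else 1) F z
  rw [one_smul, ← hy, Finset.prod_ite_eq', if_pos (Finset.mem_range.2 hi), one_mul] at this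
  exact this

theorem brace_neg_neg {m i : ℕ} (hi : i < m) (F : ListCochain I R)
    {y z : ℕ → ListCochain I R} (h : y i = -z i) (h' : ∀ j ≠ i, y j = z j) :
    brace m (-F) y = brace m F z := by
  rw [brace_neg_left, brace_smul_right hi (-1 : k) F (z := z) (by rw [h, neg_one_smul]) h',
    neg_one_smul, neg_neg]

theorem map_update_seq {V W : Type*} (f : V → W) (y : ℕ → V) (i : ℕ) (a : V) :
    (fun j => f (Function.update y i a j)) = Function.update (fun j => f (y j)) i (f a) := by
  funext j
  by_cases h : j = i
  · subst h; simp
  · simp [h]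

theorem brace_update_add {m i : ℕ} (hi : i < m) (F : ListCochain I R)
    (y : ℕ → ListCochain I R) (a b : ListCochain I R) :
    brace m F (Function.update y i (a + b)) =
      brace m F (Function.update y i a) + brace m F (Function.update y i b) := by
  induction m generalizing F y a b with
  | zero => omega
  | succ m ihm =>
    funext w
    induction w generalizing F y a b with
    | nil => simp
    | cons v w ih =>
      refine cochain_cons ?_
      simp only [lastVertex_brace_succ, Pi.sub_apply, Pi.add_apply, map_update_seq, map_add, ih]
      rcases Nat.lt_succ_iff_lt_or_eq.1 hi with h | rfl
      · rw [ihm h]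
        simp only [Function.update_of_ne h.ne', map_add, LinearMap.add_apply, Pi.add_apply]
        abel
      · simp only [Function.update_self, map_add, Pi.add_apply]
        rw [brace_congr (m := i) _ (z := fun j => shiftSign (y j)),
          brace_congr (m := i) _ (y := Function.update _ i (shiftSign a))
            (z := fun j => shiftSign (y j)),
          brace_congr (m := i) _ (y := Function.update _ i (shiftSign b))
            (z := fun j => shiftSign (y j))]
        · abel
        all_goals
          intro j hj
          rw [Function.update_of_ne hj.ne]

theorem shiftSign_brace (m : ℕ) (F : ListCochain I R) (y : ℕ → ListCochain I R) :
    shiftSign (brace m F y) = brace m (shiftSign F) (fun j => shiftSign (y j)) := by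
  induction m generalizing F y with
  | zero => rfl
  | succ m ihm =>
    funext w
    induction w generalizing F y with
    | nil => simp [shiftSign_apply]
    | cons v w ih =>
      refine cochain_cons ?_
      simp only [lastVertex_brace_succ, lastVertex_shiftSign, Pi.sub_apply, map_sub, Pi.neg_apply,
        ih, shiftSign_listCup, ihm, brace_neg_left, map_neg, LinearMap.neg_apply]
      abel

end BraceLinear

/-! ### The differential of a brace -/

section BraceDifferential

variable {k : Type u} [Field k] {I : Type w} {R : DGA.{u, v} k}

/-- The arguments of `(1 ⊗ ... ⊗ D ⊗ ... ⊗ 1)(y_0 ⊗ y_1 ⊗ ...)`, with `D` in position `j` and with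
the Koszul signs of the shifted degrees. -/
def slotD (y : ℕ → ListCochain I R) (j : ℕ) : ℕ → ListCochain I R :=
  fun i => if i < j then shiftSign (y i) else if i = j then listD (y i) else y i

/-- The arguments of `(1 ⊗ ... ⊗ μ ⊗ ... ⊗ 1)(y_0 ⊗ y_1 ⊗ ...)`, with `μ` applied to
`y_j ⊗ y_{j+1}` and with the Koszul signs of the shifted degrees. -/
def slotCup (y : ℕ → ListCochain I R) (j : ℕ) : ℕ → ListCochain I R :=
  fun i => if i < j then shiftSign (y i) else if i = j then
    -listCup (shiftSign (y i)) (y (i + 1)) else y (i + 1)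

/-- The sum of the braces in which `D` is applied to one of the arguments `y_j`. -/
def braceSlotD (m : ℕ) (F : ListCochain I R) (y : ℕ → ListCochain I R) : ListCochain I R :=
  ∑ j ∈ Finset.range m, brace m (shiftSign F) (slotD y j)

/-- The sum of the braces in which two consecutive arguments among `y_0, ..., y_n` are
multiplied. -/
def braceSlotCup (n : ℕ) (F : ListCochain I R) (y : ℕ → ListCochain I R) : ListCochain I R :=
  ∑ j ∈ Finset.range n, brace n (shiftSign F) (slotCup y j)

theorem brace_neg_slotD {n j : ℕ} (hj : j < n) (F : ListCochain I R) (y : ℕ → ListCochain I R) :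
    brace n (-F) (fun i => shiftSign (slotD y j i)) =
      brace n F (slotD (fun i => shiftSign (y i)) j) := by
  refine brace_neg_neg hj F ?_ fun i hi => ?_
  · simp [slotD, shiftSign_listD]
  · simp only [slotD]
    split_ifs <;> simp_all

theorem brace_neg_slotCup {n j : ℕ} (hj : j < n) (F : ListCochain I R)
    (y : ℕ → ListCochain I R) :
    brace n (-F) (fun i => shiftSign (slotCup y j i)) =
      brace n F (slotCup (fun i => shiftSign (y i)) j) := by
  refine brace_neg_neg hj F ?_ fun i hi => ?_
  · simp [slotCup, shiftSign_listCup]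
  · simp only [slotCup]
    split_ifs <;> simp_all

theorem lastVertex_braceSlotD (v : I) (m : ℕ) (F : ListCochain I R) (y : ℕ → ListCochain I R) :
    lastVertex v (braceSlotD (m + 1) F y) =
      braceSlotD (m + 1) (lastVertex v F) (fun i => shiftSign (y i)) -
      listCup (braceSlotD m (lastVertex v F) (fun i => shiftSign (y i))) (lastVertex v (y m)) +
      listCup (brace m (shiftSign (lastVertex v F)) y)
        (listD (lastVertex v (y m)) + shiftSign (y m)) := by
  have h1 : ∀ j ∈ Finset.range (m + 1),
      lastVertex v (brace (m + 1) (shiftSign F) (slotD y j)) =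
      brace (m + 1) (shiftSign (lastVertex v F)) (slotD (fun i => shiftSign (y i)) j) -
      listCup (brace m (-shiftSign (lastVertex v F)) (fun i => shiftSign (slotD y j i)))
        (lastVertex v (slotD y j m)) := by
    intro j hj
    rw [lastVertex_brace_succ, lastVertex_shiftSign, brace_neg_slotD (Finset.mem_range.1 hj)]
  have h2 : ∀ j ∈ Finset.range m,
      listCup (brace m (-shiftSign (lastVertex v F)) (fun i => shiftSign (slotD y j i)))
        (lastVertex v (slotD y j m)) =
      listCup (brace m (shiftSign (lastVertex v F)) (slotD (fun i => shiftSign (y i)) j))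
        (lastVertex v (y m)) := by
    intro j hj
    have hj := Finset.mem_range.1 hj
    rw [brace_neg_slotD hj, slotD, if_neg (by omega), if_neg (by omega)]
  have h3 : brace m (-shiftSign (lastVertex v F)) (fun i => shiftSign (slotD y m i)) =
      -brace m (shiftSign (lastVertex v F)) y := by
    rw [brace_neg_left, brace_congr]
    intro j hj
    simp [slotD, hj]
  have h4 : slotD y m m = listD (y m) := by simp [slotD]
  rw [braceSlotD, map_sum, Finset.sum_congr rfl h1, Finset.sum_sub_distrib,
    Finset.sum_range_succ (fun j => listCup (brace m _ _) _), Finset.sum_congr rfl h2, h3, h4,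
    lastVertex_listD, braceSlotD, braceSlotD, map_sum, LinearMap.sum_apply]
  simp only [map_neg, LinearMap.neg_apply]
  abel

theorem lastVertex_braceSlotCup (v : I) (n : ℕ) (F : ListCochain I R)
    (y : ℕ → ListCochain I R) :
    lastVertex v (braceSlotCup (n + 1) F y) =
      braceSlotCup (n + 1) (lastVertex v F) (fun i => shiftSign (y i)) -
      listCup (braceSlotCup n (lastVertex v F) (fun i => shiftSign (y i)))
        (lastVertex v (y (n + 1))) -
      listCup (brace n (shiftSign (lastVertex v F)) y)
        (lastVertex v (listCup (shiftSign (y n)) (y (n + 1)))) := by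
  have h1 : ∀ j ∈ Finset.range (n + 1),
      lastVertex v (brace (n + 1) (shiftSign F) (slotCup y j)) =
      brace (n + 1) (shiftSign (lastVertex v F)) (slotCup (fun i => shiftSign (y i)) j) -
      listCup (brace n (-shiftSign (lastVertex v F)) (fun i => shiftSign (slotCup y j i)))
        (lastVertex v (slotCup y j n)) := by
    intro j hj
    rw [lastVertex_brace_succ, lastVertex_shiftSign, brace_neg_slotCup (Finset.mem_range.1 hj)]
  have h2 : ∀ j ∈ Finset.range n,
      listCup (brace n (-shiftSign (lastVertex v F)) (fun i => shiftSign (slotCup y j i)))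
        (lastVertex v (slotCup y j n)) =
      listCup (brace n (shiftSign (lastVertex v F)) (slotCup (fun i => shiftSign (y i)) j))
        (lastVertex v (y (n + 1))) := by
    intro j hj
    have hj := Finset.mem_range.1 hj
    rw [brace_neg_slotCup hj]
    congr 2
    rw [slotCup, if_neg (by omega), if_neg (by omega)]
  have h3 : brace n (-shiftSign (lastVertex v F)) (fun i => shiftSign (slotCup y n i)) =
      -brace n (shiftSign (lastVertex v F)) y := by
    rw [brace_neg_left, brace_congr]
    intro j hj
    simp [slotCup, hj]
  have h4 : slotCup y n n = -listCup (shiftSign (y n)) (y (n + 1)) := by simp [slotCup]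
  rw [braceSlotCup, map_sum, Finset.sum_congr rfl h1, Finset.sum_sub_distrib,
    Finset.sum_range_succ (fun j => listCup (brace n _ _) _), Finset.sum_congr rfl h2, h3, h4,
    braceSlotCup, braceSlotCup, map_sum, LinearMap.sum_apply]
  simp only [map_neg, LinearMap.neg_apply]
  abel

/-- The sign `(-1)^n` as an element of the ground field. -/
def signK (k : Type u) [Field k] (n : ℤ) : k := ((n.negOnePow : ℤ) : k)

theorem signK_add (m n : ℤ) : signK k (m + n) = signK k m * signK k n := by
  simp [signK, Int.negOnePow_add]

theorem signK_eq {m n : ℤ} (h : Even (m - n)) : signK k m = signK k n := by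
  rw [signK, signK, (Int.negOnePow_eq_iff m n).2 h]

@[simp] theorem signK_zero : signK k 0 = 1 := by simp [signK]

@[simp] theorem signK_one : signK k 1 = -1 := by simp [signK]

theorem signK_succ (n : ℤ) : signK k (n + 1) = -signK k n := by simp [signK_add]

theorem signK_natCast (n : ℕ) : signK k n = (-1) ^ n := by
  induction n with
  | zero => simp
  | succ n ih => rw [Nat.cast_succ, signK_succ, ih, pow_succ]; ring

theorem negOnePow_smul_eq {M : Type*} [AddCommGroup M] [Module k M] (n : ℤ) (x : M) :
    n.negOnePow • x = signK k n • x := by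
  rw [signK, Units.smul_def, Int.cast_smul_eq_zsmul]

/-- Homogeneous cochains of total degree `p`. -/
def IsHomCochain (p : ℤ) (F : ListCochain I R) : Prop :=
  ∀ w, F w ∈ R.deg (p + 1 - w.length)

theorem DGA.sgn_of_mem' {p : ℤ} {x : R} (hx : x ∈ R.deg p) : R.sgn x = signK k p • x := by
  rw [R.sgn_of_mem hx, negOnePow_smul_eq (k := k)]

theorem DGA.sgn_pow_of_mem {p : ℤ} {x : R} (hx : x ∈ R.deg p) (n : ℕ) :
    (R.sgn ^ n) x = signK k (n * p) • x := by
  induction n with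
  | zero => simp
  | succ n ih =>
    rw [pow_succ', Module.End.mul_apply, ih, map_smul, R.sgn_of_mem' hx, smul_smul, ← signK_add]
    congr 2; push_cast; ring

theorem DGA.IsGradedCommutative.mul_comm' (hR : R.IsGradedCommutative) {p q : ℤ} {x y : R}
    (hx : x ∈ R.deg p) (hy : y ∈ R.deg q) : x * y = signK k (p * q) • (y * x) := by
  rw [hR p q x y hx hy, negOnePow_smul_eq (k := k)]

theorem IsHomCochain.shiftSign_eq {p : ℤ} {F : ListCochain I R} (hF : IsHomCochain p F) :
    shiftSign F = signK k (p - 1) • F := by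
  ext w
  rw [shiftSign_apply, R.sgn_of_mem' (hF w), smul_smul, ← signK_natCast, ← signK_add, Pi.smul_apply]
  congr 1
  exact signK_eq ⟨1, by ring⟩

theorem IsHomCochain.smul {p : ℤ} {F : ListCochain I R} (hF : IsHomCochain p F) (a : k) :
    IsHomCochain p (a • F) := fun w => Submodule.smul_mem _ _ (hF w)

theorem IsHomCochain.shiftSign {p : ℤ} {F : ListCochain I R} (hF : IsHomCochain p F) :
    IsHomCochain p (shiftSign F) := by
  rw [hF.shiftSign_eq]; exact hF.smul _

theorem IsHomCochain.lastVertex {p : ℤ} {F : ListCochain I R} (hF : IsHomCochain p F) (v : I) :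
    IsHomCochain (p - 1) (lastVertex v F) := fun w => by
  have := hF (v :: w)
  rw [List.length_cons] at this
  rw [lastVertex_apply]
  convert this using 2
  push_cast; ring

theorem rightMul_eq_leftMul (hR : R.IsGradedCommutative) {p q : ℤ} {F : ListCochain I R}
    (hF : IsHomCochain q F) {c : R} (hc : c ∈ R.deg p) :
    rightMul c F = signK k (p * (q + 1)) • leftMul c F := by
  ext w
  rw [rightMul_apply, Pi.smul_apply, leftMul_apply, R.sgn_pow_of_mem hc, mul_smul_comm,
    hR.mul_comm' (hF w) hc, smul_smul, ← signK_add]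
  congr 1
  exact signK_eq ⟨0, by ring⟩

theorem brace_lastVertex_nil (m : ℕ) (F : ListCochain I R) (y : ℕ → ListCochain I R) (v : I) :
    brace (m + 1) F y [v] = 0 := by
  change lastVertex v (brace (m + 1) F y) [] = 0
  rw [lastVertex_brace_succ]; simp

theorem listD_brace_one (hR : R.IsGradedCommutative) {p q : ℤ} {F : ListCochain I R}
    {y : ℕ → ListCochain I R} (hF : IsHomCochain p F) (hy : IsHomCochain q (y 0)) :
    -listD (brace 1 F y) + brace 1 (listD F) y + braceSlotD 1 F y =
      -(signK k ((p - 1) * (q - 1)) • listCup (shiftSign (y 0)) F) -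
        listCup (shiftSign F) (y 0) := by
  funext w
  induction w generalizing F y p q with
  | nil => simp [braceSlotD]
  | cons v w ih =>
    refine cochain_cons ?_
    have ih' := ih (hF.lastVertex v) (y := fun i => shiftSign (y i)) hy.shiftSign
    have f1 : signK k ((p - 1 - 1) * (q - 1)) • listCup (y 0) (lastVertex v F) =
        signK k ((p - 1) * (q - 1)) • listCup (shiftSign (y 0)) (lastVertex v F) := by
      rw [hy.shiftSign_eq, map_smul, LinearMap.smul_apply, smul_smul, ← signK_add]
      congr 1; exact signK_eq ⟨-(q - 1), by ring⟩
    have hc : F [v] ∈ R.deg p := by simpa using hF [v]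
    have f2 : leftMul (R.sgn (F [v])) (lastVertex v (y 0)) = -(signK k ((p - 1) * (q - 1)) •
        rightMul (F [v]) (shiftSign (lastVertex v (y 0)))) := by
      rw [(hy.lastVertex v).shiftSign_eq, rightMul_eq_leftMul hR ((hy.lastVertex v).smul _) hc,
        R.sgn_of_mem' hc, map_smul, smul_smul, smul_smul, ← signK_add, ← signK_add, ← neg_smul,
        ← signK_succ]
      rw [show leftMul (signK k p • F [v]) (lastVertex v (y 0)) =
        signK k p • leftMul (F [v]) (lastVertex v (y 0)) by ext w; simp [leftMul_apply]]
      congr 1; exact signK_eq ⟨p-p*q, by ring⟩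
    have hv : lastVertex v (y 0) [] = y 0 [v] := rfl
    have hv' : lastVertex v F [] = F [v] := rfl
    simp only [shiftSign_shiftSign] at ih'
    simp only [Pi.add_apply, Pi.neg_apply, Pi.sub_apply, f1, Pi.smul_apply] at ih'
    simp only [map_add, map_neg, map_sub, lastVertex_listD, lastVertex_brace_succ,
      lastVertex_braceSlotD, shiftSign_brace, listD_listCup, brace_add_left, brace_zero, hv, hv',
      map_smul, lastVertex_listCup, lastVertex_shiftSign, LinearMap.add_apply, f2,
      Pi.add_apply, Pi.neg_apply, Pi.sub_apply, Pi.smul_apply, smul_add, smul_neg]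
    have h0 : braceSlotD 0 (lastVertex v F) (fun i => shiftSign (y i)) = 0 := by simp [braceSlotD]
    rw [← sub_eq_zero] at ih' ⊢
    rw [h0, ← ih']
    simp only [map_zero, LinearMap.zero_apply, Pi.zero_apply]
    abel

end BraceDifferential

section BraceIdentities

variable {k : Type u} [Field k] {I : Type w} {R : DGA.{u, v} k}

@[simp] theorem leftMul_zero (F : ListCochain I R) : leftMul (0 : R) F = 0 := by
  ext w; simp [leftMul_apply]

/-- The braces `F{y_0, ..., y_n}` are homotopies: the failure of the brace to commute with the
differentials is given by the products with the outer arguments and by the braces of the products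
of consecutive arguments. Graded commutativity is used only for `n = 0`, where the last vertex of
`F` has to be moved past `y_0`. -/
theorem listD_brace_succ (hR : R.IsGradedCommutative) (n : ℕ) {p q : ℤ} {F : ListCochain I R}
    {y : ℕ → ListCochain I R} (hF : IsHomCochain p F) (hy : IsHomCochain q (y 0)) :
    -listD (brace (n + 1) F y) + brace (n + 1) (listD F) y + braceSlotD (n + 1) F y +
      braceSlotCup n F y =
      -(signK k ((p - 1) * (q - 1)) •
        listCup (shiftSign (y 0)) (brace n F (fun i => y (i + 1)))) -
      listCup (shiftSign (brace n F y)) (y n) := by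
  induction n generalizing p q F y with
  | zero => simpa [braceSlotCup] using listD_brace_one hR hF hy
  | succ n ihn =>
  funext w
  induction w generalizing F y p q with
  | nil => simp [braceSlotD, braceSlotCup]
  | cons v w ih =>
    refine cochain_cons ?_
    have ih' := ih (hF.lastVertex v) (y := fun i => shiftSign (y i)) hy.shiftSign
    have ihn' := congrArg (fun X => listCup X (lastVertex v (y (n + 1))) w)
      (ihn (hF.lastVertex v) (y := fun i => shiftSign (y i)) hy.shiftSign)
    have f1 : ∀ X : ListCochain I R, signK k ((p - 1 - 1) * (q - 1)) • listCup (y 0) X =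
        signK k ((p - 1) * (q - 1)) • listCup (shiftSign (y 0)) X := by
      intro X
      rw [hy.shiftSign_eq, map_smul, LinearMap.smul_apply, smul_smul, ← signK_add]
      congr 1; exact signK_eq ⟨-(q - 1), by ring⟩
    have hv : ∀ Z : ListCochain I R, lastVertex v Z [] = Z [v] := fun _ => rfl
    simp only [shiftSign_shiftSign, map_add, map_neg, map_sub, map_smul, LinearMap.add_apply,
      LinearMap.neg_apply, LinearMap.sub_apply, LinearMap.smul_apply, f1, listCup_assoc,
      shiftSign_brace, Pi.add_apply, Pi.neg_apply, Pi.sub_apply, Pi.smul_apply] at ih' ihn'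
    simp only [map_add, map_neg, map_sub, lastVertex_listD, lastVertex_brace_succ,
      lastVertex_braceSlotD, lastVertex_braceSlotCup, shiftSign_brace, listD_listCup,
      brace_add_left, brace_succ_nil, map_zero, smul_zero, hv, brace_neg_left, listCup_rightMul,
      shiftSign_shiftSign, rightMul_zero, leftMul_zero, Pi.zero_apply, LinearMap.neg_apply,
      map_smul, lastVertex_listCup, lastVertex_shiftSign, LinearMap.add_apply, smul_sub, smul_neg,
      brace_lastVertex_nil, Pi.add_apply, Pi.neg_apply, Pi.sub_apply, Pi.smul_apply, smul_add]
    rw [← sub_eq_zero] at ih' ihn' ⊢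
    rw [← sub_zero (0 : R.carrier)]
    nth_rw 1 [← ih']
    rw [← ihn']
    abel

/-! ### Braces of products -/

theorem IsHomCochain.of_lastVertex {p : ℤ} {F : ListCochain I R} {v : I} {w : List I}
    (h : HomotopyShuffle.lastVertex v F w ∈ R.deg (p - 1 + 1 - w.length)) :
    F (v :: w) ∈ R.deg (p + 1 - (v :: w).length) := by
  rw [lastVertex_apply] at h
  convert h using 2
  rw [List.length_cons]; push_cast; ring

theorem IsHomCochain.rightMul {p q : ℤ} {F : ListCochain I R} (hF : IsHomCochain p F) {c : R}
    (hc : c ∈ R.deg q) : IsHomCochain (p + q) (rightMul c F) := fun w => by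
  have := SetLike.mul_mem_graded (hF w) (R.sgn_pow_mem w.length hc)
  rw [rightMul_apply]
  convert this using 2
  ring

theorem IsHomCochain.listCup {p q : ℤ} {F G : ListCochain I R} (hF : IsHomCochain p F)
    (hG : IsHomCochain q G) : IsHomCochain (p + q) (listCup F G) := by
  intro w
  induction w generalizing p q F G with
  | nil => simp
  | cons v w ih =>
    refine IsHomCochain.of_lastVertex ?_
    rw [lastVertex_listCup]
    refine add_mem ?_ ?_
    · convert ih hF (hG.lastVertex v) using 2; ring
    · have hc : G [v] ∈ R.deg q := by simpa using hG [v]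
      convert (hF.lastVertex v).rightMul hc w using 2; ring

theorem brace_shiftSign {q : ℕ → ℤ} (m : ℕ) (F : ListCochain I R)
    {y : ℕ → ListCochain I R} (hy : ∀ j, IsHomCochain (q j) (y j)) :
    brace m F (fun j => shiftSign (y j)) = signK k (shiftDeg q m) • brace m F y := by
  have := brace_smul m 1 (fun j => signK k (q j - 1)) F y
  rw [one_smul, one_mul] at this
  rw [show (fun j => shiftSign (y j)) = fun j => signK k (q j - 1) • y j from
    funext fun j => (hy j).shiftSign_eq, this]
  congr 1
  rw [shiftDeg]
  induction m with
  | zero => simp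
  | succ m ih =>
    have := brace_smul m 1 (fun j => signK k (q j - 1)) F y
    rw [one_smul, one_mul] at this
    rw [Finset.sum_range_succ, Finset.prod_range_succ, signK_add, ih this]

/-- The recursion for the braces, with the sign operators on homogeneous arguments evaluated. -/
theorem lastVertex_brace_hom {q : ℕ → ℤ} (v : I) (m : ℕ) (F : ListCochain I R)
    {y : ℕ → ListCochain I R} (hy : ∀ j, IsHomCochain (q j) (y j)) :
    lastVertex v (brace (m + 1) F y) =
      signK k (shiftDeg q (m + 1)) • brace (m + 1) (lastVertex v F) y -
        signK k (shiftDeg q m) • listCup (brace m (lastVertex v F) y) (lastVertex v (y m)) := by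
  rw [lastVertex_brace_succ, brace_shiftSign _ _ hy, brace_shiftSign _ _ hy, map_smul,
    LinearMap.smul_apply]

/-- The maps `h^{1,m}` have degree zero with respect to the shifted degrees. -/
theorem IsHomCochain.brace {p : ℤ} {q : ℕ → ℤ} (m : ℕ) {F : ListCochain I R}
    {y : ℕ → ListCochain I R} (hF : IsHomCochain p F) (hy : ∀ j, IsHomCochain (q j) (y j)) :
    IsHomCochain (p + shiftDeg q m) (brace m F y) := by
  induction m generalizing p F with
  | zero => simpa [shiftDeg] using hF
  | succ m ihm =>
    intro w
    induction w generalizing p F with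
    | nil => simp
    | cons v w ih =>
      refine IsHomCochain.of_lastVertex ?_
      rw [lastVertex_brace_hom v m F hy]
      refine sub_mem (Submodule.smul_mem _ _ ?_) (Submodule.smul_mem _ _ ?_)
      · convert ih (hF.lastVertex v) using 2; ring
      · convert ((ihm (hF.lastVertex v)).listCup ((hy m).lastVertex v)) w using 2
        rw [shiftDeg, shiftDeg, Finset.sum_range_succ]; ring

theorem rightMul_listCup (hR : R.IsGradedCommutative) {p q : ℤ} {c : R} (hc : c ∈ R.deg p)
    (F : ListCochain I R) {G : ListCochain I R} (hG : IsHomCochain q G) :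
    listCup (rightMul c F) G = signK k (p * q) • rightMul c (listCup F G) := by
  funext w
  induction w generalizing G q with
  | nil => simp [rightMul_apply]
  | cons v w ih =>
    refine cochain_cons ?_
    have hg : G [v] ∈ R.deg q := by simpa using hG [v]
    have hg' := R.sgn_pow_mem w.length hg
    simp only [lastVertex_listCup, lastVertex_rightMul, map_add, map_smul, Pi.add_apply,
      Pi.smul_apply, ih (hG.lastVertex v), smul_add, R.sgn_of_mem' hc, rightMul_smul]
    congr 1
    · rw [smul_smul, ← signK_add]
      congr 1
      exact signK_eq ⟨-p, by ring⟩
    · simp only [rightMul_apply, lastVertex_apply, mul_assoc]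
      rw [R.sgn_pow_of_mem hc w.length, smul_mul_assoc, mul_smul_comm, mul_smul_comm,
        hR.mul_comm' hc hg', mul_smul_comm, mul_smul_comm]
      simp only [smul_smul, ← signK_add]
      congr 2; ring

theorem brace_rightMul (hR : R.IsGradedCommutative) {p : ℤ} {c : R} (hc : c ∈ R.deg p)
    (m : ℕ) (F : ListCochain I R) {q : ℕ → ℤ} {y : ℕ → ListCochain I R}
    (hy : ∀ j, IsHomCochain (q j) (y j)) :
    brace m (rightMul c F) y = signK k (p * shiftDeg q m) • rightMul c (brace m F y) := by
  induction m generalizing F with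
  | zero => simp [shiftDeg]
  | succ m ihm =>
    funext w
    induction w generalizing F with
    | nil => simp [rightMul_apply]
    | cons v w ih =>
      refine cochain_cons ?_
      simp only [lastVertex_brace_hom v m _ hy, lastVertex_rightMul, R.sgn_of_mem' hc,
        rightMul_smul, brace_smul_left, ihm, Pi.sub_apply, Pi.smul_apply, map_smul, map_sub,
        LinearMap.smul_apply, ih, rightMul_listCup hR hc _ ((hy m).lastVertex v), smul_sub,
        smul_smul, ← signK_add]
      congr 2
      · congr 1; ring
      · congr 1
        rw [shiftDeg, shiftDeg, Finset.sum_range_succ]; ring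

/-- Braces are distributive over products in the first argument. -/
theorem brace_listCup (hR : R.IsGradedCommutative) (m : ℕ) {p : ℤ} (G : ListCochain I R)
    {F : ListCochain I R} (hF : IsHomCochain p F) {q : ℕ → ℤ} {y : ℕ → ListCochain I R}
    (hy : ∀ j, IsHomCochain (q j) (y j)) :
    brace m (listCup G F) y = ∑ j ∈ Finset.range (m + 1), signK k (p * shiftDeg q j) •
      listCup (brace j G y) (brace (m - j) F (fun i => y (j + i))) := by
  have hdeg : ∀ a b : ℕ, a ≤ b → shiftDeg (fun i => q (a + i)) (b - a) =
      shiftDeg q b - shiftDeg q a := by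
    intro a b hab
    obtain ⟨c, rfl⟩ := Nat.exists_eq_add_of_le hab
    rw [shiftDeg, shiftDeg, shiftDeg, Nat.add_sub_cancel_left, Finset.sum_range_add]; ring
  induction m generalizing F p with
  | zero => simp [shiftDeg]
  | succ m ihm =>
    funext w
    induction w generalizing F p with
    | nil => simp
    | cons v w ih =>
      refine cochain_cons ?_
      have hc : F [v] ∈ R.deg p := by simpa using hF [v]
      have h1 : ∀ j ∈ Finset.range (m + 1), lastVertex v (listCup (brace j G y)
          (brace (m + 1 - j) F (fun i => y (j + i)))) =
          signK k (shiftDeg q (m + 1) - shiftDeg q j) • listCup (brace j G y)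
            (brace (m + 1 - j) (lastVertex v F) (fun i => y (j + i))) -
          signK k (shiftDeg q m - shiftDeg q j) • listCup (listCup (brace j G y)
            (brace (m - j) (lastVertex v F) (fun i => y (j + i)))) (lastVertex v (y m)) := by
        intro j hj
        have hj : j ≤ m := Nat.lt_succ_iff.1 (Finset.mem_range.1 hj)
        have e : m + 1 - j = m - j + 1 := by omega
        rw [lastVertex_listCup, e, brace_lastVertex_nil, rightMul_zero, add_zero,
          lastVertex_brace_hom v (m - j) F (fun i => hy (j + i)), ← e, hdeg _ _ hj,
          hdeg j (m + 1) (by omega), map_sub, map_smul, map_smul, listCup_assoc]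
        congr 6; omega
      rw [map_sum, Finset.sum_range_succ]
      simp only [map_smul]
      rw [Finset.sum_congr rfl fun j hj => by rw [h1 j hj]]
      simp only [lastVertex_brace_hom v m _ hy, lastVertex_listCup, brace_add_left,
        brace_rightMul hR hc _ _ hy, Pi.add_apply, Pi.sub_apply, Pi.smul_apply, map_add,
        LinearMap.add_apply, ihm (hF.lastVertex v), ih (hF.lastVertex v), map_smul,
        LinearMap.smul_apply, rightMul_listCup hR hc _ ((hy m).lastVertex v), Nat.sub_self,
        brace_zero, map_sub, map_sum, LinearMap.sum_apply, smul_sub, smul_add, Finset.smul_sum,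
        Finset.sum_apply, Finset.sum_sub_distrib, smul_smul, ← signK_add]
      rw [Finset.sum_range_succ (n := m + 1)]
      have e1 : ∀ a b : ℤ, signK k (b + (p - 1) * a) = signK k (p * a + (b - a)) :=
        fun a b => by congr 1; ring
      have e2 : shiftDeg q m + (p * shiftDeg q m + p * (q m - 1)) =
          p * shiftDeg q (m + 1) + shiftDeg q m := by
        rw [shiftDeg, shiftDeg, Finset.sum_range_succ]; ring
      simp only [e1, e2, Nat.sub_self, brace_zero, sub_self, add_zero]
      rw [add_comm (shiftDeg q (m + 1)) (p * shiftDeg q (m + 1))]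
      abel

end BraceIdentities

/-! ### Locality and naturality of the operations on lists -/

section Locality

variable {k : Type u} [Field k] {I : Type w} {R : DGA.{u, v} k}

/-- Two cochains agree on all sublists of `w`. -/
def AgreeOn (w : List I) (F G : ListCochain I R) : Prop := ∀ u, u.Sublist w → F u = G u

theorem AgreeOn.refl (w : List I) (F : ListCochain I R) : AgreeOn w F F := fun _ _ => rfl

theorem AgreeOn.mono {w w' : List I} {F G : ListCochain I R} (h : AgreeOn w F G)
    (hw : w'.Sublist w) : AgreeOn w' F G := fun u hu => h u (hu.trans hw)

theorem AgreeOn.tail {v : I} {w : List I} {F G : ListCochain I R} (h : AgreeOn (v :: w) F G) :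
    AgreeOn w F G := h.mono (List.sublist_cons_self v w)

theorem AgreeOn.self {w : List I} {F G : ListCochain I R} (h : AgreeOn w F G) : F w = G w :=
  h w (List.Sublist.refl w)

theorem AgreeOn.lastVertex {v : I} {w : List I} {F G : ListCochain I R}
    (h : AgreeOn (v :: w) F G) : AgreeOn w (lastVertex v F) (lastVertex v G) :=
  fun _ hu => h _ (hu.cons_cons v)

theorem AgreeOn.shiftSign {w : List I} {F G : ListCochain I R} (h : AgreeOn w F G) :
    AgreeOn w (shiftSign F) (shiftSign G) :=
  fun u hu => by rw [shiftSign_apply, shiftSign_apply, h u hu]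

theorem AgreeOn.listD {w : List I} {F G : ListCochain I R} (h : AgreeOn w F G) :
    AgreeOn w (listD F) (listD G) := by
  have key : ∀ {w : List I} {F G : ListCochain I R}, AgreeOn w F G →
      HomotopyShuffle.listD F w = HomotopyShuffle.listD G w := by
    intro w
    induction w with
    | nil => intro F G h; rw [listD_nil, listD_nil, h.self]
    | cons v w ih =>
      intro F G h
      refine cochain_cons ?_
      rw [lastVertex_listD, lastVertex_listD, Pi.add_apply, Pi.add_apply, ih h.lastVertex,
        h.tail.shiftSign.self]
  exact fun u hu => key (h.mono hu)

theorem AgreeOn.listCup {w : List I} {F F' G G' : ListCochain I R} (h : AgreeOn w F F')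
    (h' : AgreeOn w G G') : AgreeOn w (listCup F G) (listCup F' G') := by
  have key : ∀ {w : List I} {G G' : ListCochain I R}, AgreeOn w F F' → AgreeOn w G G' →
      HomotopyShuffle.listCup F G w = HomotopyShuffle.listCup F' G' w := by
    intro w
    induction w with
    | nil => intros; rfl
    | cons v w ih =>
      intro G G' h h'
      refine cochain_cons ?_
      rw [lastVertex_listCup, lastVertex_listCup, Pi.add_apply, Pi.add_apply,
        ih h.tail h'.lastVertex, rightMul_apply, rightMul_apply, h.lastVertex.self,
        h' [v] (by simp)]
  exact fun u hu => key (h.mono hu) (h'.mono hu)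

theorem AgreeOn.brace {w : List I} {m : ℕ} {F F' : ListCochain I R}
    {y y' : ℕ → ListCochain I R} (h : AgreeOn w F F') (h' : ∀ j, AgreeOn w (y j) (y' j)) :
    AgreeOn w (brace m F y) (brace m F' y') := by
  induction m generalizing w F F' y y' with
  | zero => exact h
  | succ m ihm =>
    have key : ∀ {w : List I} {F F' : ListCochain I R} {y y' : ℕ → ListCochain I R},
        AgreeOn w F F' → (∀ j, AgreeOn w (y j) (y' j)) →
        HomotopyShuffle.brace (m + 1) F y w = HomotopyShuffle.brace (m + 1) F' y' w := by
      intro w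
      induction w with
      | nil => intros; rfl
      | cons v w ih =>
        intro F F' y y' h h'
        refine cochain_cons ?_
        have h2 : ∀ j, AgreeOn w (HomotopyShuffle.shiftSign (y j))
          (HomotopyShuffle.shiftSign (y' j)) := fun j => (h' j).tail.shiftSign
        rw [lastVertex_brace_succ, lastVertex_brace_succ, Pi.sub_apply, Pi.sub_apply,
          ih h.lastVertex h2, (((ihm h.lastVertex h2).listCup (h' m).lastVertex)).self]
    exact fun u hu => key (h.mono hu) (fun j => (h' j).mono hu)

variable {R' : DGA.{u, v} k} (f : DGA.Hom R R')

theorem DGA.Hom.map_listCup (F G : ListCochain I R) (w : List I) :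
    f.toAlgHom (listCup F G w) =
      listCup (fun u => f.toAlgHom (F u)) (fun u => f.toAlgHom (G u)) w := by
  induction w generalizing F G with
  | nil => simp
  | cons v w ih =>
    refine Eq.trans ?_ (cochain_cons (F := listCup _ _) rfl).symm
    change f.toAlgHom (listCup F (lastVertex v G) w + F (v :: w) * (R.sgn ^ w.length) (G [v])) = _
    rw [map_add, ih, map_mul, f.map_sgn_pow]
    rfl

theorem DGA.Hom.map_brace (m : ℕ) (F : ListCochain I R) (y : ℕ → ListCochain I R) (w : List I) :
    f.toAlgHom (brace m F y w) =
      brace m (fun u => f.toAlgHom (F u)) (fun j u => f.toAlgHom (y j u)) w := by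
  induction m generalizing F y w with
  | zero => rfl
  | succ m ihm =>
    induction w generalizing F y with
    | nil => simp
    | cons v w ih =>
      have hs : (fun j u => f.toAlgHom (shiftSign (y j) u)) =
          fun j => shiftSign (fun u => f.toAlgHom (y j u)) := by
        funext j u; simp [shiftSign_apply, f.map_sgn]
      have hb : (fun u => f.toAlgHom (brace m (lastVertex v F) (fun j => shiftSign (y j)) u)) =
          brace m (lastVertex v fun u => f.toAlgHom (F u))
            (fun j => shiftSign fun u => f.toAlgHom (y j u)) := by
        funext u
        refine (ihm _ _ _).trans ?_
        rw [← hs]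
        rfl
      change f.toAlgHom (lastVertex v (brace (m + 1) F y) w) =
        lastVertex v (brace (m + 1) (fun u => f.toAlgHom (F u)) (fun j u => f.toAlgHom (y j u))) w
      rw [lastVertex_brace_succ, lastVertex_brace_succ, Pi.sub_apply, Pi.sub_apply, map_sub, ih,
        f.map_listCup, hb, ← hs]
      rfl

end Locality

/-! ### Cochains on ordered simplices -/

section Ordered

variable {k : Type u} [Field k] {I : Type w} [LinearOrder I] {R : DGA.{u, v} k}

/-- A cochain on the finite subsets of `I`, viewed as a cochain on lists which vanishes on the
lists that are not strictly ordered. -/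
def listOf : (Finset I → R.carrier) →ₗ[k] ListCochain I R where
  toFun f w := if w.Pairwise (· > ·) then f w.toFinset else 0
  map_add' f g := by ext w; simp only [Pi.add_apply]; split_ifs <;> simp
  map_smul' c f := by ext w; simp only [Pi.smul_apply, RingHom.id_apply]; split_ifs <;> simp

theorem listOf_of_pairwise (f : Finset I → R.carrier) {w : List I} (hw : w.Pairwise (· > ·)) :
    listOf (R := R) f w = f w.toFinset := if_pos hw

theorem card_toFinset_of_pairwise {w : List I} (hw : w.Pairwise (· > ·)) :
    w.toFinset.card = w.length :=
  List.toFinset_card_of_nodup (hw.imp fun h => h.ne')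

theorem agreeOn_lastVertex_listOf (f : Finset I → R.carrier) {v : I} {w : List I}
    (hw : (v :: w).Pairwise (· > ·)) :
    AgreeOn w (lastVertex v (listOf (R := R) f)) (listOf fun S => f (insert v S)) := by
  intro u hu
  have h1 : (v :: u).Pairwise (· > ·) := hw.sublist (hu.cons_cons v)
  rw [lastVertex_apply, listOf_of_pairwise f h1, listOf_of_pairwise _ (List.pairwise_cons.1 h1).2,
    List.toFinset_cons]

theorem listCup_listOf (f g : Finset I → R.carrier) {w : List I} (hw : w.Pairwise (· > ·)) :
    listCup (listOf f) (listOf g) w = ∑ v ∈ w.toFinset, f (lowPart w.toFinset v) *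
      (R.sgn ^ posIn w.toFinset v) (g (highPart w.toFinset v)) := by
  induction w generalizing g with
  | nil => simp
  | cons v w ih =>
    obtain ⟨hv, hw'⟩ := List.pairwise_cons.1 hw
    have hn : v ∉ w.toFinset := fun h => lt_irrefl _ (hv v (List.mem_toFinset.1 h))
    have hlt : ∀ a ∈ w.toFinset, a < v := fun a ha => hv a (List.mem_toFinset.1 ha)
    change listCup (listOf f) (lastVertex v (listOf g)) w +
      listOf (R := R) f (v :: w) * (R.sgn ^ w.length) (listOf (R := R) g [v]) = _
    rw [((AgreeOn.refl w (listOf f)).listCup (agreeOn_lastVertex_listOf g hw)).self,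
      ih _ hw', listOf_of_pairwise f hw, listOf_of_pairwise g (by simp), List.toFinset_cons,
      Finset.sum_insert hn, add_comm, ← card_toFinset_of_pairwise hw']
    set S := w.toFinset
    congr 1
    · have e1 : lowPart (insert v S) v = insert v S := by
        ext a; simp only [lowPart, Finset.mem_filter, Finset.mem_insert]; grind
      have e2 : posIn (insert v S) v = S.card := by
        unfold posIn; congr 1; ext a; simp only [Finset.mem_filter, Finset.mem_insert]; grind
      have e3 : highPart (insert v S) v = [v].toFinset := by
        ext a; simp only [highPart, Finset.mem_filter, Finset.mem_insert, List.mem_toFinset,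
          List.mem_singleton]; grind
      rw [e1, e2, e3]
    · refine Finset.sum_congr rfl fun u hu => ?_
      have huv := hlt u hu
      have e1 : lowPart (insert v S) u = lowPart S u := by
        ext a; simp only [lowPart, Finset.mem_filter, Finset.mem_insert]; grind
      have e2 : posIn (insert v S) u = posIn S u := by
        unfold posIn; congr 1; ext a; simp only [Finset.mem_filter, Finset.mem_insert]; grind
      have e3 : highPart (insert v S) u = insert v (highPart S u) := by
        ext a; simp only [highPart, Finset.mem_filter, Finset.mem_insert]; grind
      rw [e1, e2, e3]

theorem listD_listOf (f : Finset I → R.carrier) {w : List I} (hw : w.Pairwise (· > ·)) :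
    listD (listOf f) w = cutD R f w.toFinset := by
  induction w generalizing f with
  | nil => simp [cutD, listOf]
  | cons v w ih =>
    obtain ⟨hv, hw'⟩ := List.pairwise_cons.1 hw
    have hn : v ∉ w.toFinset := fun h => lt_irrefl _ (hv v (List.mem_toFinset.1 h))
    have hlt : ∀ a ∈ w.toFinset, a < v := fun a ha => hv a (List.mem_toFinset.1 ha)
    change listD (lastVertex v (listOf f)) w + shiftSign (listOf f) w = _
    rw [(agreeOn_lastVertex_listOf f hw).listD.self, ih _ hw', shiftSign_apply,
      listOf_of_pairwise f hw', List.toFinset_cons, cutD, cutD, Finset.sum_insert hn,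
      ← card_toFinset_of_pairwise hw']
    set S := w.toFinset
    rw [add_assoc]
    congr 1
    rw [add_comm]
    congr 1
    · have e2 : posIn (insert v S) v = S.card := by
        unfold posIn; congr 1; ext a; simp only [Finset.mem_filter, Finset.mem_insert]; grind
      rw [e2, Finset.erase_insert hn, negOnePow_smul_eq (k := k), signK_natCast]
    · refine Finset.sum_congr rfl fun u hu => ?_
      have huv := hlt u hu
      have e2 : posIn (insert v S) u = posIn S u := by
        unfold posIn; congr 1; ext a; simp only [Finset.mem_filter, Finset.mem_insert]; grind
      rw [e2, Finset.erase_insert_of_ne huv.ne']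

/-- The strictly decreasing list of the elements of a finite set. -/
def decList (S : Finset I) : List I := S.sort (· ≥ ·)

theorem decList_pairwise (S : Finset I) : (decList S).Pairwise (· > ·) :=
  (S.sortedGT_sort).pairwise

@[simp] theorem decList_toFinset (S : Finset I) : (decList S).toFinset = S := S.sort_toFinset _

@[simp] theorem decList_length (S : Finset I) : (decList S).length = S.card := S.length_sort _

theorem decList_eq {w : List I} (hw : w.Pairwise (· > ·)) : decList w.toFinset = w :=
  (List.toFinset_sort _ (hw.imp fun h => h.ne')).2 (hw.imp fun h => h.le)

end Ordered

/-! ### The braces of Čech cochains -/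

section CechBraces

variable {k : Type u} [Field k] {I : Type w} [LinearOrder I]
  {A : StrictCosimplicialCDGA.{u, v, w} k I}

/-- The restrictions of a Čech cochain to the faces of `J`, as a cochain with values in `A_J`. -/
def restr (J : Simplex I) : CechCarrier A →ₗ[k] ListCochain I (A.obj J) where
  toFun x := listOf fun S => x.res S J
  map_add' x y := by rw [← map_add]; congr 1; funext S; exact x.res_add y S J
  map_smul' c x := by rw [RingHom.id_apply, ← map_smul]; congr 1; funext S; exact x.res_smul c S J

theorem restr_apply {J : Simplex I} (x : CechCarrier A) {w : List I} (hw : w.Pairwise (· > ·)) :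
    restr J x w = x.res w.toFinset J := if_pos hw

theorem restr_decList {J : Simplex I} (x : CechCarrier A) : restr J x (decList J.1) = x J := by
  rw [restr_apply x (decList_pairwise _), decList_toFinset, CechCarrier.res_self]

theorem restr_isHom {p : ℤ} {x : CechCarrier A} (hx : x ∈ cechDeg A p) (J : Simplex I) :
    IsHomCochain p (restr J x) := by
  intro w
  by_cases hw : w.Pairwise (· > ·)
  · rw [restr_apply x hw, ← card_toFinset_of_pairwise hw]
    convert x.res_mem (S := w.toFinset) (T := J) hx using 2
    ring
  · rw [show restr J x w = 0 from if_neg hw]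
    exact zero_mem _

/-- The Čech cochain `x` is represented on the faces of `J` by the cochain `F`. -/
def RepresentedBy (J : Simplex I) (x : CechCarrier A) (F : ListCochain I (A.obj J)) : Prop :=
  AgreeOn (decList J.1) (restr J x) F

theorem representedBy_restr (J : Simplex I) (x : CechCarrier A) :
    RepresentedBy J x (restr J x) := AgreeOn.refl _ _

theorem subset_of_sublist_decList {J : Finset I} {u : List I} (hu : u.Sublist (decList J)) :
    u.toFinset ⊆ J := by
  intro a ha
  have := hu.subset (List.mem_toFinset.1 ha)
  rwa [← List.mem_toFinset, decList_toFinset] at this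

theorem RepresentedBy.eval {J : Simplex I} {x : CechCarrier A} {F : ListCochain I (A.obj J)}
    (h : RepresentedBy J x F) : x J = F (decList J.1) := by
  rw [← restr_decList x]; exact AgreeOn.self h

theorem RepresentedBy.smul {J : Simplex I} {x : CechCarrier A} {F : ListCochain I (A.obj J)}
    (h : RepresentedBy J x F) (c : k) : RepresentedBy J (c • x) (c • F) := fun u hu => by
  rw [map_smul, Pi.smul_apply, Pi.smul_apply, h u hu]

theorem RepresentedBy.mul {J : Simplex I} {x y : CechCarrier A} {F G : ListCochain I (A.obj J)}
    (hx : RepresentedBy J x F) (hy : RepresentedBy J y G) :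
    RepresentedBy J (x * y) (listCup F G) := fun u hu => by
  have hp := (decList_pairwise J.1).sublist hu
  rw [restr_apply _ hp, CechCarrier.mul_res x y (subset_of_sublist_decList hu),
    ← AgreeOn.listCup hx hy u hu]
  exact (listCup_listOf (fun S => x.res S J) (fun S => y.res S J) hp).symm

theorem RepresentedBy.d {J : Simplex I} {x : CechCarrier A} {F : ListCochain I (A.obj J)}
    (hx : RepresentedBy J x F) : RepresentedBy J (cechD A x) (listD F) := fun u hu => by
  have hp := (decList_pairwise J.1).sublist hu
  rw [restr_apply _ hp, cechD_res x (subset_of_sublist_decList hu), ← AgreeOn.listD hx u hu]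
  exact (listD_listOf (fun S => x.res S J) hp).symm

/-- The brace `x{y_0, ..., y_{m-1}}` of Čech cochains. -/
def cechBrace (m : ℕ) (x : CechCarrier A) (y : ℕ → CechCarrier A) : CechCarrier A :=
  ⟨fun J => brace m (restr J x) (fun j => restr J (y j)) (decList J.1)⟩

theorem map_restr {S T : Simplex I} (h : S.1 ⊆ T.1) (x : CechCarrier A) :
    AgreeOn (decList S.1) (fun u => (A.map h).toAlgHom (restr S x u)) (restr T x) := by
  intro u hu
  have hp := (decList_pairwise S.1).sublist hu
  change (A.map h).toAlgHom (restr S x u) = _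
  rw [restr_apply _ hp, restr_apply _ hp, CechCarrier.map_res x (subset_of_sublist_decList hu)]

theorem representedBy_cechBrace (J : Simplex I) (m : ℕ) (x : CechCarrier A)
    (y : ℕ → CechCarrier A) :
    RepresentedBy J (cechBrace m x y) (brace m (restr J x) (fun j => restr J (y j))) := by
  intro u hu
  have hp := (decList_pairwise J.1).sublist hu
  have hs := subset_of_sublist_decList hu
  rw [restr_apply _ hp, CechCarrier.res]
  split_ifs with hn
  · change (A.map hn.2).toAlgHom (brace m (restr ⟨u.toFinset, hn.1⟩ x)
      (fun j => restr ⟨u.toFinset, hn.1⟩ (y j)) (decList u.toFinset)) = _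
    rw [DGA.Hom.map_brace, (AgreeOn.brace (map_restr hn.2 x) fun j => map_restr hn.2 (y j)).self,
      decList_eq hp]
  · have hu0 : u = [] := by
      rw [← List.toFinset_eq_empty_iff, ← Finset.not_nonempty_iff_eq_empty]
      exact fun h => hn ⟨h, hs⟩
    subst hu0
    cases m with
    | zero =>
      rw [brace_zero, restr_apply _ (by simp)]
      exact (CechCarrier.res_empty x J).symm
    | succ m => rfl

theorem RepresentedBy.brace {J : Simplex I} {m : ℕ} {x : CechCarrier A} {y : ℕ → CechCarrier A}
    {F : ListCochain I (A.obj J)} {G : ℕ → ListCochain I (A.obj J)}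
    (hx : RepresentedBy J x F) (hy : ∀ j, RepresentedBy J (y j) (G j)) :
    RepresentedBy J (cechBrace m x y) (HomotopyShuffle.brace m F G) := fun u hu => by
  rw [representedBy_cechBrace J m x y u hu]
  exact AgreeOn.brace hx hy u hu

theorem cechBrace_zero (x : CechCarrier A) (y : ℕ → CechCarrier A) : cechBrace 0 x y = x :=
  cech_ext fun _ => restr_decList x

theorem cechBrace_apply (m : ℕ) (x : CechCarrier A) (y : ℕ → CechCarrier A) (J : Simplex I) :
    cechBrace m x y J = brace m (restr J x) (fun j => restr J (y j)) (decList J.1) := rfl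

theorem cechBrace_congr {m : ℕ} (x : CechCarrier A) {y z : ℕ → CechCarrier A}
    (h : ∀ j < m, y j = z j) : cechBrace m x y = cechBrace m x z :=
  cech_ext fun J => by
    rw [cechBrace_apply, cechBrace_apply, brace_congr _ fun j hj => by rw [h j hj]]

/-- A finite sequence, continued by zero. -/
def extendSeq {M : Type*} [Zero M] {m : ℕ} (y : Fin m → M) (j : ℕ) : M :=
  if h : j < m then y ⟨j, h⟩ else 0

theorem extendSeq_coe {M : Type*} [Zero M] {m : ℕ} (y : Fin m → M) (j : Fin m) :
    extendSeq y j = y j := dif_pos j.2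

theorem extendSeq_update {M : Type*} [Zero M] {m : ℕ} (y : Fin m → M) (j : Fin m) (a : M) :
    extendSeq (Function.update y j a) = Function.update (extendSeq y) j a := by
  funext i
  rw [Function.update_apply]
  split_ifs with h
  · subst h; rw [extendSeq_coe, Function.update_self]
  · unfold extendSeq
    split_ifs with h'
    · rw [Function.update_of_ne]
      exact fun e => h (congrArg Fin.val e)
    · rfl

theorem cechBrace_update_add {m i : ℕ} (hi : i < m) (x : CechCarrier A) (y : ℕ → CechCarrier A)
    (a b : CechCarrier A) : cechBrace m x (Function.update y i (a + b)) =
      cechBrace m x (Function.update y i a) + cechBrace m x (Function.update y i b) :=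
  cech_ext fun J => by
    simp only [CechCarrier.add_apply, cechBrace_apply, map_update_seq, map_add,
      brace_update_add hi, Pi.add_apply]

theorem cechBrace_update_smul {m i : ℕ} (hi : i < m) (x : CechCarrier A)
    (y : ℕ → CechCarrier A) (c : k) (a : CechCarrier A) :
    cechBrace m x (Function.update y i (c • a)) = c • cechBrace m x (Function.update y i a) :=
  cech_ext fun J => by
    simp only [CechCarrier.smul_apply, cechBrace_apply, map_update_seq, map_smul]
    rw [brace_smul_right hi c _ (z := Function.update (fun j => restr J (y j)) i (restr J a))]
    · rfl
    · simp
    · intro j hj; simp [hj]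

/-- The braces as multilinear maps in the arguments `y_j`. -/
def cechBraceMulti (m : ℕ) : CechCarrier A →ₗ[k]
    MultilinearMap k (fun _ : Fin m => CechCarrier A) (CechCarrier A) where
  toFun x := MultilinearMap.mk' (fun y => cechBrace m x (extendSeq y))
    (fun y i a b => by simp only [extendSeq_update, cechBrace_update_add i.2])
    (fun y i c a => by simp only [extendSeq_update, cechBrace_update_smul i.2])
  map_add' x x' := by
    ext y : 1
    refine cech_ext fun J => ?_
    simp [cechBrace_apply, brace_add_left]
  map_smul' c x := by
    ext y : 1
    refine cech_ext fun J => ?_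
    simp [cechBrace_apply, brace_smul_left]

variable [Finite I]

/-- The homotopy shuffle system of the Čech algebra: `h^{0,1}` is the identity, `h^{1,m}` is the
brace with `m` arguments, and all other maps vanish. -/
def cechShuffle (A : StrictCosimplicialCDGA.{u, v, w} k I) : ShuffleMaps (cech A)
  | 0, 1 => MultilinearMap.constOfIsEmpty k _
      (MultilinearMap.ofSubsingleton k (CechCarrier A) (CechCarrier A) (0 : Fin 1) LinearMap.id)
  | 1, m => MultilinearMap.ofSubsingleton k (CechCarrier A)
      (MultilinearMap k (fun _ : Fin m => CechCarrier A) (CechCarrier A)) (0 : Fin 1)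
      (cechBraceMulti m)
  | _, _ => 0

theorem cechShuffle_zero_one (x y : ℕ → cech A) : (cechShuffle A).app 0 1 x y = y 0 := rfl

theorem cechShuffle_one (m : ℕ) (x y : ℕ → cech A) :
    (cechShuffle A).app 1 m x y = cechBrace m (x 0) y := by
  change cechBrace m (x 0) (extendSeq fun j : Fin m => y j) = _
  exact cechBrace_congr _ fun j hj => extendSeq_coe (fun j : Fin m => y j) ⟨j, hj⟩

theorem cechShuffle_of_one_lt {l : ℕ} (hl : 1 < l) (m : ℕ) : cechShuffle A l m = 0 := by
  obtain ⟨l, rfl⟩ := Nat.exists_eq_add_of_lt hl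
  rw [show 1 + l + 1 = l + 2 by ring]
  rfl

theorem cechShuffle_zero {m : ℕ} (hm : m ≠ 1) : cechShuffle A 0 m = 0 := by
  match m, hm with
  | 0, _ => rfl
  | 1, h => exact absurd rfl h
  | m + 2, _ => rfl

end CechBraces

/-! ### The homotopy shuffle system of the Čech algebra -/

section System

variable {k : Type u} [Field k] {I : Type w}

section Signed

variable {R : DGA.{u, v} k}

theorem prod_signK_shiftDeg (q : ℕ → ℤ) {j m : ℕ} (hj : j ≤ m) :
    (∏ i ∈ Finset.range m, if i < j then signK k (q i - 1) else 1) = signK k (shiftDeg q j) := by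
  obtain ⟨c, rfl⟩ := Nat.exists_eq_add_of_le hj
  rw [Finset.prod_range_add, Finset.prod_eq_one (s := Finset.range c) (by simp), mul_one, shiftDeg]
  clear hj
  induction j with
  | zero => simp
  | succ j ih =>
    rw [Finset.prod_range_succ, Finset.sum_range_succ, signK_add, ← ih, if_pos (Nat.lt_succ_self j)]
    congr 1
    refine Finset.prod_congr rfl fun i hi => ?_
    have := Finset.mem_range.1 hi
    rw [if_pos this, if_pos (by omega)]

/-- The sign operators on `F` and on the arguments before position `j` make up the Koszul sign of
an operator of degree one moved past `F` and these arguments. -/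
theorem brace_signs {p : ℤ} {q : ℕ → ℤ} {j m : ℕ} (hj : j ≤ m) {F : ListCochain I R}
    {y z : ℕ → ListCochain I R} (hF : IsHomCochain p F)
    (h1 : ∀ i < j, y i = signK k (q i - 1) • z i) (h2 : ∀ i, j ≤ i → y i = z i) :
    brace m (shiftSign F) y = signK k (p - 1 + shiftDeg q j) • brace m F z := by
  have hy : y = fun i => (if i < j then signK k (q i - 1) else 1) • z i := by
    funext i
    split_ifs with h
    · exact h1 i h
    · rw [one_smul, h2 i (by omega)]
  rw [hy, hF.shiftSign_eq, brace_smul, prod_signK_shiftDeg q hj, signK_add]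

theorem brace_slotD_signed {p : ℤ} {q : ℕ → ℤ} {j m : ℕ} (hj : j < m) {F : ListCochain I R}
    {y : ℕ → ListCochain I R} (hF : IsHomCochain p F) (hy : ∀ j, IsHomCochain (q j) (y j)) :
    brace m (shiftSign F) (slotD y j) = signK k (p - 1 + shiftDeg q j) •
      brace m F (Function.update y j (listD (y j))) := by
  refine brace_signs hj.le hF (fun i hi => ?_) (fun i hi => ?_)
  · rw [slotD, if_pos hi, (hy i).shiftSign_eq, Function.update_of_ne hi.ne]
  · rw [slotD, if_neg (by omega), Function.update_apply]
    split_ifs with h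
    · rw [h]
    · rfl

theorem brace_slotCup_signed {p : ℤ} {q : ℕ → ℤ} {j n : ℕ} (hj : j < n) {F : ListCochain I R}
    {y z : ℕ → ListCochain I R} (hF : IsHomCochain p F) (hy : ∀ j, IsHomCochain (q j) (y j))
    (h1 : ∀ i < j, z i = y i) (h2 : z j = -listCup (shiftSign (y j)) (y (j + 1)))
    (h3 : ∀ i, j < i → z i = y (i + 1)) :
    brace n (shiftSign F) (slotCup y j) = signK k (p - 1 + shiftDeg q j) • brace n F z := by
  refine brace_signs hj.le hF (fun i hi => ?_) (fun i hi => ?_)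
  · rw [slotCup, if_pos hi, (hy i).shiftSign_eq, h1 i hi]
  · rw [slotCup, if_neg (by omega)]
    split_ifs with h
    · rw [h, h2]
    · rw [h3 i (by omega)]

end Signed

variable [LinearOrder I] {A : StrictCosimplicialCDGA.{u, v, w} k I}

theorem RepresentedBy.update {J : Simplex I} {y : ℕ → CechCarrier A}
    {G : ℕ → ListCochain I (A.obj J)} (hy : ∀ j, RepresentedBy J (y j) (G j)) (i : ℕ)
    {a : CechCarrier A} {F : ListCochain I (A.obj J)} (ha : RepresentedBy J a F) (j : ℕ) :
    RepresentedBy J (Function.update y i a j) (Function.update G i F j) := by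
  rw [Function.update_apply, Function.update_apply]
  split_ifs
  · exact ha
  · exact hy j

theorem cechBrace_mem {p : ℤ} {q : ℕ → ℤ} (m : ℕ) {x : CechCarrier A} {y : ℕ → CechCarrier A}
    (hx : x ∈ cechDeg A p) (hy : ∀ j, y j ∈ cechDeg A (q j)) :
    cechBrace m x y ∈ cechDeg A (p + shiftDeg q m) := by
  intro J
  have := ((restr_isHom hx J).brace m fun j => restr_isHom (hy j) J) (decList J.1)
  rw [decList_length] at this
  rw [cechBrace_apply]
  convert this using 2
  ring

theorem RepresentedBy.eval_d_brace {J : Simplex I} {m : ℕ} (x : CechCarrier A)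
    (y : ℕ → CechCarrier A) : cechD A (cechBrace m x y) J =
      listD (HomotopyShuffle.brace m (restr J x) fun j => restr J (y j)) (decList J.1) :=
  (representedBy_cechBrace J m x y).d.eval

/-- The operation `μ` on elements `x` of degree `p`. -/
def cechCup (p : ℤ) (x y : CechCarrier A) : CechCarrier A := signK k p • (x * y)

theorem RepresentedBy.cup {J : Simplex I} {p : ℤ} {x y : CechCarrier A}
    {F G : ListCochain I (A.obj J)} (hF : IsHomCochain p F)
    (hx : RepresentedBy J x F) (hy : RepresentedBy J y G) :
    RepresentedBy J (cechCup p x y) (-listCup (shiftSign F) G) := by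
  have e : -listCup (shiftSign F) G = signK k p • listCup F G := by
    rw [hF.shiftSign_eq, map_smul, LinearMap.smul_apply, ← neg_smul, ← signK_succ, sub_add_cancel]
  rw [e]
  exact (hx.mul hy).smul _

/-- Replace `y_j, y_{j+1}` by `μ(y_j ⊗ y_{j+1})`, for `y_j` of degree `q_j`. -/
def cechMerge (q : ℕ → ℤ) (y : ℕ → CechCarrier A) (j i : ℕ) : CechCarrier A :=
  if i < j then y i else if i = j then cechCup (q j) (y j) (y (j + 1)) else y (i + 1)

/-- The homotopy formula for the braces of homogeneous Čech cochains. -/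
theorem cechD_cechBrace (n : ℕ) {p : ℤ} {q : ℕ → ℤ} {x : CechCarrier A} {y : ℕ → CechCarrier A}
    (hx : x ∈ cechDeg A p) (hy : ∀ j, y j ∈ cechDeg A (q j)) :
    -cechD A (cechBrace (n + 1) x y) + cechBrace (n + 1) (cechD A x) y +
      ∑ j ∈ Finset.range (n + 1), signK k (p - 1 + shiftDeg q j) •
        cechBrace (n + 1) x (Function.update y j (cechD A (y j))) +
      ∑ j ∈ Finset.range n, signK k (p - 1 + shiftDeg q j) •
        cechBrace n x (cechMerge q y j) =
      signK k ((p - 1) * (q 0 - 1)) • cechCup (q 0) (y 0) (cechBrace n x fun i => y (i + 1)) +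
        cechCup (p + shiftDeg q n) (cechBrace n x y) (y n) := by
  refine cech_ext fun J => ?_
  have hF := restr_isHom hx J
  have hG := fun j => restr_isHom (hy j) J
  have hFr := representedBy_restr J x
  have hGr := fun j => representedBy_restr J (y j)
  have key := congrFun (listD_brace_succ (A.comm J) n (y := fun j => restr J (y j)) hF (hG 0))
    (decList J.1)
  have e1 : ∀ j ∈ Finset.range (n + 1), cechProj A J (signK k (p - 1 + shiftDeg q j) •
      cechBrace (n + 1) x (Function.update y j (cechD A (y j)))) =
      brace (n + 1) (shiftSign (restr J x)) (slotD (fun j => restr J (y j)) j) (decList J.1) := by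
    intro j hj
    rw [brace_slotD_signed (Finset.mem_range.1 hj) hF hG]
    exact ((hFr.brace (RepresentedBy.update hGr j (hGr j).d)).smul _).eval
  have e2 : ∀ j ∈ Finset.range n, cechProj A J (signK k (p - 1 + shiftDeg q j) •
      cechBrace n x (cechMerge q y j)) =
      brace n (shiftSign (restr J x)) (slotCup (fun j => restr J (y j)) j) (decList J.1) := by
    intro j hj
    rw [brace_slotCup_signed (Finset.mem_range.1 hj) hF hG
      (z := fun i => if i < j then restr J (y i) else if i = j then
        -listCup (shiftSign (restr J (y j))) (restr J (y (j + 1))) else restr J (y (i + 1)))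
      (fun i hi => if_pos hi) (by simp) (fun i hi => by rw [if_neg (by omega), if_neg (by omega)])]
    refine ((hFr.brace fun i => ?_).smul _).eval
    unfold cechMerge
    split_ifs
    · exact hGr i
    · exact RepresentedBy.cup (hG j) (hGr j) (hGr (j + 1))
    · exact hGr (i + 1)
  have e3 := ((RepresentedBy.cup (hG 0) (hGr 0)
    (representedBy_cechBrace J n x fun i => y (i + 1))).smul
      (signK k ((p - 1) * (q 0 - 1)))).eval
  have e4 := (RepresentedBy.cup (hF.brace n hG)
    (representedBy_cechBrace J n x y) (hGr n)).eval
  rw [CechCarrier.add_apply, CechCarrier.add_apply, CechCarrier.add_apply, CechCarrier.add_apply,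
    e3, e4, ((hFr.d).brace hGr).eval]
  change -(cechD A (cechBrace (n + 1) x y) J) + _ + cechProj A J _ + cechProj A J _ = _
  rw [RepresentedBy.eval_d_brace, map_sum, map_sum, Finset.sum_congr rfl e1,
    Finset.sum_congr rfl e2]
  simpa only [braceSlotD, braceSlotCup, Pi.add_apply, Pi.neg_apply, Pi.sub_apply, Finset.sum_apply,
    Pi.smul_apply, smul_neg, sub_eq_add_neg] using key

/-- Braces are multiplicative in their first entry: the arguments are distributed over the two
factors. -/
theorem cechBrace_cup (m : ℕ) {p p' : ℤ} {q : ℕ → ℤ} {x x' : CechCarrier A}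
    {y : ℕ → CechCarrier A} (hx : x ∈ cechDeg A p) (hx' : x' ∈ cechDeg A p')
    (hy : ∀ j, y j ∈ cechDeg A (q j)) :
    cechBrace m (cechCup p x x') y = ∑ j ∈ Finset.range (m + 1),
      signK k ((p' - 1) * shiftDeg q j) •
        cechCup (p + shiftDeg q j) (cechBrace j x y) (cechBrace (m - j) x' fun i => y (j + i)) := by
  refine cech_ext fun J => ?_
  have hF := restr_isHom hx J
  have hF' := restr_isHom hx' J
  have hG := fun j => restr_isHom (hy j) J
  have hGr := fun j => representedBy_restr J (y j)
  have hsum : ∀ f : ℕ → CechCarrier A, (∑ j ∈ Finset.range (m + 1), f j) J =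
    ∑ j ∈ Finset.range (m + 1), f j J := fun f => map_sum (cechProj A J) f _
  rw [((RepresentedBy.cup hF (representedBy_restr J x) (representedBy_restr J x')).brace
    hGr).eval, brace_neg_left, brace_listCup (A.comm J) m _ hF' hG, hsum, Pi.neg_apply,
    Finset.sum_apply, ← Finset.sum_neg_distrib]
  refine Finset.sum_congr rfl fun j hj => ?_
  have e := ((RepresentedBy.cup (hF.brace j hG)
    (representedBy_cechBrace J j x y)
    (representedBy_cechBrace J (m - j) x' fun i => y (j + i))).smul
      (signK k ((p' - 1) * shiftDeg q j))).eval
  rw [e, shiftSign_brace, brace_shiftSign _ _ hG, map_smul, LinearMap.smul_apply, ← smul_neg,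
    smul_smul, ← signK_add, show (p' - 1) * shiftDeg q j + shiftDeg q j = p' * shiftDeg q j by ring]
  simp only [Pi.smul_apply, Pi.neg_apply, smul_neg]

/-- Braces with at least one argument vanish on vertices. -/
theorem cechBrace_succ_vertex (m : ℕ) (x : CechCarrier A) (y : ℕ → CechCarrier A) (J : Simplex I)
    (hJ : J.1.card ≤ 1) : cechBrace (m + 1) x y J = 0 := by
  have h : (decList J.1).length ≤ 1 := by rwa [decList_length]
  rw [cechBrace_apply]
  match decList J.1, h with
  | [], _ => rfl
  | [v], _ => exact brace_lastVertex_nil m _ _ v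

variable [Finite I]

theorem DGA.cup_of_mem (R : DGA.{u, v} k) {p : ℤ} {x : R} (hx : x ∈ R.deg p) (y : R) :
    R.cup x y = signK k p • (x * y) := by
  change R.sgn x * y = _
  rw [R.sgn_of_mem' hx, smul_mul_assoc]

theorem DGA.mergeAt_of_mem (R : DGA.{u, v} k) {q : ℕ → ℤ} {y : ℕ → R}
    (hy : ∀ j, y j ∈ R.deg (q j)) (j i : ℕ) : R.mergeAt y j i =
      if i < j then y i else if i = j then signK k (q j) • (y j * y (j + 1)) else y (i + 1) := by
  rw [DGA.mergeAt, R.cup_of_mem (hy j)]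

theorem ShuffleMaps.app_eq_zero {R : DGA.{u, v} k} {h : ShuffleMaps R} {l m : ℕ} (h0 : h l m = 0)
    (x y : ℕ → R) : h.app l m x y = 0 := by
  rw [ShuffleMaps.app, h0]; rfl

/-- A homotopy shuffle system with `h^{l,m} = 0` for `l > 1` amounts to braces `b` which satisfy
the homotopy formula and are distributive over products in the first argument. -/
theorem isHomotopyShuffleSystem_of_braces {R : DGA.{u, v} k} {h : ShuffleMaps R}
    (b : ℕ → R → (ℕ → R) → R) (h_one : ∀ m x y, h.app 1 m x y = b m (x 0) y)
    (h_zero_one : ∀ x y, h.app 0 1 x y = y 0) (h_zero : ∀ m, m ≠ 1 → h 0 m = 0)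
    (h_vanish : ∀ l m, 1 < l → h l m = 0) (b_zero : ∀ x y, b 0 x y = x)
    (b_mem : ∀ (m : ℕ) {p : ℤ} {q : ℕ → ℤ} {x : R} {y : ℕ → R}, x ∈ R.deg p →
      (∀ j, y j ∈ R.deg (q j)) → b m x y ∈ R.deg (p + shiftDeg q m))
    (b_d : ∀ (n : ℕ) {p : ℤ} {q : ℕ → ℤ} {x : R} {y : ℕ → R}, x ∈ R.deg p →
      (∀ j, y j ∈ R.deg (q j)) →
      -R.d (b (n + 1) x y) + b (n + 1) (R.d x) y +
        ∑ j ∈ Finset.range (n + 1), signK k (p - 1 + shiftDeg q j) •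
          b (n + 1) x (Function.update y j (R.d (y j))) +
        ∑ j ∈ Finset.range n, signK k (p - 1 + shiftDeg q j) • b n x (fun i =>
          if i < j then y i else if i = j then signK k (q j) • (y j * y (j + 1)) else y (i + 1)) =
      signK k ((p - 1) * (q 0 - 1)) • signK k (q 0) • (y 0 * b n x fun i => y (i + 1)) +
        signK k (p + shiftDeg q n) • (b n x y * y n))
    (b_mul : ∀ (m : ℕ) {p p' : ℤ} {q : ℕ → ℤ} {x x' : R} {y : ℕ → R}, x ∈ R.deg p →
      x' ∈ R.deg p' → (∀ j, y j ∈ R.deg (q j)) →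
      b m (signK k p • (x * x')) y = ∑ j ∈ Finset.range (m + 1),
        signK k ((p' - 1) * shiftDeg q j) • signK k (p + shiftDeg q j) •
          (b j x y * b (m - j) x' fun i => y (j + i))) :
    IsHomotopyShuffleSystem R h where
  zero_zero := h_zero 0 (by simp)
  map_deg l m p q x y hx hy := by
    match l, m with
    | 0, 1 =>
      rw [h_zero_one]
      convert hy 0 using 2
      simp [shiftDeg]
    | 0, 0 => rw [ShuffleMaps.app_eq_zero (h_zero _ (by simp))]; exact zero_mem _
    | 0, m + 2 => rw [ShuffleMaps.app_eq_zero (h_zero _ (by simp))]; exact zero_mem _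
    | 1, m =>
      rw [h_one]
      convert b_mem m (hx 0) hy using 2
      simp only [shiftDeg, Finset.sum_range_one]
      ring
    | l + 2, m => rw [ShuffleMaps.app_eq_zero (h_vanish _ _ (by omega))]; exact zero_mem _
  one_zero x y := by rw [h_one, b_zero]
  zero_one := h_zero_one
  left_zero n hn := h_vanish n 0 hn
  right_zero n hn := h_zero n (by omega)
  homotopy_comm p q x y hx hy := by
    have key := b_d 0 (q := fun _ => q) (y := fun _ => y) hx (fun _ => hy)
    have e : ∀ x' z, b 1 x' (Function.update (fun _ => y) 0 z) =
        h 1 1 (fun _ => x') (fun _ => z) := fun x' z => by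
      rw [← h_one 1 (fun _ => x') (Function.update (fun _ => y) 0 z), ShuffleMaps.app]
      congr 1
      funext j
      simp [Subsingleton.elim j 0]
    have e' : ∀ x' z, b 1 x' (fun _ => z) = h 1 1 (fun _ => x') (fun _ => z) := fun x' z => by
      rw [← h_one 1 (fun _ => x') (fun _ => z), ShuffleMaps.app]
    simp only [zero_add, Finset.sum_range_one, Finset.range_zero, Finset.sum_empty, add_zero, e, e',
      b_zero, shiftDeg] at key
    rw [R.cup_of_mem hx, R.cup_of_mem hy, negOnePow_smul_eq (k := k), negOnePow_smul_eq (k := k),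
      add_comm (signK k p • _), ← key, add_assoc]
  higher l m hl hm hlm p q x y hx hy := by
    match l, hl, hlm with
    | 1, _, hlm =>
      obtain ⟨n, rfl⟩ : ∃ n, m = n + 2 := ⟨m - 2, by omega⟩
      have hp : shiftDeg p 1 = p 0 - 1 := by simp [shiftDeg]
      have hp0 : shiftDeg p 0 = 0 := by simp [shiftDeg]
      have key := b_d (n + 1) (hx 0) hy
      have e1 : h.alpha 1 (n + 2) p q x y =
          signK k ((p 0 - 1) * (q 0 - 1)) • R.cup (y 0) (b (n + 1) (x 0) fun i => y (i + 1)) +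
            R.cup (b (n + 1) (x 0) y) (y (n + 1)) := by
        rw [ShuffleMaps.alpha, Finset.sum_range_succ, Finset.sum_range_one,
          Finset.sum_eq_single 1, Finset.sum_eq_single (n + 1)]
        · rw [if_pos (by omega), if_pos (by omega), h_zero_one, h_one, h_one, Nat.sub_self,
            show n + 2 - (n + 1) = 1 by omega, h_zero_one, negOnePow_smul_eq (k := k),
            negOnePow_smul_eq (k := k)]
          simp [shiftDeg, add_comm 1]
        · intro j hj hne
          have := Finset.mem_range.1 hj
          split_ifs with hc
          · rw [ShuffleMaps.app_eq_zero (h := h) (l := 1 - 1) (h_zero (n + 2 - j) (by omega))]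
            simp
          · rfl
        · intro hc; exact absurd (Finset.mem_range.2 (by omega)) hc
        · intro j hj hne
          rw [ShuffleMaps.app_eq_zero (h_zero j hne)]
          simp
        · intro hc; exact absurd (Finset.mem_range.2 (by omega)) hc
      have e2 : h.beta 1 (n + 2) p q x y = 0 := by simp [ShuffleMaps.beta]
      have e3 : ∀ j, b (n + 1) (x 0) (R.mergeAt y j) = b (n + 1) (x 0) (fun i =>
          if i < j then y i else if i = j then signK k (q j) • (y j * y (j + 1)) else y (i + 1)) :=
        fun j => by congr 1; funext i; exact R.mergeAt_of_mem hy j i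
      rw [e1, e2, ShuffleMaps.gamma, ShuffleMaps.compD, Finset.sum_range_one, R.cup_of_mem (hy 0),
        R.cup_of_mem (b_mem (n + 1) (hx 0) hy), ← key]
      simp only [h_one, negOnePow_smul_eq (k := k), hp, hp0, Function.update_self, signK_zero,
        one_smul, show n + 2 - 1 = n + 1 from rfl, e3]
      abel
    | 2, _, _ =>
      have hp : shiftDeg p 0 = 0 := by simp [shiftDeg]
      have z : ∀ l m x y, 1 < l → h.app l m x y = 0 :=
        fun l m x y hl => ShuffleMaps.app_eq_zero (h_vanish l m hl) x y
      have e1 : h.alpha 2 m p q x y = b m (R.cup (x 0) (x 1)) y := by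
        rw [R.cup_of_mem (hx 0), b_mul m (hx 0) (hx 1) hy, ShuffleMaps.alpha,
          Finset.sum_range_succ, Finset.sum_range_succ, Finset.sum_range_one,
          Finset.sum_eq_zero, zero_add, add_eq_left.2]
        · refine Finset.sum_congr rfl fun j hj => ?_
          have := Finset.mem_range.1 hj
          rw [if_pos (by omega), h_one, h_one, R.cup_of_mem (b_mem j (hx 0) hy),
            negOnePow_smul_eq (k := k)]
          simp [shiftDeg]
        · refine Finset.sum_eq_zero fun j _ => ?_
          rw [z 2 _ _ _ (by omega)]; simp
        · intro j _
          rw [z (2 - 0) _ _ _ (by omega)]; simp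
      have e2 : h.beta 2 m p q x y = -b m (R.cup (x 0) (x 1)) y := by
        simp [ShuffleMaps.beta, h_one, hp, DGA.mergeAt]
      have e3 : h.gamma 2 m p q x y = 0 := by simp [ShuffleMaps.gamma, z]
      have e4 : h.compD 2 m p q x y = 0 := by simp [ShuffleMaps.compD, z]
      rw [e1, e2, e3, e4, z 2 _ _ _ (by omega)]
      simp
    | l + 3, _, _ =>
      have z : ∀ l m x y, 1 < l → h.app l m x y = 0 :=
        fun l m x y hl => ShuffleMaps.app_eq_zero (h_vanish l m hl) x y
      have e1 : h.alpha (l + 3) m p q x y = 0 := by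
        refine Finset.sum_eq_zero fun i hi => Finset.sum_eq_zero fun j hj => ?_
        by_cases hi' : 1 < i
        · rw [z i _ _ _ hi']; simp
        · rw [z (l + 3 - i) _ _ _ (by omega)]; simp
      rw [e1, z _ _ _ _ (by omega)]
      simp [ShuffleMaps.compD, ShuffleMaps.beta, ShuffleMaps.gamma, z]

theorem isHomotopyShuffleSystem_cechShuffle (A : StrictCosimplicialCDGA.{u, v, w} k I) :
    IsHomotopyShuffleSystem (cech A) (cechShuffle A) :=
  isHomotopyShuffleSystem_of_braces (cechBrace (A := A)) cechShuffle_one cechShuffle_zero_one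
    (fun _ => cechShuffle_zero) (fun _ m hl => cechShuffle_of_one_lt hl m) cechBrace_zero
    (fun m _ _ _ _ hx hy => cechBrace_mem m hx hy)
    (fun n _ _ _ _ hx hy => cechD_cechBrace n hx hy)
    (fun m _ _ _ _ _ _ hx hx' hy => cechBrace_cup m hx hx' hy)

end System

/-! ### Functoriality -/

section Functoriality

variable {k : Type u} [Field k] {I J : Type w}

section Pullback

variable {R : DGA.{u, v} k}

theorem brace_zero_left (m : ℕ) (y : ℕ → ListCochain I R) : brace m 0 y = 0 := by
  have := brace_smul_left m (0 : k) 0 y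
  rwa [zero_smul, zero_smul] at this

theorem listCup_map (φ : I → J) (F G : ListCochain J R) (w : List I) :
    listCup (fun u : List I => F (u.map φ)) (fun u => G (u.map φ)) w = listCup F G (w.map φ) := by
  induction w generalizing G with
  | nil => rfl
  | cons v w ih =>
    have h := ih (lastVertex (φ v) G)
    change listCup (fun u : List I => F (u.map φ)) (fun u => lastVertex (φ v) G (u.map φ)) w +
      F (φ v :: w.map φ) * (R.sgn ^ w.length) (G [φ v]) =
        listCup F (lastVertex (φ v) G) (w.map φ) +
          F (φ v :: w.map φ) * (R.sgn ^ (w.map φ).length) (G [φ v])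
    rw [h, List.length_map]

/-- Braces are compatible with maps of vertices. -/
theorem brace_map (φ : I → J) (m : ℕ) (F : ListCochain J R) (y : ℕ → ListCochain J R)
    (w : List I) : brace m (fun u : List I => F (u.map φ)) (fun j u => y j (u.map φ)) w =
      brace m F y (w.map φ) := by
  induction m generalizing F y w with
  | zero => rfl
  | succ m ihm =>
    induction w generalizing F y with
    | nil => rfl
    | cons v w ih =>
      have hs : (fun j => shiftSign fun u : List I => y j (u.map φ)) =
          fun j u => shiftSign (y j) (u.map φ) := by
        funext j u; simp [shiftSign_apply]
      have hl : ∀ G : ListCochain J R, (lastVertex v fun u : List I => G (u.map φ)) =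
          fun u => lastVertex (φ v) G (u.map φ) := fun G => rfl
      change lastVertex v (brace (m + 1) _ _) w = lastVertex (φ v) (brace (m + 1) F y) (w.map φ)
      rw [lastVertex_brace_succ, lastVertex_brace_succ, Pi.sub_apply, Pi.sub_apply, hs, hl, ih,
        ← listCup_map]
      have hb : (brace m (fun u : List I => lastVertex (φ v) F (u.map φ))
          fun j u => shiftSign (y j) (u.map φ)) = fun u => brace m (lastVertex (φ v) F)
            (fun j => shiftSign (y j)) (u.map φ) := funext fun u => ihm _ _ u
      rw [hb]
      rfl

end Pullback

section Vanishing

variable [LinearOrder J] {R : DGA.{u, v} k}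

/-- Cochains which vanish on the lists that are not strictly ordered. -/
def IsOrderedCochain (F : ListCochain J R) : Prop := ∀ w : List J, ¬w.Pairwise (· > ·) → F w = 0

theorem IsOrderedCochain.lastVertex {F : ListCochain J R} (hF : IsOrderedCochain F) (v : J) :
    IsOrderedCochain (lastVertex v F) :=
  fun _ hw => hF _ fun h => hw (List.pairwise_cons.1 h).2

theorem IsOrderedCochain.shiftSign {F : ListCochain J R} (hF : IsOrderedCochain F) :
    IsOrderedCochain (shiftSign F) := fun w hw => by
  rw [shiftSign_apply, hF w hw, map_zero, smul_zero]

theorem IsOrderedCochain.lastVertex_lastVertex {F : ListCochain J R} (hF : IsOrderedCochain F)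
    {v v' : J} (h : v ≤ v') :
    HomotopyShuffle.lastVertex v' (HomotopyShuffle.lastVertex v F) = 0 := by
  funext w
  refine hF _ fun hp => ?_
  exact absurd ((List.pairwise_cons.1 hp).1 v' (by simp)) (not_lt.2 h)

theorem not_pairwise_cons_cons {v v' : J} {w : List J} (h : ¬(v :: v' :: w).Pairwise (· > ·)) :
    ¬(v' :: w).Pairwise (· > ·) ∨ v ≤ v' := by
  by_contra! hc
  obtain ⟨h1, h2⟩ := hc
  refine h (List.pairwise_cons.2 ⟨fun a ha => ?_, h1⟩)
  rcases List.mem_cons.1 ha with rfl | ha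
  · exact h2
  · exact lt_trans ((List.pairwise_cons.1 h1).1 a ha) h2

theorem IsOrderedCochain.listCup {F G : ListCochain J R} (hF : IsOrderedCochain F)
    (hG : IsOrderedCochain G) : IsOrderedCochain (listCup F G) := by
  intro w
  induction w generalizing G with
  | nil => intro h; exact absurd List.Pairwise.nil h
  | cons v w ih =>
    intro hw
    refine Eq.trans (b := HomotopyShuffle.lastVertex v (HomotopyShuffle.listCup F G) w) rfl ?_
    rw [lastVertex_listCup, Pi.add_apply, rightMul_apply, lastVertex_apply, hF _ hw, zero_mul,
      add_zero]
    cases w with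
    | nil => rfl
    | cons v' w =>
      rcases not_pairwise_cons_cons hw with h | h
      · exact ih (hG.lastVertex v) h
      · refine Eq.trans (b := HomotopyShuffle.lastVertex v' (HomotopyShuffle.listCup F _) w) rfl ?_
        rw [lastVertex_listCup, hG.lastVertex_lastVertex h, map_zero, zero_add, rightMul_apply,
          lastVertex_apply, lastVertex_apply, hG [v, v'], map_zero, mul_zero]
        simpa using h

theorem IsOrderedCochain.brace {m : ℕ} {F : ListCochain J R} {y : ℕ → ListCochain J R}
    (hF : IsOrderedCochain F) (hy : ∀ j, IsOrderedCochain (y j)) :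
    IsOrderedCochain (brace m F y) := by
  induction m generalizing F y with
  | zero => exact hF
  | succ m ihm =>
    intro w
    induction w generalizing F y with
    | nil => intro _; rfl
    | cons v w ih =>
      intro hw
      refine Eq.trans (b := HomotopyShuffle.lastVertex v (HomotopyShuffle.brace (m + 1) F y) w)
        rfl ?_
      have hb := ihm (hF.lastVertex v) (fun j => (hy j).shiftSign)
      rw [lastVertex_brace_succ, Pi.sub_apply]
      cases w with
      | nil => simp
      | cons v' w =>
        rcases not_pairwise_cons_cons hw with h | h
        · rw [ih (hF.lastVertex v) (fun j => (hy j).shiftSign) h,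
            hb.listCup ((hy m).lastVertex v) _ h, sub_zero]
        · have h1 : HomotopyShuffle.brace (m + 1) (HomotopyShuffle.lastVertex v F)
              (fun j => HomotopyShuffle.shiftSign (y j)) (v' :: w) = 0 := by
            refine Eq.trans (b := HomotopyShuffle.lastVertex v' (HomotopyShuffle.brace (m + 1)
              (HomotopyShuffle.lastVertex v F) (fun j => HomotopyShuffle.shiftSign (y j))) w)
              rfl ?_
            rw [lastVertex_brace_succ, hF.lastVertex_lastVertex h, brace_zero_left,
              brace_zero_left, map_zero, LinearMap.zero_apply, sub_zero, Pi.zero_apply]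
          have h2 : HomotopyShuffle.listCup (HomotopyShuffle.brace m
              (HomotopyShuffle.lastVertex v F) (fun j => HomotopyShuffle.shiftSign (y j)))
              (HomotopyShuffle.lastVertex v (y m)) (v' :: w) = 0 := by
            refine Eq.trans (b := HomotopyShuffle.lastVertex v' (HomotopyShuffle.listCup
              (HomotopyShuffle.brace m (HomotopyShuffle.lastVertex v F)
              (fun j => HomotopyShuffle.shiftSign (y j))) (HomotopyShuffle.lastVertex v (y m))) w)
              rfl ?_
            have h0 : y m [v, v'] = 0 := hy m _ (by simpa using h)
            rw [lastVertex_listCup, (hy m).lastVertex_lastVertex h, map_zero, zero_add,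
              rightMul_apply, lastVertex_apply _ (y m), h0, map_zero, mul_zero]
          rw [h1, h2, sub_zero]

end Vanishing

section Induced

variable [LinearOrder I] [LinearOrder J] {φ : I →o J} {B : StrictCosimplicialCDGA.{u, v, w} k J}
  {A : StrictCosimplicialCDGA.{u, v, w} k I} (τ : PhiHom φ B A)

open Classical in
theorem PhiHom.induced_apply (b : CechCarrier B) (S : Simplex I) :
    τ.induced b S = if Set.InjOn φ (S.1 : Set I) then
      (τ.app (S := S) (T := ⟨S.1.image φ, S.2.image φ⟩) (Finset.Subset.refl _)).toAlgHom
        (b ⟨S.1.image φ, S.2.image φ⟩) else 0 := rfl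

theorem toFinset_map' (φ : I → J) (u : List I) : (u.map φ).toFinset = u.toFinset.image φ := by
  ext a; simp

theorem pairwise_map_iff {u : List I} (hu : u.Pairwise (· > ·)) :
    (u.map φ).Pairwise (· > ·) ↔ Set.InjOn φ (u.toFinset : Set I) := by
  rw [List.pairwise_map]
  constructor
  · intro h a ha b hb hab
    simp only [List.coe_toFinset, Set.mem_ofPred_eq] at ha hb
    by_contra hne
    have hsym : ∀ x ∈ u, ∀ y ∈ u, x ≠ y → φ x ≠ φ y := fun x hx y hy hxy =>
      List.Pairwise.forall_of_forall_of_flip (R := fun x y => x ≠ y → φ x ≠ φ y)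
        (fun x _ h => absurd rfl h) (h.imp fun h _ => h.ne') (h.imp fun h _ => h.ne) hx hy hxy
    exact hsym a ha b hb hne hab
  · intro h
    refine hu.imp_of_mem fun {a b} ha hb hab => ?_
    refine lt_of_le_of_ne (φ.monotone hab.le) fun e => hab.ne (h ?_ ?_ e)
    · simpa using hb
    · simpa using ha

theorem PhiHom.restr_induced (b : CechCarrier B) (S : Simplex I) :
    AgreeOn (decList S.1) (restr S (τ.induced b)) (fun u =>
      (τ.app (S := S) (T := ⟨S.1.image φ, S.2.image φ⟩) (Finset.Subset.refl _)).toAlgHom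
        (restr ⟨S.1.image φ, S.2.image φ⟩ b (u.map φ))) := by
  classical
  intro u hu
  have hp := (decList_pairwise S.1).sublist hu
  have hs := subset_of_sublist_decList hu
  rw [restr_apply _ hp]
  have hT : u.toFinset.image φ ⊆ S.1.image φ := Finset.image_subset_image hs
  have hR : restr ⟨S.1.image φ, S.2.image φ⟩ b (u.map φ) =
      if Set.InjOn φ (u.toFinset : Set I) then
        b.res (u.toFinset.image φ) ⟨S.1.image φ, S.2.image φ⟩ else 0 := by
    split_ifs with h
    · rw [restr_apply _ ((pairwise_map_iff hp).2 h), toFinset_map']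
    · exact if_neg fun h' => h ((pairwise_map_iff hp).1 h')
  beta_reduce
  rw [hR]
  unfold CechCarrier.res
  by_cases hn : u.toFinset.Nonempty
  · rw [dif_pos ⟨hn, hs⟩, dif_pos ⟨hn.image φ, hT⟩, PhiHom.induced_apply]
    split_ifs with h
    · exact τ.natural (S := ⟨u.toFinset, hn⟩) (S' := S) (T := ⟨_, hn.image φ⟩)
        (T' := ⟨S.1.image φ, S.2.image φ⟩) (Finset.Subset.refl _) (Finset.Subset.refl _) hs hT _
    · rw [map_zero, map_zero]
  · rw [dif_neg fun h => hn h.1, dif_neg fun h => hn (by simpa using h.1)]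
    simp

/-- The braces are functorial. -/
theorem PhiHom.induced_cechBrace (m : ℕ) (x : CechCarrier B) (y : ℕ → CechCarrier B) :
    τ.induced (cechBrace m x y) = cechBrace m (τ.induced x) (fun j => τ.induced (y j)) := by
  classical
  refine cech_ext fun S => ?_
  have hord : ∀ b : CechCarrier B, IsOrderedCochain (fun u =>
      (τ.app (S := S) (T := ⟨S.1.image φ, S.2.image φ⟩) (Finset.Subset.refl _)).toAlgHom
        (restr ⟨S.1.image φ, S.2.image φ⟩ b u)) := fun b u hu => by
    dsimp only
    rw [show restr ⟨S.1.image φ, S.2.image φ⟩ b u = 0 from if_neg hu, map_zero]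
  rw [cechBrace_apply, ((AgreeOn.brace (τ.restr_induced x S)
    fun j => τ.restr_induced (y j) S)).self]
  rw [brace_map φ m (fun u => (τ.app (S := S) (T := ⟨S.1.image φ, S.2.image φ⟩)
    (Finset.Subset.refl _)).toAlgHom (restr ⟨S.1.image φ, S.2.image φ⟩ x u))
    (fun j u => (τ.app (S := S) (T := ⟨S.1.image φ, S.2.image φ⟩)
    (Finset.Subset.refl _)).toAlgHom (restr ⟨S.1.image φ, S.2.image φ⟩ (y j) u)),
    PhiHom.induced_apply]
  have hp := pairwise_map_iff (φ := φ) (decList_pairwise S.1)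
  rw [decList_toFinset] at hp
  split_ifs with h
  · rw [cechBrace_apply, DGA.Hom.map_brace]
    congr 1
    have := decList_eq (hp.2 h)
    rw [toFinset_map', decList_toFinset] at this
    exact this
  · exact ((hord x).brace (fun j => hord (y j)) _ fun h' => h (hp.1 h')).symm

variable [Finite I] [Finite J]

theorem cechShuffle_functorial (l m : ℕ) (x : Fin l → CechCarrier B) (y : Fin m → CechCarrier B) :
    τ.induced (cechShuffle B l m x y) =
      cechShuffle A l m (fun i => τ.induced (x i)) (fun j => τ.induced (y j)) := by
  match l, m with
  | 0, 0 => exact map_zero τ.induced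
  | 0, 1 => rfl
  | 0, m + 2 => exact map_zero τ.induced
  | l + 2, m => exact map_zero τ.induced
  | 1, m =>
    change τ.induced (cechBrace m (x 0) (extendSeq y)) =
      cechBrace m (τ.induced (x 0)) (extendSeq fun j => τ.induced (y j))
    rw [PhiHom.induced_cechBrace]
    refine cechBrace_congr _ fun j hj => ?_
    simp [extendSeq, hj]

end Induced

end Functoriality

/-! ### Augmentations -/

section Augmentations

variable {k : Type u} [Field k] {I : Type w} [LinearOrder I]
  {A : StrictCosimplicialCDGA.{u, v, w} k I}

theorem res_eq_zero {a : CechCarrier A} {n : ℕ} (ha : ∀ J : Simplex I, J.1.card ≤ n → a J = 0)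
    {S : Finset I} (hS : S.card ≤ n) (T : Simplex I) : a.res S T = 0 := by
  unfold CechCarrier.res
  split_ifs with h
  · rw [ha ⟨S, h.1⟩ hS, map_zero]
  · rfl

/-- Powers of a cochain which vanishes on vertices vanish on low-dimensional simplices. -/
theorem pow_apply_eq_zero {a : CechCarrier A} (ha : ∀ J : Simplex I, J.1.card ≤ 1 → a J = 0)
    (n : ℕ) (J : Simplex I) (hJ : J.1.card ≤ n) : (a ^ n) J = 0 := by
  induction n generalizing J with
  | zero => exact absurd (Finset.card_pos.2 J.2) (by omega)
  | succ n ih =>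
    rw [pow_succ, CechCarrier.mul_apply]
    refine Finset.sum_eq_zero fun v hv => ?_
    have h1 := card_lo hv
    have h2 := card_hi hv
    by_cases h : (lowPart J.1 v).card ≤ n
    · rw [res_eq_zero ih h, zero_mul]
    · rw [res_eq_zero ha (S := highPart J.1 v) (by omega), map_zero, mul_zero]

variable [Finite I]

/-- Cochains which vanish on vertices are nilpotent, so that every augmentation kills them. -/
theorem augmentation_eq_zero (ε : Augmentation (cech A)) {a : CechCarrier A}
    (ha : ∀ J : Simplex I, J.1.card ≤ 1 → a J = 0) : ε.toAlgHom a = 0 := by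
  have _ := Fintype.ofFinite I
  have h : a ^ Fintype.card I = 0 := cech_ext fun J => pow_apply_eq_zero ha _ J J.1.card_le_univ
  refine eq_zero_of_pow_eq_zero (n := Fintype.card I) ?_
  exact (map_pow ε.toAlgHom _ _).symm.trans ((congrArg ε.toAlgHom h).trans (map_zero _))

theorem cechShuffle_preservesIdeal (ε : Augmentation (cech A)) :
    (cechShuffle A).PreservesIdeal ε := by
  intro l m x y
  match l, m with
  | 0, 0 => exact zero_mem _
  | 0, 1 => exact (y 0).2
  | 0, m + 2 => exact zero_mem _
  | l + 2, m => exact zero_mem _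
  | 1, 0 =>
    have h : cechShuffle A 1 0 (fun i => (x i : cech A)) (fun j => (y j : cech A)) = x 0 :=
      cechBrace_zero (A := A) _ _
    rw [h]; exact (x 0).2
  | 1, m + 1 =>
    rw [ε.mem_ideal]
    exact augmentation_eq_zero ε (cechBrace_succ_vertex m _ _)

theorem cechShuffle_eq_zero_of_card_le_one (hI : Nat.card I ≤ 1) {l m : ℕ} (hlm : 1 < l + m) :
    cechShuffle A l m = 0 := by
  match l, m, hlm with
  | 0, m, hlm => exact cechShuffle_zero (by omega)
  | l + 2, m, _ => rfl
  | 1, 0, hlm => omega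
  | 1, m + 1, _ =>
    ext x y : 2
    refine cech_ext fun J => cechBrace_succ_vertex m _ _ J ?_
    have _ := Fintype.ofFinite I
    exact J.1.card_le_univ.trans (by rwa [← Nat.card_eq_fintype_card])

end Augmentations

/-! ### Functionals on words -/

section Words

variable {k : Type u} [Field k] {A : DGA.{u, v} k} (ε : Augmentation A)

/-- A letter: an element of the augmentation ideal together with its degree in `A`. -/
abbrev Letter := ℤ × ε.ideal

variable {ε} {M M' M'' N N' N'' : Type*} [AddCommGroup M]

/-- The sum over all deconcatenations of a word. -/
def splitSum : List (Letter ε) → (List (Letter ε) → List (Letter ε) → M) → M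
  | [], g => g [] []
  | c :: X, g => g [] (c :: X) + splitSum X (fun X₁ X₂ => g (c :: X₁) X₂)

theorem splitSum_nil (g : List (Letter ε) → List (Letter ε) → M) : splitSum [] g = g [] [] := rfl

theorem splitSum_cons (c : Letter ε) (X : List (Letter ε))
    (g : List (Letter ε) → List (Letter ε) → M) :
    splitSum (c :: X) g = g [] (c :: X) + splitSum X (fun X₁ X₂ => g (c :: X₁) X₂) := rfl

theorem splitSum_congr {X : List (Letter ε)} {g g' : List (Letter ε) → List (Letter ε) → M}
    (h : ∀ X₁ X₂, X₁ ++ X₂ = X → g X₁ X₂ = g' X₁ X₂) : splitSum X g = splitSum X g' := by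
  induction X generalizing g g' with
  | nil => exact h _ _ rfl
  | cons c X ih =>
    rw [splitSum_cons, splitSum_cons, h [] _ rfl,
      ih fun X₁ X₂ e => h _ _ (by rw [List.cons_append, e])]

theorem splitSum_add (X : List (Letter ε)) (g g' : List (Letter ε) → List (Letter ε) → M) :
    splitSum X (fun X₁ X₂ => g X₁ X₂ + g' X₁ X₂) = splitSum X g + splitSum X g' := by
  induction X generalizing g g' with
  | nil => rfl
  | cons c X ih => simp only [splitSum_cons, ih]; abel

theorem splitSum_zero (X : List (Letter ε)) :
    splitSum X (fun _ _ => (0 : M)) = 0 := by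
  induction X with
  | nil => rfl
  | cons c X ih => rw [splitSum_cons, ih, add_zero]

theorem splitSum_comm (X Y : List (Letter ε))
    (g : List (Letter ε) → List (Letter ε) → List (Letter ε) → List (Letter ε) → M) :
    splitSum X (fun X₁ X₂ => splitSum Y (g X₁ X₂)) =
      splitSum Y (fun Y₁ Y₂ => splitSum X (fun X₁ X₂ => g X₁ X₂ Y₁ Y₂)) := by
  induction X generalizing g with
  | nil => rfl
  | cons c X ih => simp only [splitSum_cons, splitSum_add, ih]

/-- Coassociativity of deconcatenation. -/
theorem splitSum_splitSum (X : List (Letter ε))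
    (g : List (Letter ε) → List (Letter ε) → List (Letter ε) → M) :
    splitSum X (fun X₁ X₂ => splitSum X₁ (fun Z₁ Z₂ => g Z₁ Z₂ X₂)) =
      splitSum X (fun X₁ X₂ => splitSum X₂ (fun Z₁ Z₂ => g X₁ Z₁ Z₂)) := by
  induction X generalizing g with
  | nil => rfl
  | cons c X ih => simp only [splitSum_cons, splitSum_nil, splitSum_add, ih]; abel

variable [Module k M] [AddCommGroup M'] [Module k M'] [AddCommGroup M''] [Module k M'']
  [AddCommGroup N] [Module k N] [AddCommGroup N'] [Module k N'] [AddCommGroup N''] [Module k N'']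

/-- The differential of a letter. -/
def Letter.d (c : Letter ε) : Letter ε := (c.1 + 1, ε.idealD c.2)

/-- The product of two letters. -/
def Letter.cup (c c' : Letter ε) : Letter ε := (c.1 + c'.1, ε.idealCup c.2 c'.2)

/-- The degree of a word in the bar complex, i.e. the sum of the shifted degrees of the letters. -/
def wordDeg (X : List (Letter ε)) : ℤ := (X.map fun c => c.1 - 1).sum

@[simp] theorem wordDeg_nil : wordDeg ([] : List (Letter ε)) = 0 := rfl

@[simp] theorem wordDeg_cons (c : Letter ε) (X : List (Letter ε)) :
    wordDeg (c :: X) = c.1 - 1 + wordDeg X := by simp [wordDeg]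

theorem wordDeg_append (X Y : List (Letter ε)) : wordDeg (X ++ Y) = wordDeg X + wordDeg Y := by
  simp [wordDeg]

/-- The value of a functional on the word in which the first two letters are multiplied. -/
def mergeHead (c : Letter ε) : List (Letter ε) → ((List (Letter ε) → M) →ₗ[k] M)
  | [] => 0
  | c' :: X => LinearMap.proj (c.cup c' :: X)

/-- The transpose of the bar differential: the value of a functional on the differential of a
word. -/
def wordD : List (Letter ε) → ((List (Letter ε) → M) →ₗ[k] M)
  | [] => 0
  | c :: X => LinearMap.proj (c.d :: X) +
      signK k (c.1 - 1) • (wordD X ∘ₗ LinearMap.funLeft k M (List.cons c)) + mergeHead c X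

theorem wordD_nil (f : List (Letter ε) → M) : wordD [] f = 0 := rfl

theorem wordD_cons (c : Letter ε) (X : List (Letter ε)) (f : List (Letter ε) → M) :
    wordD (c :: X) f =
      f (c.d :: X) + signK k (c.1 - 1) • wordD X (fun Z => f (c :: Z)) + mergeHead c X f := rfl

@[simp] theorem mergeHead_nil (c : Letter ε) (f : List (Letter ε) → M) : mergeHead c [] f = 0 := rfl

@[simp] theorem mergeHead_cons (c c' : Letter ε) (X : List (Letter ε)) (f : List (Letter ε) → M) :
    mergeHead c (c' :: X) f = f (c.cup c' :: X) := rfl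

theorem map_splitSum (T : M →ₗ[k] N) (X : List (Letter ε))
    (g : List (Letter ε) → List (Letter ε) → M) :
    T (splitSum X g) = splitSum X (fun X₁ X₂ => T (g X₁ X₂)) := by
  induction X generalizing g with
  | nil => rfl
  | cons c X ih => simp only [splitSum_cons, map_add, ih]

theorem smul_splitSum (a : k) (X : List (Letter ε)) (g : List (Letter ε) → List (Letter ε) → M) :
    a • splitSum X g = splitSum X (fun X₁ X₂ => a • g X₁ X₂) :=
  map_splitSum (a • LinearMap.id) X g

theorem map_wordD (T : M →ₗ[k] N) (X : List (Letter ε)) (f : List (Letter ε) → M) :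
    T (wordD X f) = wordD X (fun Z => T (f Z)) := by
  induction X generalizing f with
  | nil => exact map_zero T
  | cons c X ih =>
    simp only [wordD_cons, map_add, map_smul, ih]
    cases X <;> simp

theorem wordD_add (X : List (Letter ε)) (f g : List (Letter ε) → M) :
    wordD X (fun Z => f Z + g Z) = wordD X f + wordD X g := (wordD X).map_add f g

theorem wordD_splitSum_right (X Y : List (Letter ε))
    (g : List (Letter ε) → List (Letter ε) → List (Letter ε) → M) :
    wordD X (fun Z => splitSum Y (g Z)) =
      splitSum Y (fun Y₁ Y₂ => wordD X (fun Z => g Z Y₁ Y₂)) := by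
  induction Y generalizing g with
  | nil => rfl
  | cons c Y ih => simp only [splitSum_cons, wordD_add, ih]

/-- The differential changes the degree of a word by one. -/
theorem wordD_sign_smul (e : ℤ) (X : List (Letter ε)) (f : List (Letter ε) → M) :
    wordD X (fun Z => signK k (e * wordDeg Z) • f Z) =
      signK k (e * (wordDeg X + 1)) • wordD X f := by
  have h : ∀ (X : List (Letter ε)) (a : ℤ) (f : List (Letter ε) → M),
      wordD X (fun Z => signK k (e * (a + wordDeg Z)) • f Z) =
        signK k (e * (a + wordDeg X + 1)) • wordD X f := by
    intro X
    induction X with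
    | nil => intro a f; simp [wordD_nil]
    | cons c X ih =>
      intro a f
      simp only [wordD_cons, wordDeg_cons, smul_add, Letter.d]
      congr 1
      · congr 1
        · congr 2; ring
        · simp only [← add_assoc]
          rw [ih, smul_smul, smul_smul, mul_comm]
      · cases X with
        | nil => simp
        | cons c' X =>
          simp only [mergeHead_cons, wordDeg_cons, Letter.cup]
          congr 2; ring
  simpa using h X 0 f

/-- The differential of the tensor coalgebra is a coderivation. -/
theorem wordD_splitSum (X : List (Letter ε)) (g : List (Letter ε) → List (Letter ε) → M) :
    wordD X (fun Z => splitSum Z g) = splitSum X (fun X₁ X₂ => wordD X₁ (fun Z => g Z X₂) +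
      signK k (wordDeg X₁) • wordD X₂ (fun Z => g X₁ Z)) := by
  induction X generalizing g with
  | nil => simp [wordD_nil, splitSum_nil]
  | cons c X ih =>
    have hm : splitSum X (fun X₁ X₂ => mergeHead c X₁ (fun Z => g Z X₂)) + mergeHead c X (g []) =
        mergeHead c X (fun Z => splitSum Z g) := by
      cases X with
      | nil => simp [splitSum_nil]
      | cons c' X => simp only [splitSum_cons, mergeHead_nil, mergeHead_cons, zero_add]; abel
    simp only [splitSum_cons, wordD_cons, wordD_nil, wordD_add, ih, splitSum_add, wordDeg_cons,
      wordDeg_nil, signK_zero, one_smul, zero_add, signK_add, mul_smul, ← smul_splitSum, smul_add,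
      ← hm]
    abel

/-! ### Convolution -/

/-- The convolution product of two functionals on pairs of words. The sign is that of the
permutation which moves the second part of `X` past the first part of `Y`. -/
def conv (β : M →ₗ[k] M' →ₗ[k] M'') (Φ : List (Letter ε) → List (Letter ε) → M)
    (Ψ : List (Letter ε) → List (Letter ε) → M') (X Y : List (Letter ε)) : M'' :=
  splitSum X fun X₁ X₂ => splitSum Y fun Y₁ Y₂ =>
    signK k (wordDeg X₂ * wordDeg Y₁) • β (Φ X₁ Y₁) (Ψ X₂ Y₂)

/-- The transpose of the differential on pairs of words. -/
def biD (Φ : List (Letter ε) → List (Letter ε) → M) (X Y : List (Letter ε)) : M :=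
  wordD X (fun Z => Φ Z Y) + signK k (wordDeg X) • wordD Y (fun Z => Φ X Z)

/-- The sign operator on functionals. -/
def biSign (Φ : List (Letter ε) → List (Letter ε) → M) (X Y : List (Letter ε)) : M :=
  signK k (wordDeg X + wordDeg Y) • Φ X Y

theorem conv_congr {β : M →ₗ[k] M' →ₗ[k] M''} {β' : N →ₗ[k] N' →ₗ[k] M''}
    {Φ : List (Letter ε) → List (Letter ε) → M} {Ψ : List (Letter ε) → List (Letter ε) → M'}
    {Φ' : List (Letter ε) → List (Letter ε) → N} {Ψ' : List (Letter ε) → List (Letter ε) → N'}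
    {X Y : List (Letter ε)}
    (h : ∀ X₁ X₂ Y₁ Y₂, X₁ ++ X₂ = X → Y₁ ++ Y₂ = Y →
      β (Φ X₁ Y₁) (Ψ X₂ Y₂) = β' (Φ' X₁ Y₁) (Ψ' X₂ Y₂)) :
    conv β Φ Ψ X Y = conv β' Φ' Ψ' X Y :=
  splitSum_congr fun X₁ X₂ hX => splitSum_congr fun Y₁ Y₂ hY => by rw [h X₁ X₂ Y₁ Y₂ hX hY]

theorem conv_add_left (β : M →ₗ[k] M' →ₗ[k] M'') (Φ Φ' : List (Letter ε) → List (Letter ε) → M)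
    (Ψ : List (Letter ε) → List (Letter ε) → M') (X Y : List (Letter ε)) :
    conv β (fun X Y => Φ X Y + Φ' X Y) Ψ X Y = conv β Φ Ψ X Y + conv β Φ' Ψ X Y := by
  simp only [conv, map_add, LinearMap.add_apply, smul_add, splitSum_add]

theorem conv_add_right (β : M →ₗ[k] M' →ₗ[k] M'') (Φ : List (Letter ε) → List (Letter ε) → M)
    (Ψ Ψ' : List (Letter ε) → List (Letter ε) → M') (X Y : List (Letter ε)) :
    conv β Φ (fun X Y => Ψ X Y + Ψ' X Y) X Y = conv β Φ Ψ X Y + conv β Φ Ψ' X Y := by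
  simp only [conv, map_add, smul_add, splitSum_add]

theorem conv_assoc {β : M'' →ₗ[k] N →ₗ[k] N'} {γ : M →ₗ[k] M' →ₗ[k] M''}
    {β' : M →ₗ[k] N'' →ₗ[k] N'} {γ' : M' →ₗ[k] N →ₗ[k] N''}
    (h : ∀ a b c, β (γ a b) c = β' a (γ' b c)) (Φ : List (Letter ε) → List (Letter ε) → M)
    (Ψ : List (Letter ε) → List (Letter ε) → M') (Θ : List (Letter ε) → List (Letter ε) → N)
    (X Y : List (Letter ε)) :
    conv β (conv γ Φ Ψ) Θ X Y = conv β' Φ (conv γ' Ψ Θ) X Y := by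
  -- Both sides are the sum over all deconcatenations of `X` and `Y` in three parts.
  have hl : conv β (conv γ Φ Ψ) Θ X Y =
      splitSum X fun X' X₃ => splitSum X' fun X₁ X₂ => splitSum Y fun Y' Y₃ =>
        splitSum Y' fun Y₁ Y₂ => signK k (wordDeg X₂ * wordDeg Y₁ +
          wordDeg X₃ * wordDeg Y₁ + wordDeg X₃ * wordDeg Y₂) •
            β' (Φ X₁ Y₁) (γ' (Ψ X₂ Y₂) (Θ X₃ Y₃)) := by
    refine splitSum_congr fun X' X₃ _ => ?_
    rw [← splitSum_comm]
    refine splitSum_congr fun Y' Y₃ _ => ?_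
    change signK k _ • β.flip (Θ X₃ Y₃) (splitSum X' _) = _
    rw [map_splitSum, smul_splitSum]
    refine splitSum_congr fun X₁ X₂ _ => ?_
    rw [map_splitSum, smul_splitSum]
    refine splitSum_congr fun Y₁ Y₂ hY => ?_
    rw [map_smul, LinearMap.flip_apply, h, smul_smul, ← signK_add, ← hY, wordDeg_append]
    congr 2; ring
  have hr : conv β' Φ (conv γ' Ψ Θ) X Y =
      splitSum X fun X₁ X' => splitSum X' fun X₂ X₃ => splitSum Y fun Y₁ Y' =>
        splitSum Y' fun Y₂ Y₃ => signK k (wordDeg X₂ * wordDeg Y₁ +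
          wordDeg X₃ * wordDeg Y₁ + wordDeg X₃ * wordDeg Y₂) •
            β' (Φ X₁ Y₁) (γ' (Ψ X₂ Y₂) (Θ X₃ Y₃)) := by
    refine splitSum_congr fun X₁ X' _ => ?_
    rw [← splitSum_comm]
    refine splitSum_congr fun Y₁ Y' _ => ?_
    change signK k _ • β' (Φ X₁ Y₁) (splitSum X' _) = _
    rw [map_splitSum, smul_splitSum]
    refine splitSum_congr fun X₂ X₃ hX => ?_
    rw [map_splitSum, smul_splitSum]
    refine splitSum_congr fun Y₂ Y₃ _ => ?_
    rw [map_smul, smul_smul, ← signK_add, ← hX, wordDeg_append]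
    congr 2; ring
  rw [hl, hr, splitSum_splitSum X (fun X₁ X₂ X₃ => splitSum Y fun Y' Y₃ =>
        splitSum Y' fun Y₁ Y₂ => signK k (wordDeg X₂ * wordDeg Y₁ +
          wordDeg X₃ * wordDeg Y₁ + wordDeg X₃ * wordDeg Y₂) •
            β' (Φ X₁ Y₁) (γ' (Ψ X₂ Y₂) (Θ X₃ Y₃)))]
  exact splitSum_congr fun X₁ X' _ => splitSum_congr fun X₂ X₃ _ => splitSum_splitSum Y _

theorem biD_conv (β : M →ₗ[k] M' →ₗ[k] M'') (Φ : List (Letter ε) → List (Letter ε) → M)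
    (Ψ : List (Letter ε) → List (Letter ε) → M') (X Y : List (Letter ε)) :
    biD (conv β Φ Ψ) X Y = conv β (biD Φ) Ψ X Y + conv β (biSign Φ) (biD Ψ) X Y := by
  have hX : wordD X (fun Z => conv β Φ Ψ Z Y) =
      splitSum X fun X₁ X₂ => splitSum Y fun Y₁ Y₂ =>
        signK k (wordDeg X₂ * wordDeg Y₁) • β (wordD X₁ fun Z => Φ Z Y₁) (Ψ X₂ Y₂) +
        signK k (wordDeg X₂ * wordDeg Y₁ + wordDeg X₁ + wordDeg Y₁) •
          β (Φ X₁ Y₁) (wordD X₂ fun Z => Ψ Z Y₂) := by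
    simp only [conv]
    rw [wordD_splitSum]
    refine splitSum_congr fun X₁ X₂ _ => ?_
    rw [wordD_splitSum_right, wordD_splitSum_right, smul_splitSum, ← splitSum_add]
    refine splitSum_congr fun Y₁ Y₂ _ => ?_
    congr 1
    · rw [← LinearMap.flip_apply, map_wordD]
      exact ((wordD X₁).map_smul _ _)
    · simp only [mul_comm (wordDeg _) (wordDeg Y₁)]
      rw [wordD_sign_smul, map_wordD, smul_smul, ← signK_add]
      congr 2; ring
  have hY : wordD Y (fun Z => conv β Φ Ψ X Z) =
      splitSum X fun X₁ X₂ => splitSum Y fun Y₁ Y₂ =>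
        signK k (wordDeg X₂ * wordDeg Y₁ + wordDeg X₂) • β (wordD Y₁ fun Z => Φ X₁ Z) (Ψ X₂ Y₂) +
        signK k (wordDeg X₂ * wordDeg Y₁ + wordDeg Y₁) •
          β (Φ X₁ Y₁) (wordD Y₂ fun Z => Ψ X₂ Z) := by
    simp only [conv]
    rw [wordD_splitSum_right]
    refine splitSum_congr fun X₁ X₂ _ => ?_
    rw [wordD_splitSum]
    refine splitSum_congr fun Y₁ Y₂ _ => ?_
    congr 1
    · rw [wordD_sign_smul, ← LinearMap.flip_apply, map_wordD]
      congr 2; ring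
    · rw [map_wordD, add_comm, signK_add, mul_smul]
      congr 1
      exact (wordD Y₂).map_smul _ _
  rw [biD, hX, hY, smul_splitSum]
  simp only [conv]
  rw [← splitSum_add, ← splitSum_add]
  refine splitSum_congr fun X₁ X₂ hX => ?_
  rw [smul_splitSum, ← splitSum_add, ← splitSum_add]
  refine splitSum_congr fun Y₁ Y₂ _ => ?_
  simp only [biD, biSign, ← hX, wordDeg_append, map_add, map_smul, LinearMap.add_apply,
    LinearMap.smul_apply, smul_add, smul_smul, ← signK_add]
  have e₁ : signK k (wordDeg X₁ + wordDeg X₂ + (wordDeg X₂ * wordDeg Y₁ + wordDeg X₂)) =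
      signK k (wordDeg X₂ * wordDeg Y₁ + wordDeg X₁) := signK_eq ⟨wordDeg X₂, by ring⟩
  have e₂ : signK k (wordDeg X₂ * wordDeg Y₁ + wordDeg X₁ + wordDeg Y₁) =
      signK k (wordDeg X₂ * wordDeg Y₁ + (wordDeg X₁ + wordDeg Y₁)) := by congr 1; ring
  have e₃ : signK k (wordDeg X₁ + wordDeg X₂ + (wordDeg X₂ * wordDeg Y₁ + wordDeg Y₁)) =
      signK k (wordDeg X₂ * wordDeg Y₁ + (wordDeg X₂ + (wordDeg X₁ + wordDeg Y₁))) := by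
    congr 1; ring
  rw [e₁, e₂, e₃]
  abel

end Words

/-! ### The reduced bar complex and words -/

section BarWords

variable {k : Type u} [Field k] {A : DGA.{u, v} k} (ε : Augmentation A)

/-- The integers act on the tensor powers through the ground field, so that signs in `ℤˣ` and in
`k` have the same effect. -/
theorem negOnePow_smul_bar (n : ℤ) (z : Bar ε) : n.negOnePow • z = signK k n • z := by
  rw [signK, Units.smul_def, ← zsmul_one, smul_one_smul]

instance : AddCommGroup (Bar ε) := Module.addCommMonoidToAddCommGroup k

/-- Two linear maps on the reduced bar complex agree if they agree on pure tensors. -/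
theorem bar_ext {N : Type*} [AddCommGroup N] [Module k N] {f g : Bar ε →ₗ[k] N}
    (h : ∀ (n : ℕ) (x : Fin n → ε.ideal), f (barIncl ε n (PiTensorProduct.tprod k x)) =
      g (barIncl ε n (PiTensorProduct.tprod k x))) : f = g :=
  DirectSum.linearMap_ext k fun n => PiTensorProduct.ext (MultilinearMap.ext fun x => h n x)

/-- The unit of the tensor coalgebra. -/
def barOne : Bar ε := barIncl ε 0 (PiTensorProduct.tprod k Fin.elim0)

theorem barIncl_zero_tprod (x : Fin 0 → ε.ideal) :
    barIncl ε 0 (PiTensorProduct.tprod k x) = barOne ε := by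
  rw [barOne, Subsingleton.elim x Fin.elim0]

/-- Concatenation `a ⊗ z ↦ a ⊗ z` of an element of the augmentation ideal with an element of the
bar complex. -/
def barCons : ε.ideal →ₗ[k] Bar ε →ₗ[k] Bar ε :=
  LinearMap.flip (DirectSum.toModule k ℕ (ε.ideal →ₗ[k] Bar ε) fun n =>
    LinearMap.flip ((PiTensorProduct.lift (R := k)).toLinearMap ∘ₗ
      ((barIncl ε (n + 1)).compMultilinearMap
        (PiTensorProduct.tprod k (s := fun _ : Fin (n + 1) => ε.ideal))).curryLeft))

theorem barCons_barIncl (a : ε.ideal) {n : ℕ} (x : Fin n → ε.ideal) :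
    barCons ε a (barIncl ε n (PiTensorProduct.tprod k x)) =
      barIncl ε (n + 1) (PiTensorProduct.tprod k (Fin.cons a x : Fin (n + 1) → ε.ideal)) := by
  rw [barCons, LinearMap.flip_apply, barIncl, DirectSum.toModule_lof]
  simp

theorem barIncl_succ_tprod {n : ℕ} (x : Fin (n + 1) → ε.ideal) :
    barIncl ε (n + 1) (PiTensorProduct.tprod k x) =
      barCons ε (x 0) (barIncl ε n (PiTensorProduct.tprod k (Fin.tail x))) := by
  rw [barCons_barIncl, Fin.cons_self_tail]

theorem barD_barOne : barD ε (barOne ε) = 0 := by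
  rw [barOne, barD, barIncl, DirectSum.toModule_lof]; rfl

theorem barD_barIncl_succ {n : ℕ} (z : ⨂[k]^(n + 1) ε.ideal) :
    barD ε (barIncl ε (n + 1) z) =
      barIncl ε (n + 1) (barInner ε (n + 1) z) + barIncl ε n (barOuter ε n z) := by
  rw [barD, barIncl, DirectSum.toModule_lof]; rfl

theorem barInner_tprod {n : ℕ} (x : Fin n → ε.ideal) :
    barInner ε n (PiTensorProduct.tprod k x) = ∑ i, PiTensorProduct.tprod k fun j =>
      if j < i then ε.idealSgn (x j) else if j = i then ε.idealD (x j) else x j := by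
  rw [barInner, LinearMap.sum_apply]
  refine Finset.sum_congr rfl fun i _ => ?_
  rw [PiTensorProduct.map_tprod]
  congr 1; ext1 j
  split_ifs <;> rfl

theorem barOuter_tprod {n : ℕ} (x : Fin (n + 1) → ε.ideal) :
    barOuter ε n (PiTensorProduct.tprod k x) = ∑ i, PiTensorProduct.tprod k (barMerge ε i x) := by
  rw [barOuter, LinearMap.sum_apply]
  refine Finset.sum_congr rfl fun i _ => ?_
  rw [PiTensorProduct.lift.tprod]; rfl

theorem barInner_cons (a : ε.ideal) {n : ℕ} (x : Fin n → ε.ideal) :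
    barIncl ε (n + 1) (barInner ε (n + 1)
        (PiTensorProduct.tprod k (Fin.cons a x : Fin (n + 1) → ε.ideal))) =
      barCons ε (ε.idealD a) (barIncl ε n (PiTensorProduct.tprod k x)) +
        barCons ε (ε.idealSgn a) (barIncl ε n (barInner ε n (PiTensorProduct.tprod k x))) := by
  rw [barInner_tprod, barInner_tprod, Fin.sum_univ_succ, map_add, map_sum, map_sum, map_sum]
  congr 1
  · rw [barCons_barIncl]
    congr 2
    ext1 j
    refine Fin.cases ?_ (fun j => ?_) j <;> simp
  · refine Finset.sum_congr rfl fun i _ => ?_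
    rw [barCons_barIncl]
    congr 2
    ext1 j
    refine Fin.cases ?_ (fun j => ?_) j <;> simp [Fin.succ_lt_succ_iff]

theorem barOuter_cons (a b : ε.ideal) {n : ℕ} (x : Fin n → ε.ideal) :
    barIncl ε (n + 1) (barOuter ε (n + 1) (PiTensorProduct.tprod k
        (Fin.cons a (Fin.cons b x : Fin (n + 1) → ε.ideal) : Fin (n + 2) → ε.ideal))) =
      barCons ε (ε.idealCup a b) (barIncl ε n (PiTensorProduct.tprod k x)) +
        barCons ε (ε.idealSgn a) (barIncl ε n (barOuter ε n
          (PiTensorProduct.tprod k (Fin.cons b x : Fin (n + 1) → ε.ideal)))) := by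
  rw [barOuter_tprod, barOuter_tprod, Fin.sum_univ_succ, map_add, map_sum, map_sum, map_sum]
  congr 1
  · rw [barCons_barIncl]
    congr 2
    ext1 j
    refine Fin.cases ?_ (fun j => ?_) j <;> simp [barMerge]
  · refine Finset.sum_congr rfl fun i _ => ?_
    rw [barCons_barIncl]
    congr 2
    ext1 j
    refine Fin.cases ?_ (fun j => ?_) j <;> simp [barMerge, Fin.succ_lt_succ_iff]

/-- The part of the bar differential of `a ⊗ z` which multiplies `a` with the first factor
of `z`. -/
def barMul : ε.ideal →ₗ[k] Bar ε →ₗ[k] Bar ε :=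
  (barCons ε).compr₂ (barD ε) - barCons ε ∘ₗ ε.idealD -
    (barCons ε).compl₁₂ ε.idealSgn (barD ε)

theorem barD_barCons (a : ε.ideal) (z : Bar ε) :
    barD ε (barCons ε a z) = barCons ε (ε.idealD a) z + barCons ε (ε.idealSgn a) (barD ε z) +
      barMul ε a z := by
  simp [barMul]

theorem barMul_barOne (a : ε.ideal) : barMul ε a (barOne ε) = 0 := by
  have h : barD ε (barCons ε a (barOne ε)) = barCons ε (ε.idealD a) (barOne ε) := by
    rw [barOne, barCons_barIncl, barD_barIncl_succ, barInner_cons]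
    simp [barInner, barOuter]
  have := barD_barCons ε a (barOne ε)
  rw [h, barD_barOne, map_zero, add_zero] at this
  simpa using this

theorem barMul_barCons (a b : ε.ideal) (z : Bar ε) :
    barMul ε a (barCons ε b z) = barCons ε (ε.idealCup a b) z := by
  suffices h : barMul ε a ∘ₗ barCons ε b = barCons ε (ε.idealCup a b) from
    LinearMap.congr_fun h z
  refine bar_ext ε fun n x => ?_
  have h := barD_barCons ε a (barCons ε b (barIncl ε n (PiTensorProduct.tprod k x)))
  rw [barCons_barIncl, barCons_barIncl, barD_barIncl_succ, barD_barIncl_succ, barInner_cons,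
    barOuter_cons, map_add] at h
  rw [LinearMap.comp_apply, barCons_barIncl ε b x]
  have h' := sub_eq_of_eq_add' h
  rw [← h']
  abel

theorem barSgn_barOne : barSgn ε (barOne ε) = barOne ε := by
  rw [barOne, barSgn, barIncl, DirectSum.toModule_lof, LinearMap.comp_apply,
    PiTensorProduct.map_tprod]
  exact barIncl_zero_tprod ε _

theorem barSgn_barCons (a : ε.ideal) (z : Bar ε) :
    barSgn ε (barCons ε a z) = barCons ε (ε.idealSgn a) (barSgn ε z) := by
  suffices h : barSgn ε ∘ₗ barCons ε a = barCons ε (ε.idealSgn a) ∘ₗ barSgn ε from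
    LinearMap.congr_fun h z
  have hs : ∀ (n : ℕ) (x : Fin n → ε.ideal), barSgn ε (barIncl ε n (PiTensorProduct.tprod k x)) =
      barIncl ε n (PiTensorProduct.tprod k fun i => ε.idealSgn (x i)) := fun n x => by
    rw [barSgn, barIncl, DirectSum.toModule_lof, LinearMap.comp_apply, PiTensorProduct.map_tprod]
  refine bar_ext ε fun n x => ?_
  rw [LinearMap.comp_apply, LinearMap.comp_apply, barCons_barIncl, hs, hs, barCons_barIncl]
  congr 2
  ext1 j
  refine Fin.cases ?_ (fun j => ?_) j <;> rfl

variable {ε}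

/-- A word is homogeneous if each of its letters is an element of the indicated degree. -/
def IsHomogeneousWord (X : List (Letter ε)) : Prop := ∀ c ∈ X, (c.2 : A.carrier) ∈ A.deg c.1

/-- The element of the bar complex given by a word. -/
def wordBar : List (Letter ε) → Bar ε
  | [] => barOne ε
  | c :: X => barCons ε c.2 (wordBar X)

theorem wordBar_ofFn {n : ℕ} (p : Fin n → ℤ) (x : Fin n → ε.ideal) :
    wordBar (List.ofFn fun i => ((p i, x i) : Letter ε)) =
      barIncl ε n (PiTensorProduct.tprod k x) := by
  induction n with
  | zero => exact (barIncl_zero_tprod ε x).symm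
  | succ n ih =>
    rw [List.ofFn_succ, wordBar, barIncl_succ_tprod]
    exact congrArg _ (ih (fun i => p i.succ) fun i => x i.succ)

theorem wordDeg_ofFn {n : ℕ} (p : Fin n → ℤ) (x : Fin n → ε.ideal) :
    wordDeg (List.ofFn fun i => ((p i, x i) : Letter ε)) = ∑ i, (p i - 1) := by
  rw [wordDeg, List.map_ofFn, List.sum_ofFn]; rfl

theorem isHomogeneousWord_ofFn {n : ℕ} {p : Fin n → ℤ} {x : Fin n → ε.ideal}
    (h : ∀ i, (x i : A.carrier) ∈ A.deg (p i)) :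
    IsHomogeneousWord (List.ofFn fun i => ((p i, x i) : Letter ε)) := by
  intro c hc
  obtain ⟨i, rfl⟩ := (List.mem_ofFn' _ _).1 hc
  exact h i

theorem Augmentation.idealSgn_of_mem {p : ℤ} {a : ε.ideal} (ha : (a : A.carrier) ∈ A.deg p) :
    ε.idealSgn a = signK k (p - 1) • a := by
  refine Subtype.ext ?_
  change -A.sgn a = signK k (p - 1) • (a : A.carrier)
  rw [A.sgn_of_mem' ha, ← neg_smul, ← signK_succ]
  congr 1
  exact signK_eq ⟨1, by ring⟩

theorem barD_wordBar {X : List (Letter ε)} (hX : IsHomogeneousWord X) :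
    barD ε (wordBar X) = wordD X wordBar := by
  induction X with
  | nil => exact barD_barOne ε
  | cons c X ih =>
    rw [wordBar, barD_barCons, Augmentation.idealSgn_of_mem (hX c (by simp)),
      ih fun c' hc' => hX c' (by simp [hc']), wordD_cons, map_smul, LinearMap.smul_apply, map_wordD]
    congr 1
    cases X with
    | nil => exact barMul_barOne ε _
    | cons c' X => exact barMul_barCons ε _ _ _

theorem barSgn_wordBar {X : List (Letter ε)} (hX : IsHomogeneousWord X) :
    barSgn ε (wordBar X) = signK k (wordDeg X) • wordBar X := by
  induction X with
  | nil => simpa [wordBar] using barSgn_barOne ε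
  | cons c X ih =>
    rw [wordBar, barSgn_barCons, Augmentation.idealSgn_of_mem (hX c (by simp)),
      ih fun c' hc' => hX c' (by simp [hc']), map_smul, map_smul, LinearMap.smul_apply, smul_smul,
      wordDeg_cons, signK_add, mul_comm]

theorem barOne_mem : barOne ε ∈ barDeg ε 0 :=
  Submodule.subset_span ⟨0, Fin.elim0, Fin.elim0, fun i => i.elim0, rfl, rfl⟩

theorem barCons_mem {p r : ℤ} {a : ε.ideal} (ha : (a : A.carrier) ∈ A.deg p) {z : Bar ε}
    (hz : z ∈ barDeg ε r) : barCons ε a z ∈ barDeg ε (p - 1 + r) := by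
  refine Submodule.span_le (p := (barDeg ε (p - 1 + r)).comap (barCons ε a)).2 ?_ hz
  rintro _ ⟨n, q, x, hx, hq, rfl⟩
  refine Submodule.subset_span ⟨n + 1, Fin.cons p q, Fin.cons a x, ?_, ?_, barCons_barIncl ε a x⟩
  · intro i
    refine Fin.cases ?_ (fun j => ?_) i
    · exact ha
    · exact hx j
  · rw [Fin.sum_univ_succ]; simp [← hq]

end BarWords

/-! ### Homotopy shuffle systems on words -/

section WordSequences

variable {k : Type u} [Field k] {A : DGA.{u, v} k} {ε : Augmentation A}

/-- The letters of a word, continued by zero. -/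
def wordSeq (X : List (Letter ε)) (i : ℕ) : A.carrier := ((X.getD i (0, 0)).2 : A.carrier)

/-- The degrees of the letters of a word, continued by zero. -/
def wordDegSeq (X : List (Letter ε)) (i : ℕ) : ℤ := (X.getD i (0, 0)).1

/-- The sequence `a, s 0, s 1, …`. -/
def seqCons {α : Type*} (a : α) (s : ℕ → α) : ℕ → α
  | 0 => a
  | i + 1 => s i

theorem wordSeq_cons (c : Letter ε) (X : List (Letter ε)) :
    wordSeq (c :: X) = seqCons (c.2 : A.carrier) (wordSeq X) := by
  funext i; cases i <;> rfl

theorem wordSeq_mem {X : List (Letter ε)} (hX : IsHomogeneousWord X) (i : ℕ) :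
    wordSeq X i ∈ A.deg (wordDegSeq X i) := by
  rw [wordSeq, wordDegSeq]
  by_cases h : i < X.length
  · rw [List.getD_eq_getElem _ _ h]
    exact hX _ (List.getElem_mem h)
  · rw [List.getD_eq_default _ _ (not_lt.1 h)]
    exact zero_mem _

theorem wordSeq_drop (a : ℕ) (X : List (Letter ε)) :
    wordSeq (X.drop a) = fun i => wordSeq X (a + i) := by
  funext i; simp [wordSeq, List.getD_eq_getElem?_getD]

theorem wordSeq_take {a i : ℕ} (h : i < a) (X : List (Letter ε)) :
    wordSeq (X.take a) i = wordSeq X i := by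
  simp [wordSeq, List.getD_eq_getElem?_getD, List.getElem?_take_of_lt h]

theorem shiftDeg_wordDegSeq (X : List (Letter ε)) {n : ℕ} (hn : n ≤ X.length) :
    shiftDeg (wordDegSeq X) n = wordDeg (X.take n) := by
  induction X generalizing n with
  | nil =>
    obtain rfl : n = 0 := Nat.le_zero.1 hn
    rfl
  | cons c X ih =>
    cases n with
    | zero => simp [shiftDeg]
    | succ n =>
      rw [shiftDeg, Finset.sum_range_succ', List.take_succ_cons, wordDeg_cons,
        ← ih (Nat.le_of_succ_le_succ hn), add_comm]
      rfl

/-- Deconcatenations of a word are indexed by the length of the first part. -/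
theorem splitSum_eq_sum {M : Type*} [AddCommGroup M] (X : List (Letter ε))
    (g : List (Letter ε) → List (Letter ε) → M) :
    splitSum X g = ∑ a ∈ Finset.range (X.length + 1), g (X.take a) (X.drop a) := by
  induction X generalizing g with
  | nil => simp [splitSum_nil]
  | cons c X ih =>
    rw [splitSum_cons, ih, List.length_cons, Finset.sum_range_succ' _ (X.length + 1), add_comm]
    rfl

/-- The differential of a word, in terms of the sequence of its letters. -/
theorem wordD_seq {M : Type*} [AddCommGroup M] [Module k M] (X : List (Letter ε))
    (F : ℕ → (ℕ → A.carrier) → M) :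
    wordD X (fun Z => F Z.length (wordSeq Z)) =
      ∑ i ∈ Finset.range X.length, signK k (shiftDeg (wordDegSeq X) i) •
        F X.length (Function.update (wordSeq X) i (A.d (wordSeq X i))) +
      ∑ i ∈ Finset.range (X.length - 1), signK k (shiftDeg (wordDegSeq X) i) •
        F (X.length - 1) (A.mergeAt (wordSeq X) i) := by
  induction X generalizing F with
  | nil => simp [wordD_nil]
  | cons c X ih =>
    have hs : ∀ i, signK k (shiftDeg (wordDegSeq (c :: X)) (i + 1)) =
        signK k (c.1 - 1) * signK k (shiftDeg (wordDegSeq X) i) := fun i => by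
      rw [← signK_add, shiftDeg, Finset.sum_range_succ', add_comm]; rfl
    have hd : ∑ i ∈ Finset.range (X.length + 1), signK k (shiftDeg (wordDegSeq (c :: X)) i) •
          F (X.length + 1) (Function.update (wordSeq (c :: X)) i (A.d (wordSeq (c :: X) i))) =
        F (X.length + 1) (wordSeq (c.d :: X)) + signK k (c.1 - 1) • ∑ i ∈ Finset.range X.length,
          signK k (shiftDeg (wordDegSeq X) i) • F (X.length + 1)
            (seqCons (c.2 : A.carrier) (Function.update (wordSeq X) i (A.d (wordSeq X i)))) := by
      rw [Finset.sum_range_succ', add_comm, Finset.smul_sum]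
      congr 1
      · simp only [shiftDeg, Finset.range_zero, Finset.sum_empty, signK_zero, one_smul]
        congr 1
        funext j; cases j <;> simp [wordSeq_cons, seqCons, Letter.d]; rfl
      · refine Finset.sum_congr rfl fun i _ => ?_
        rw [hs, mul_smul, wordSeq_cons]
        congr 3
        funext j; cases j <;> simp [seqCons, Function.update_apply]
    have hm : ∑ i ∈ Finset.range X.length, signK k (shiftDeg (wordDegSeq (c :: X)) i) •
          F X.length (A.mergeAt (wordSeq (c :: X)) i) =
        mergeHead c X (fun Z => F Z.length (wordSeq Z)) + signK k (c.1 - 1) •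
          ∑ i ∈ Finset.range (X.length - 1), signK k (shiftDeg (wordDegSeq X) i) •
            F (X.length - 1 + 1) (seqCons (c.2 : A.carrier) (A.mergeAt (wordSeq X) i)) := by
      cases X with
      | nil => simp
      | cons c' X =>
        rw [List.length_cons, Finset.sum_range_succ', add_comm, Finset.smul_sum]
        congr 1
        · simp only [shiftDeg, Finset.range_zero, Finset.sum_empty, signK_zero, one_smul,
            mergeHead_cons, List.length_cons]
          congr 1
          funext j; cases j <;> simp [wordSeq_cons, seqCons, Letter.cup, DGA.mergeAt]; rfl
        · refine Finset.sum_congr rfl fun i _ => ?_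
          rw [hs, mul_smul, wordSeq_cons c]
          congr 3
          funext j; cases j <;> simp [seqCons, DGA.mergeAt]
    have hcons : (fun Z => F (c :: Z : List (Letter ε)).length (wordSeq (c :: Z))) =
        fun Z => (fun n s => F (n + 1) (seqCons (c.2 : A.carrier) s)) Z.length (wordSeq Z) := by
      funext Z; rw [wordSeq_cons]; rfl
    rw [wordD_cons, hcons, ih fun n s => F (n + 1) (seqCons (c.2 : A.carrier) s)]
    simp only [List.length_cons, Nat.add_sub_cancel]
    rw [hd, hm, smul_add]
    abel

end WordSequences

section WordSystem

variable {k : Type u} [Field k] {A : DGA.{u, v} k} {ε : Augmentation A} {h : ShuffleMaps A}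

theorem ShuffleMaps.app_congr {l m : ℕ} {x x' y y' : ℕ → A} (hx : ∀ i < l, x i = x' i)
    (hy : ∀ j < m, y j = y' j) : h.app l m x y = h.app l m x' y' := by
  simp only [ShuffleMaps.app]
  congr 2 <;> funext i
  · exact hx i i.2
  · exact hy i i.2

/-- The value of a homotopy shuffle system on a pair of words. -/
def wordApp (hI : h.PreservesIdeal ε) (X Y : List (Letter ε)) : ε.ideal :=
  ⟨h.app X.length Y.length (wordSeq X) (wordSeq Y),
    hI _ _ (fun i => (X.getD i (0, 0)).2) (fun j => (Y.getD j (0, 0)).2)⟩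

variable (hI : h.PreservesIdeal ε)

/-- The terms `h d`, `h ∘ (d_B ⊗ 1)` and `h ∘ (1 ⊗ d_B)` of the defining relation together are the
transpose of the differential of the bar complex, applied to `h`. -/
theorem coe_biD_wordApp (X Y : List (Letter ε)) :
    ((biD (wordApp hI) X Y : ε.ideal) : A.carrier) =
      h.compD X.length Y.length (wordDegSeq X) (wordDegSeq Y) (wordSeq X) (wordSeq Y) -
      h.beta X.length Y.length (wordDegSeq X) (wordDegSeq Y) (wordSeq X) (wordSeq Y) -
      h.gamma X.length Y.length (wordDegSeq X) (wordDegSeq Y) (wordSeq X) (wordSeq Y) := by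
  change ε.ideal.subtype (biD (wordApp hI) X Y) = _
  have h₁ := wordD_seq X fun n s => h.app n Y.length s (wordSeq Y)
  have h₂ := wordD_seq Y fun n s => h.app X.length n (wordSeq X) s
  rw [biD, map_add, map_smul, map_wordD, map_wordD]
  refine (congrArg₂ (fun a b => a + signK k (wordDeg X) • b) h₁ h₂).trans ?_
  simp only [ShuffleMaps.compD, ShuffleMaps.beta, ShuffleMaps.gamma, negOnePow_smul_eq (k := k),
    shiftDeg_wordDegSeq X le_rfl, List.take_length, signK_add, mul_smul, ← Finset.smul_sum,
    smul_add]
  abel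

theorem wordApp_nil_nil (hh : IsHomotopyShuffleSystem A h) : wordApp hI [] [] = 0 := by
  refine Subtype.ext ?_
  change h 0 0 _ _ = 0
  rw [hh.zero_zero]; rfl

theorem wordApp_singleton_nil (hh : IsHomotopyShuffleSystem A h) (c : Letter ε) :
    wordApp hI [c] [] = c.2 :=
  Subtype.ext (hh.one_zero _ _)

theorem wordApp_nil_singleton (hh : IsHomotopyShuffleSystem A h) (c : Letter ε) :
    wordApp hI [] [c] = c.2 :=
  Subtype.ext (hh.zero_one _ _)

theorem wordApp_nil_right (hh : IsHomotopyShuffleSystem A h) {X : List (Letter ε)}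
    (hX : 1 < X.length) : wordApp hI X [] = 0 := by
  refine Subtype.ext ?_
  change h X.length 0 _ _ = 0
  rw [hh.left_zero _ hX]; rfl

theorem wordApp_nil_left (hh : IsHomotopyShuffleSystem A h) {Y : List (Letter ε)}
    (hY : 1 < Y.length) : wordApp hI [] Y = 0 := by
  refine Subtype.ext ?_
  change h 0 Y.length _ _ = 0
  rw [hh.right_zero _ hY]; rfl

theorem wordApp_mem (hh : IsHomotopyShuffleSystem A h) {X Y : List (Letter ε)}
    (hX : IsHomogeneousWord X) (hY : IsHomogeneousWord Y) :
    (wordApp hI X Y : A.carrier) ∈ A.deg (wordDeg X + wordDeg Y + 1) := by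
  have := hh.map_deg X.length Y.length _ _ _ _ (wordSeq_mem hX) (wordSeq_mem hY)
  rwa [shiftDeg_wordDegSeq _ le_rfl, shiftDeg_wordDegSeq _ le_rfl, List.take_length,
    List.take_length] at this

theorem idealSgn_wordApp (hh : IsHomotopyShuffleSystem A h) {X Y : List (Letter ε)}
    (hX : IsHomogeneousWord X) (hY : IsHomogeneousWord Y) :
    ε.idealSgn (wordApp hI X Y) = biSign (wordApp hI) X Y := by
  rw [Augmentation.idealSgn_of_mem (wordApp_mem hI hh hX hY), biSign]
  congr 2; ring

/-- The quadratic term of the defining relation is the convolution square of `h`. -/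
theorem coe_conv_wordApp (hh : IsHomotopyShuffleSystem A h) (X Y : List (Letter ε)) :
    ((conv ε.idealCup (wordApp hI) (wordApp hI) X Y : ε.ideal) : A.carrier) =
      h.alpha X.length Y.length (wordDegSeq X) (wordDegSeq Y) (wordSeq X) (wordSeq Y) := by
  change ε.ideal.subtype _ = _
  rw [conv, map_splitSum, splitSum_eq_sum]
  refine Finset.sum_congr rfl fun l' hl => ?_
  rw [map_splitSum, splitSum_eq_sum]
  refine Finset.sum_congr rfl fun m' hm => ?_
  rw [Finset.mem_range, Nat.lt_succ_iff] at hl hm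
  rw [map_smul, negOnePow_smul_eq (k := k)]
  split_ifs with hc
  · have e₁ : shiftDeg (fun i => wordDegSeq X (l' + i)) (X.length - l') =
        wordDeg (X.drop l') := by
      have := shiftDeg_wordDegSeq (X.drop l') le_rfl
      rw [List.take_length, List.length_drop] at this
      rw [← this]
      congr 1
      funext i; simp [wordDegSeq, List.getD_eq_getElem?_getD]
    rw [e₁, shiftDeg_wordDegSeq Y hm]
    congr 1
    change A.cup (h.app _ _ _ _) (h.app _ _ _ _) = _
    rw [List.length_take_of_le hl, List.length_take_of_le hm, List.length_drop, List.length_drop,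
      wordSeq_drop, wordSeq_drop]
    congr 2
    exact ShuffleMaps.app_congr (fun i hi => wordSeq_take hi X) fun i hi => wordSeq_take hi Y
  · rcases Nat.eq_zero_or_pos (l' + m') with h0 | h0
    · obtain ⟨rfl, rfl⟩ : l' = 0 ∧ m' = 0 := by omega
      simp [wordApp_nil_nil hI hh]
    · obtain ⟨rfl, rfl⟩ : l' = X.length ∧ m' = Y.length := by omega
      simp [wordApp_nil_nil hI hh]

/-- The defining relations of a homotopy shuffle system, in terms of convolution. -/
theorem biD_wordApp (hh : IsHomotopyShuffleSystem A h) {X Y : List (Letter ε)}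
    (hX : IsHomogeneousWord X) (hY : IsHomogeneousWord Y) :
    biD (wordApp hI) X Y =
      ε.idealD (wordApp hI X Y) + conv ε.idealCup (wordApp hI) (wordApp hI) X Y := by
  rcases Y with _ | ⟨c', Y⟩
  · rcases X with _ | ⟨c, _ | ⟨c', _ | ⟨c'', X⟩⟩⟩
    · simp [biD, wordD_nil, conv, splitSum_nil, wordApp_nil_nil hI hh]
    · simp [biD, wordD_cons, wordD_nil, conv, splitSum_nil, splitSum_cons, wordApp_nil_nil hI hh,
        wordApp_singleton_nil hI hh, Letter.d]
    · simp [biD, wordD_cons, wordD_nil, conv, splitSum_nil, splitSum_cons, wordApp_nil_nil hI hh,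
        wordApp_singleton_nil hI hh, wordApp_nil_right hI hh, Letter.cup]
    · have h0 : ∀ (n : ℕ) (x y : ℕ → A), 1 < n → h.app n 0 x y = 0 := fun n x y hn =>
        ShuffleMaps.app_eq_zero (hh.left_zero n hn) x y
      refine Subtype.ext ?_
      rw [Submodule.coe_add, coe_biD_wordApp, coe_conv_wordApp hI hh]
      have hα : h.alpha (c :: c' :: c'' :: X).length ([] : List (Letter ε)).length
          (wordDegSeq (c :: c' :: c'' :: X)) (wordDegSeq ([] : List (Letter ε)))
          (wordSeq (c :: c' :: c'' :: X))
          (wordSeq ([] : List (Letter ε))) = 0 := by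
        refine Finset.sum_eq_zero fun l' hl => Finset.sum_eq_zero fun m' hm => ?_
        obtain rfl : m' = 0 := by simpa using hm
        split_ifs with hc
        · rcases Nat.lt_or_ge 1 l' with hl' | hl'
          · simp [h0 _ _ _ hl']
          · simp only [List.length_cons, List.length_nil] at hl ⊢
            rw [h0 (X.length + 1 + 1 + 1 - l') _ _ (by omega)]
            simp
        · rfl
      rw [hα, wordApp_nil_right hI hh (by simp), map_zero]
      simp [ShuffleMaps.compD, ShuffleMaps.beta, ShuffleMaps.gamma, h0]
  rcases X with _ | ⟨c, X⟩
  · rcases Y with _ | ⟨c'', _ | ⟨c₃, Y⟩⟩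
    · simp [biD, wordD_cons, wordD_nil, conv, splitSum_nil, splitSum_cons, wordApp_nil_nil hI hh,
        wordApp_nil_singleton hI hh, Letter.d]
    · simp [biD, wordD_cons, wordD_nil, conv, splitSum_nil, splitSum_cons, wordApp_nil_nil hI hh,
        wordApp_nil_singleton hI hh, wordApp_nil_left hI hh, Letter.cup]
    · have h0 : ∀ (n : ℕ) (x y : ℕ → A), 1 < n → h.app 0 n x y = 0 := fun n x y hn =>
        ShuffleMaps.app_eq_zero (hh.right_zero n hn) x y
      refine Subtype.ext ?_
      rw [Submodule.coe_add, coe_biD_wordApp, coe_conv_wordApp hI hh]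
      have hα : h.alpha ([] : List (Letter ε)).length (c' :: c'' :: c₃ :: Y).length
          (wordDegSeq ([] : List (Letter ε))) (wordDegSeq (c' :: c'' :: c₃ :: Y))
          (wordSeq ([] : List (Letter ε)))
          (wordSeq (c' :: c'' :: c₃ :: Y)) = 0 := by
        refine Finset.sum_eq_zero fun l' hl => Finset.sum_eq_zero fun m' hm => ?_
        obtain rfl : l' = 0 := by simpa using hl
        split_ifs with hc
        · rcases Nat.lt_or_ge 1 m' with hm' | hm'
          · simp [h0 _ _ _ hm']
          · simp only [List.length_cons, List.length_nil] at hm ⊢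
            rw [h0 (Y.length + 1 + 1 + 1 - m') _ _ (by omega)]
            simp
        · rfl
      rw [hα, wordApp_nil_left hI hh (by simp), map_zero]
      simp [ShuffleMaps.compD, ShuffleMaps.beta, ShuffleMaps.gamma, h0]
  rw [← sub_eq_iff_eq_add']
  refine Subtype.ext ?_
  rw [AddSubgroupClass.coe_sub, coe_biD_wordApp, coe_conv_wordApp hI hh]
  change _ - A.d (h.app _ _ _ _) = _
  by_cases hl : 2 < (c :: X).length + (c' :: Y).length
  · have := hh.higher _ _ (by simp) (by simp) hl _ _ _ _ (wordSeq_mem hX) (wordSeq_mem hY)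
    rw [neg_add_eq_sub, sub_eq_iff_eq_add] at this
    rw [this]
    abel
  · obtain rfl : X = [] := by rw [← List.length_eq_zero_iff]; simp at hl; omega
    obtain rfl : Y = [] := by rw [← List.length_eq_zero_iff]; simp at hl; omega
    have := hh.homotopy_comm c.1 c'.1 c.2 c'.2 (hX c (by simp)) (hY c' (by simp))
    have h11 : ∀ x y : ℕ → A, h.app 1 1 x y = h 1 1 (fun _ => x 0) (fun _ => y 0) :=
      fun x y => h.app_congr (x' := fun _ => x 0) (y' := fun _ => y 0)
        (fun i hi => by rw [Nat.lt_one_iff.1 hi]) (fun j hj => by rw [Nat.lt_one_iff.1 hj])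
    have hα : h.alpha 1 1 (wordDegSeq [c]) (wordDegSeq [c']) (wordSeq [c]) (wordSeq [c']) =
        A.cup c.2 c'.2 + ((c.1 - 1) * (c'.1 - 1)).negOnePow • A.cup c'.2 c.2 := by
      simp only [ShuffleMaps.alpha, Finset.sum_range_succ, Finset.sum_range_zero, shiftDeg]
      simp [hh.one_zero, hh.zero_one]
      rw [add_comm]; rfl
    simp only [List.length_cons, List.length_nil, zero_add]
    rw [hα, this]
    simp only [ShuffleMaps.compD, ShuffleMaps.beta, ShuffleMaps.gamma, h11, shiftDeg]
    simp [wordSeq, wordDegSeq]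
    abel

end WordSystem

/-! ### The homotopy shuffle product of words -/

section WordShuffle

variable {k : Type u} [Field k] {A : DGA.{u, v} k} {ε : Augmentation A} {h : ShuffleMaps A}
  (hI : h.PreservesIdeal ε)

/-- The convolution unit. -/
def wordUnit : List (Letter ε) → List (Letter ε) → Bar ε
  | [], [] => barOne ε
  | _, _ => 0

/-- The component of tensor length `n` of the homotopy shuffle product of two words, i.e. the
`n`-th convolution power of the homotopy shuffle system. -/
def wordShuffle : ℕ → List (Letter ε) → List (Letter ε) → Bar ε
  | 0 => wordUnit
  | n + 1 => conv (barCons ε) (wordApp hI) (wordShuffle n)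

/-- The homotopy shuffle product of two words. -/
def wordProduct (X Y : List (Letter ε)) : Bar ε :=
  ∑ n ∈ Finset.range (X.length + Y.length + 1), wordShuffle hI n X Y

theorem splitSum_eq_zero {M : Type*} [AddCommGroup M] {X : List (Letter ε)}
    {g : List (Letter ε) → List (Letter ε) → M} (hg : ∀ X₁ X₂, X₁ ++ X₂ = X → g X₁ X₂ = 0) :
    splitSum X g = 0 :=
  (splitSum_congr hg).trans (splitSum_zero X)

theorem wordShuffle_eq_zero (hh : IsHomotopyShuffleSystem A h) {n : ℕ} {X Y : List (Letter ε)}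
    (hn : X.length + Y.length < n) : wordShuffle hI n X Y = 0 := by
  induction n generalizing X Y with
  | zero => exact absurd hn (Nat.not_lt_zero _)
  | succ n ih =>
    refine splitSum_eq_zero fun X₁ X₂ hX => splitSum_eq_zero fun Y₁ Y₂ hY => ?_
    rw [← hX, ← hY, List.length_append, List.length_append] at hn
    rcases Nat.eq_zero_or_pos (X₁.length + Y₁.length) with h0 | h0
    · obtain rfl : X₁ = [] := List.length_eq_zero_iff.1 (by omega)
      obtain rfl : Y₁ = [] := List.length_eq_zero_iff.1 (by omega)
      simp [wordApp_nil_nil hI hh]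
    · rw [ih (by omega), map_zero, smul_zero]

theorem wordProduct_eq_sum (hh : IsHomotopyShuffleSystem A h) {n : ℕ} {X Y : List (Letter ε)}
    (hn : X.length + Y.length < n) :
    wordProduct hI X Y = ∑ i ∈ Finset.range n, wordShuffle hI i X Y := by
  refine Finset.sum_subset (Finset.range_subset_range.2 hn) fun i _ hi => ?_
  refine wordShuffle_eq_zero hI hh ?_
  rw [Finset.mem_range, not_lt] at hi
  omega

theorem conv_sum_right {M M' M'' ι : Type*} [AddCommGroup M] [Module k M] [AddCommGroup M']
    [Module k M'] [AddCommGroup M''] [Module k M''] (β : M →ₗ[k] M' →ₗ[k] M'')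
    (Φ : List (Letter ε) → List (Letter ε) → M)
    (Ψ : ι → List (Letter ε) → List (Letter ε) → M') (s : Finset ι) (X Y : List (Letter ε)) :
    conv β Φ (fun X Y => ∑ i ∈ s, Ψ i X Y) X Y = ∑ i ∈ s, conv β Φ (Ψ i) X Y := by
  classical
  induction s using Finset.induction_on with
  | empty =>
    exact splitSum_eq_zero fun _ _ _ => splitSum_eq_zero fun _ _ _ => by simp
  | insert a s ha ih =>
    simp only [Finset.sum_insert ha]
    rw [conv_add_right, ih]

/-- The homotopy shuffle product is the geometric series of the homotopy shuffle system in the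
convolution algebra. -/
theorem wordProduct_eq (hh : IsHomotopyShuffleSystem A h) (X Y : List (Letter ε)) :
    wordProduct hI X Y = wordUnit X Y + conv (barCons ε) (wordApp hI) (wordProduct hI) X Y := by
  rw [wordProduct_eq_sum hI hh (n := X.length + Y.length + 1 + 1) (by omega),
    Finset.sum_range_succ', add_comm]
  congr 1
  refine (conv_sum_right _ _ _ _ X Y).symm.trans (conv_congr fun X₁ X₂ Y₁ Y₂ hX hY => ?_)
  rw [wordProduct_eq_sum hI hh]
  rw [← hX, ← hY, List.length_append, List.length_append]
  omega

theorem biD_wordUnit (X Y : List (Letter ε)) :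
    biD (wordUnit : List (Letter ε) → List (Letter ε) → Bar ε) X Y = 0 := by
  have hD : ∀ (Z : List (Letter ε)) (f : List (Letter ε) → Bar ε),
      (∀ c Z, f (c :: Z) = 0) → wordD Z f = 0 := by
    intro Z
    induction Z with
    | nil => intro f _; rfl
    | cons c Z ih =>
      intro f hf
      rw [wordD_cons, hf, ih (fun Z => f (c :: Z)) fun c' Z' => hf _ _]
      cases Z <;> simp [hf]
  rw [biD, hD X _ fun c Z => rfl, hD Y _ fun c Z => ?_, smul_zero, add_zero]
  cases X <;> rfl

theorem IsHomogeneousWord.left {X₁ X₂ : List (Letter ε)} (hX : IsHomogeneousWord (X₁ ++ X₂)) :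
    IsHomogeneousWord X₁ := fun c hc => hX c (List.mem_append_left _ hc)

theorem IsHomogeneousWord.right {X₁ X₂ : List (Letter ε)} (hX : IsHomogeneousWord (X₁ ++ X₂)) :
    IsHomogeneousWord X₂ := fun c hc => hX c (List.mem_append_right _ hc)

/-- The homotopy shuffle product commutes with the differentials. Induction on the length of the
words reduces this to the relations between the members of a homotopy shuffle system. -/
theorem barD_wordProduct (hh : IsHomotopyShuffleSystem A h) {X Y : List (Letter ε)}
    (hX : IsHomogeneousWord X) (hY : IsHomogeneousWord Y) :
    barD ε (wordProduct hI X Y) = biD (wordProduct hI) X Y := by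
  induction hn : X.length + Y.length using Nat.strong_induction_on generalizing X Y with
  | _ n ih =>
  have hu : barD ε (wordUnit X Y) = 0 := by
    rcases X with _ | ⟨c, X⟩ <;> rcases Y with _ | ⟨c', Y⟩
    · exact barD_barOne ε
    all_goals exact map_zero _
  -- The term in which the values of the system on the first two parts are multiplied.
  have hm : conv (barMul ε) (wordApp hI) (wordProduct hI) X Y =
      conv (barCons ε) (conv ε.idealCup (wordApp hI) (wordApp hI)) (wordProduct hI) X Y := by
    rw [conv_assoc (fun a b z => (barMul_barCons ε a b z).symm)]
    refine conv_congr fun X₁ X₂ Y₁ Y₂ _ _ => ?_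
    rw [wordProduct_eq hI hh X₂ Y₂, map_add, add_eq_right]
    rcases X₂ with _ | ⟨c, X₂⟩ <;> rcases Y₂ with _ | ⟨c', Y₂⟩
    · exact barMul_barOne ε _
    all_goals exact map_zero _
  have hd : barD ε (conv (barCons ε) (wordApp hI) (wordProduct hI) X Y) =
      conv (barCons ε) (fun X Y => ε.idealD (wordApp hI X Y)) (wordProduct hI) X Y +
        conv (barCons ε) (biSign (wordApp hI)) (biD (wordProduct hI)) X Y +
        conv (barMul ε) (wordApp hI) (wordProduct hI) X Y := by
    simp only [conv]
    rw [map_splitSum, ← splitSum_add, ← splitSum_add]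
    refine splitSum_congr fun X₁ X₂ hX' => ?_
    rw [map_splitSum, ← splitSum_add, ← splitSum_add]
    refine splitSum_congr fun Y₁ Y₂ hY' => ?_
    rw [map_smul, barD_barCons, smul_add, smul_add]
    rw [← hX'] at hX
    rw [← hY'] at hY
    rw [idealSgn_wordApp hI hh hX.left hY.left]
    congr 3
    rcases Nat.eq_zero_or_pos (X₁.length + Y₁.length) with h0 | h0
    · obtain rfl : X₁ = [] := List.length_eq_zero_iff.1 (by omega)
      obtain rfl : Y₁ = [] := List.length_eq_zero_iff.1 (by omega)
      simp [biSign, wordApp_nil_nil hI hh]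
    · rw [ih (X₂.length + Y₂.length) ?_ hX.right hY.right rfl]
      rw [← hn, ← hX', ← hY', List.length_append, List.length_append]
      omega
  have hc : conv (barCons ε) (biD (wordApp hI)) (wordProduct hI) X Y =
      conv (barCons ε) (fun X Y => ε.idealD (wordApp hI X Y)) (wordProduct hI) X Y +
      conv (barCons ε) (conv ε.idealCup (wordApp hI) (wordApp hI)) (wordProduct hI) X Y := by
    rw [← conv_add_left]
    refine conv_congr fun X₁ X₂ Y₁ Y₂ hX' hY' => ?_
    rw [← hX'] at hX
    rw [← hY'] at hY
    rw [biD_wordApp hI hh hX.left hY.left]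
  have hP : (wordProduct hI : List (Letter ε) → List (Letter ε) → Bar ε) = fun X Y =>
      wordUnit X Y + conv (barCons ε) (wordApp hI) (wordProduct hI) X Y := by
    funext X Y; exact wordProduct_eq hI hh X Y
  have hb : biD (wordProduct hI) X Y = biD wordUnit X Y +
      biD (conv (barCons ε) (wordApp hI) (wordProduct hI)) X Y := by
    conv_lhs => rw [hP]
    simp only [biD, wordD_add, smul_add]
    abel
  rw [hb, biD_wordUnit, zero_add, biD_conv, hc, wordProduct_eq hI hh, map_add, hu, zero_add, hd, hm]
  abel

theorem splitSum_mem {M : Type*} [AddCommGroup M] [Module k M] (N : Submodule k M)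
    {X : List (Letter ε)} {g : List (Letter ε) → List (Letter ε) → M}
    (hg : ∀ X₁ X₂, X₁ ++ X₂ = X → g X₁ X₂ ∈ N) : splitSum X g ∈ N := by
  induction X generalizing g with
  | nil => exact hg _ _ rfl
  | cons c X ih =>
    exact N.add_mem (hg _ _ rfl) (ih fun X₁ X₂ e => hg _ _ (by rw [List.cons_append, e]))

theorem wordShuffle_mem (hh : IsHomotopyShuffleSystem A h) (n : ℕ) {X Y : List (Letter ε)}
    (hX : IsHomogeneousWord X) (hY : IsHomogeneousWord Y) :
    wordShuffle hI n X Y ∈ barDeg ε (wordDeg X + wordDeg Y) := by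
  induction n generalizing X Y with
  | zero =>
    rcases X with _ | ⟨c, X⟩ <;> rcases Y with _ | ⟨c', Y⟩
    · exact barOne_mem
    all_goals exact zero_mem _
  | succ n ih =>
    refine splitSum_mem _ fun X₁ X₂ hX' => splitSum_mem _ fun Y₁ Y₂ hY' => ?_
    rw [← hX'] at hX
    rw [← hY'] at hY
    have := barCons_mem (wordApp_mem hI hh hX.left hY.left) (ih hX.right hY.right)
    rw [← hX', ← hY', wordDeg_append, wordDeg_append]
    refine Submodule.smul_mem _ _ ?_
    convert this using 2
    ring

end WordShuffle

/-! ### Shuffle maps and their first fibres -/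

section ShuffleCons

variable {l m n : ℕ}

/-- The shuffle map whose fibre over the first point consists of the first `a` elements of the left
part and the first `b` elements of the right part, and which is `f` on the other elements. -/
def shuffleCons (a b : ℕ) (f : Fin l ⊕ Fin m → Fin n) :
    Fin (a + l) ⊕ Fin (b + m) → Fin (n + 1) :=
  Sum.elim (Fin.addCases (fun _ => 0) fun i => (f (Sum.inl i)).succ)
    (Fin.addCases (fun _ => 0) fun j => (f (Sum.inr j)).succ)

variable (a b : ℕ) (f : Fin l ⊕ Fin m → Fin n)

@[simp] theorem shuffleCons_inl_castAdd (i : Fin a) :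
    shuffleCons a b f (Sum.inl (Fin.castAdd l i)) = 0 := by simp [shuffleCons]

@[simp] theorem shuffleCons_inl_natAdd (i : Fin l) :
    shuffleCons a b f (Sum.inl (Fin.natAdd a i)) = (f (Sum.inl i)).succ := by simp [shuffleCons]

@[simp] theorem shuffleCons_inr_castAdd (j : Fin b) :
    shuffleCons a b f (Sum.inr (Fin.castAdd m j)) = 0 := by simp [shuffleCons]

@[simp] theorem shuffleCons_inr_natAdd (j : Fin m) :
    shuffleCons a b f (Sum.inr (Fin.natAdd b j)) = (f (Sum.inr j)).succ := by simp [shuffleCons]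

theorem shuffleCons_injective :
    Function.Injective (shuffleCons (l := l) (m := m) (n := n) a b) := by
  intro f g hfg
  funext c
  rcases c with i | j
  · simpa using congrFun hfg (Sum.inl (Fin.natAdd a i))
  · simpa using congrFun hfg (Sum.inr (Fin.natAdd b j))

theorem leftFiber_shuffleCons_zero :
    leftFiber (shuffleCons a b f) 0 = Finset.univ.map (Fin.castAddEmb l) := by
  ext i
  refine Fin.addCases (fun i => ?_) (fun i => ?_) i
  · simp [leftFiber]
  · refine iff_of_false (by simp [leftFiber]) ?_
    rw [Finset.mem_map]
    rintro ⟨j, _, hj⟩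
    have := congrArg Fin.val hj
    simp at this
    omega

theorem rightFiber_shuffleCons_zero :
    rightFiber (shuffleCons a b f) 0 = Finset.univ.map (Fin.castAddEmb m) := by
  ext i
  refine Fin.addCases (fun i => ?_) (fun i => ?_) i
  · simp [rightFiber]
  · refine iff_of_false (by simp [rightFiber]) ?_
    rw [Finset.mem_map]
    rintro ⟨j, _, hj⟩
    have := congrArg Fin.val hj
    simp at this
    omega

theorem leftFiber_shuffleCons_succ (r : Fin n) :
    leftFiber (shuffleCons a b f) r.succ = (leftFiber f r).map (Fin.natAddEmb a) := by
  ext i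
  refine Fin.addCases (fun i => ?_) (fun i => ?_) i
  · simp [leftFiber, Fin.ext_iff]; omega
  · simp [leftFiber]

theorem rightFiber_shuffleCons_succ (r : Fin n) :
    rightFiber (shuffleCons a b f) r.succ = (rightFiber f r).map (Fin.natAddEmb b) := by
  ext i
  refine Fin.addCases (fun i => ?_) (fun i => ?_) i
  · simp [rightFiber, Fin.ext_iff]; omega
  · simp [rightFiber]

theorem mem_shuffleSet {f : Fin l ⊕ Fin m → Fin n} : f ∈ shuffleSet l m n ↔
    Function.Surjective f ∧ (Monotone fun i => f (Sum.inl i)) ∧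
      Monotone fun j => f (Sum.inr j) := by
  simp [shuffleSet, Monotone]

theorem monotone_addCases {g : Fin (a + l) → Fin (n + 1)} {g' : Fin l → Fin n}
    (h₁ : ∀ i, g (Fin.castAdd l i) = 0) (h₂ : ∀ i, g (Fin.natAdd a i) = (g' i).succ) :
    Monotone g ↔ Monotone g' := by
  constructor
  · intro hg i j hij
    rw [← Fin.succ_le_succ_iff, ← h₂, ← h₂]
    exact hg (by simpa using hij)
  · intro hg i j
    refine Fin.addCases (fun i => ?_) (fun i => ?_) i <;>
      refine Fin.addCases (fun j => ?_) (fun j => ?_) j <;> intro hij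
    · rw [h₁, h₁]
    · rw [h₁]; exact Fin.zero_le _
    · rw [Fin.le_def] at hij; simp at hij; omega
    · rw [h₂, h₂, Fin.succ_le_succ_iff]
      exact hg (by simpa using hij)

theorem shuffleCons_mem_iff {a b : ℕ} (hab : 0 < a + b) {f : Fin l ⊕ Fin m → Fin n} :
    shuffleCons a b f ∈ shuffleSet (a + l) (b + m) (n + 1) ↔ f ∈ shuffleSet l m n := by
  rw [mem_shuffleSet, mem_shuffleSet,
    monotone_addCases a (g' := fun i => f (Sum.inl i)) (by simp) (by simp),
    monotone_addCases b (g' := fun j => f (Sum.inr j)) (by simp) (by simp)]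
  refine and_congr_left fun _ => ⟨fun hf r => ?_, fun hf r => ?_⟩
  · obtain ⟨c, hc⟩ := hf r.succ
    rcases c with i | j
    · revert hc
      refine Fin.addCases (fun i => ?_) (fun i => ?_) i
      · intro hc; simp at hc; exact absurd hc.symm (Fin.succ_ne_zero r)
      · intro hc; exact ⟨Sum.inl i, by simpa using hc⟩
    · revert hc
      refine Fin.addCases (fun i => ?_) (fun i => ?_) j
      · intro hc; simp at hc; exact absurd hc.symm (Fin.succ_ne_zero r)
      · intro hc; exact ⟨Sum.inr i, by simpa using hc⟩
  · refine Fin.cases ?_ (fun r => ?_) r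
    · rcases Nat.eq_zero_or_pos a with ha | ha
      · exact ⟨Sum.inr (Fin.castAdd m ⟨0, by omega⟩), shuffleCons_inr_castAdd a b f _⟩
      · exact ⟨Sum.inl (Fin.castAdd l ⟨0, ha⟩), shuffleCons_inl_castAdd a b f _⟩
    · obtain ⟨c, rfl⟩ := hf r
      rcases c with i | j
      · exact ⟨Sum.inl (Fin.natAdd a i), by simp⟩
      · exact ⟨Sum.inr (Fin.natAdd b j), by simp⟩

/-- A lower set in `{0, …, N-1}` is an initial segment. -/
theorem mem_iff_lt_card {N : ℕ} {s : Finset (Fin N)} (hs : IsLowerSet (s : Set (Fin N)))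
    (i : Fin N) : i ∈ s ↔ (i : ℕ) < s.card := by
  constructor
  · intro hi
    have : (Finset.Iic i).card ≤ s.card :=
      Finset.card_le_card fun j hj => hs (Finset.mem_Iic.1 hj) hi
    rw [Fin.card_Iic] at this
    omega
  · intro hi
    by_contra hn
    have : s.card ≤ (Finset.Iio i).card := Finset.card_le_card fun j hj =>
      Finset.mem_Iio.2 (lt_of_not_ge fun hij => hn (hs hij hj))
    rw [Fin.card_Iio] at this
    omega

theorem exists_shuffleCons_eq {f : Fin (a + l) ⊕ Fin (b + m) → Fin (n + 1)}
    (hf : f ∈ shuffleSet (a + l) (b + m) (n + 1)) (ha : (leftFiber f 0).card = a)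
    (hb : (rightFiber f 0).card = b) : ∃ f', shuffleCons a b f' = f := by
  rw [mem_shuffleSet] at hf
  have hl : ∀ i, f (Sum.inl i) = 0 ↔ (i : ℕ) < a := by
    intro i
    have := mem_iff_lt_card (s := leftFiber f 0) (fun i j hij hi => ?_) i
    · rw [ha] at this
      simpa [leftFiber] using this
    · simp only [leftFiber, Finset.coe_filter, Finset.mem_univ, true_and, Set.mem_ofPred_eq] at hi ⊢
      exact Fin.le_zero_iff.1 (hi ▸ hf.2.1 hij)
  have hr : ∀ i, f (Sum.inr i) = 0 ↔ (i : ℕ) < b := by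
    intro i
    have := mem_iff_lt_card (s := rightFiber f 0) (fun i j hij hi => ?_) i
    · rw [hb] at this
      simpa [rightFiber] using this
    · simp only [rightFiber, Finset.coe_filter, Finset.mem_univ, true_and,
        Set.mem_ofPred_eq] at hi ⊢
      exact Fin.le_zero_iff.1 (hi ▸ hf.2.2 hij)
  refine ⟨Sum.elim (fun i => (f (Sum.inl (Fin.natAdd a i))).pred (by simp [hl]))
    (fun j => (f (Sum.inr (Fin.natAdd b j))).pred (by simp [hr])), ?_⟩
  funext c
  rcases c with i | j
  · refine Fin.addCases (fun i => ?_) (fun i => ?_) i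
    · rw [shuffleCons_inl_castAdd, eq_comm, hl]; simp
    · simp
  · refine Fin.addCases (fun i => ?_) (fun i => ?_) j
    · rw [shuffleCons_inr_castAdd, eq_comm, hr]; simp
    · simp

/-- Shuffle maps are classified by their fibre over the first point and the remaining map. -/
theorem sum_shuffleSet_fiber {M : Type*} [AddCommMonoid M] (hab : 0 < a + b)
    (G : (Fin (a + l) ⊕ Fin (b + m) → Fin (n + 1)) → M) :
    ∑ f ∈ shuffleSet (a + l) (b + m) (n + 1) with
      ((leftFiber f 0).card, (rightFiber f 0).card) = (a, b), G f =
    ∑ f ∈ shuffleSet l m n, G (shuffleCons a b f) := by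
  symm
  refine Finset.sum_nbij (shuffleCons a b) ?_ (shuffleCons_injective a b).injOn ?_ fun _ _ => rfl
  · intro f hf
    rw [Finset.mem_filter, leftFiber_shuffleCons_zero, rightFiber_shuffleCons_zero]
    exact ⟨(shuffleCons_mem_iff hab).2 hf, by simp⟩
  · intro f hf
    rw [Finset.mem_coe, Finset.mem_filter, Prod.mk.injEq] at hf
    obtain ⟨f', rfl⟩ := exists_shuffleCons_eq a b hf.1 hf.2.1 hf.2.2
    exact ⟨f', (shuffleCons_mem_iff hab).1 hf.1, rfl⟩

theorem sum_shuffleSet_succ {M : Type*} [AddCommMonoid M]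
    (G : (Fin l ⊕ Fin m → Fin (n + 1)) → M) :
    ∑ f ∈ shuffleSet l m (n + 1), G f =
      ∑ a ∈ Finset.range (l + 1), ∑ b ∈ Finset.range (m + 1),
        ∑ f ∈ shuffleSet l m (n + 1) with
          ((leftFiber f 0).card, (rightFiber f 0).card) = (a, b), G f := by
  rw [← Finset.sum_product', ← Finset.sum_fiberwise_of_maps_to
    (g := fun f => ((leftFiber f 0).card, (rightFiber f 0).card))]
  intro f _
  rw [Finset.mem_product, Finset.mem_range, Finset.mem_range, Nat.lt_succ_iff, Nat.lt_succ_iff]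
  exact ⟨card_finset_fin_le (leftFiber f 0), card_finset_fin_le (rightFiber f 0)⟩

theorem koszulExponent_shuffleCons (p : Fin (a + l) → ℤ) (q : Fin (b + m) → ℤ) :
    koszulExponent (shuffleCons a b f) p q =
      (∑ i, (p (Fin.natAdd a i) - 1)) * (∑ j, (q (Fin.castAdd m j) - 1)) +
        koszulExponent f (fun i => p (Fin.natAdd a i)) fun j => q (Fin.natAdd b j) := by
  rw [Finset.sum_mul_sum]
  simp [koszulExponent, Fin.sum_univ_add, Finset.sum_add_distrib, -Finset.sum_sub_distrib]

end ShuffleCons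

section ShuffleFormula

variable {k : Type u} [Field k] {A : DGA.{u, v} k} {ε : Augmentation A} {h : ShuffleMaps A}
  (hI : h.PreservesIdeal ε)

theorem wordApp_ofFn {l m : ℕ} (p : Fin l → ℤ) (q : Fin m → ℤ) (x : Fin l → ε.ideal)
    (y : Fin m → ε.ideal) :
    wordApp hI (List.ofFn fun i => (p i, x i)) (List.ofFn fun j => (q j, y j)) =
      ⟨h l m (fun i => (x i : A.carrier)) fun j => (y j : A.carrier), hI l m x y⟩ := by
  refine Subtype.ext ?_
  change h.app _ _ _ _ = _
  rw [List.length_ofFn, List.length_ofFn, ShuffleMaps.app]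
  congr 2 <;> funext i <;> simp [wordSeq]

theorem ShuffleMaps.apply_orderEmbOfFin {l m a b : ℕ} (s : Finset (Fin l)) (t : Finset (Fin m))
    (hs : s.card = a) (ht : t.card = b) (x : Fin l → A.carrier) (y : Fin m → A.carrier) :
    h s.card t.card (fun i => x (s.orderEmbOfFin rfl i)) (fun j => y (t.orderEmbOfFin rfl j)) =
      h a b (fun i => x (s.orderEmbOfFin hs i)) (fun j => y (t.orderEmbOfFin ht j)) := by
  subst hs ht; rfl

theorem shuffleTerm_shuffleCons {l m n : ℕ} (a b : ℕ) (f : Fin l ⊕ Fin m → Fin n)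
    (x : Fin (a + l) → ε.ideal) (y : Fin (b + m) → ε.ideal) :
    barIncl ε (n + 1) (shuffleTerm ε hI (shuffleCons a b f) x y) =
      barCons ε ⟨h a b (fun i => (x (Fin.castAdd l i) : A.carrier))
          fun j => (y (Fin.castAdd m j) : A.carrier),
          hI a b (fun i => x (Fin.castAdd l i)) fun j => y (Fin.castAdd m j)⟩
        (barIncl ε n (shuffleTerm ε hI f (fun i => x (Fin.natAdd a i))
          fun j => y (Fin.natAdd b j))) := by
  rw [shuffleTerm, shuffleTerm, barCons_barIncl]
  congr 2
  funext r
  refine Subtype.ext ?_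
  have key : ∀ {a' b' : ℕ} (r : Fin (n + 1)) (φ : Fin a' ↪o Fin (a + l))
      (ψ : Fin b' ↪o Fin (b + m)),
      leftFiber (shuffleCons a b f) r = Finset.univ.map φ.toEmbedding →
      rightFiber (shuffleCons a b f) r = Finset.univ.map ψ.toEmbedding →
      h (leftFiber (shuffleCons a b f) r).card (rightFiber (shuffleCons a b f) r).card
        (fun i => (x ((leftFiber (shuffleCons a b f) r).orderEmbOfFin rfl i) : A.carrier))
        (fun j => (y ((rightFiber (shuffleCons a b f) r).orderEmbOfFin rfl j) : A.carrier)) =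
      h a' b' (fun i => (x (φ i) : A.carrier)) fun j => (y (ψ j) : A.carrier) := by
    intro a' b' r φ ψ hφ hψ
    have h₁ : (leftFiber (shuffleCons a b f) r).card = a' := by rw [hφ]; simp
    have h₂ : (rightFiber (shuffleCons a b f) r).card = b' := by rw [hψ]; simp
    rw [ShuffleMaps.apply_orderEmbOfFin _ _ h₁ h₂ (fun i => (x i : A.carrier))
      fun j => (y j : A.carrier),
      ← Finset.orderEmbOfFin_unique' h₁ (f := φ) (fun i => by rw [hφ]; simp),
      ← Finset.orderEmbOfFin_unique' h₂ (f := ψ) (fun i => by rw [hψ]; simp)]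
  refine Fin.cases ?_ (fun r => ?_) r
  · exact key 0 (Fin.castAddOrderEmb l) (Fin.castAddOrderEmb m) (leftFiber_shuffleCons_zero a b f)
      (rightFiber_shuffleCons_zero a b f)
  · refine key r.succ (((leftFiber f r).orderEmbOfFin rfl).trans (Fin.natAddOrderEmb a))
      (((rightFiber f r).orderEmbOfFin rfl).trans (Fin.natAddOrderEmb b)) ?_ ?_
    · rw [leftFiber_shuffleCons_succ]
      conv_lhs => rw [← Finset.map_orderEmbOfFin_univ (leftFiber f r) rfl]
      exact Finset.map_map _ _ _
    · rw [rightFiber_shuffleCons_succ]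
      conv_lhs => rw [← Finset.map_orderEmbOfFin_univ (rightFiber f r) rfl]
      exact Finset.map_map _ _ _

theorem take_ofFn_add {α : Type*} {a l : ℕ} (w : Fin (a + l) → α) :
    (List.ofFn w).take a = List.ofFn fun i => w (Fin.castAdd l i) := by
  rw [List.ofFn_add]; exact List.take_left' (by simp)

theorem drop_ofFn_add {α : Type*} {a l : ℕ} (w : Fin (a + l) → α) :
    (List.ofFn w).drop a = List.ofFn fun i => w (Fin.natAdd a i) := by
  rw [List.ofFn_add]; exact List.drop_left' (by simp)

/-- The convolution powers of a homotopy shuffle system are given by the formula for the homotopy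
shuffle product. -/
theorem wordShuffle_ofFn (hh : IsHomotopyShuffleSystem A h) (n : ℕ) {l m : ℕ} (p : Fin l → ℤ)
    (q : Fin m → ℤ) (x : Fin l → ε.ideal) (y : Fin m → ε.ideal) :
    wordShuffle hI n (List.ofFn fun i => (p i, x i)) (List.ofFn fun j => (q j, y j)) =
      ∑ f ∈ shuffleSet l m n,
        signK k (koszulExponent f p q) • barIncl ε n (shuffleTerm ε hI f x y) := by
  induction n generalizing l m with
  | zero =>
    rcases l with _ | l <;> rcases m with _ | m
    · have h0 : shuffleSet 0 0 0 = {Sum.elim Fin.elim0 Fin.elim0} := by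
        refine Finset.eq_singleton_iff_unique_mem.2 ⟨?_, fun f _ => Subsingleton.elim _ _⟩
        rw [mem_shuffleSet]
        exact ⟨fun r => r.elim0, fun i => i.elim0, fun j => j.elim0⟩
      rw [h0, Finset.sum_singleton, shuffleTerm, barIncl_zero_tprod]
      simp [koszulExponent, wordShuffle, wordUnit]
    · refine Eq.trans (b := 0) ?_ (Finset.sum_eq_zero fun f _ => (f (Sum.inr 0)).elim0).symm
      simp [wordShuffle, wordUnit]
    · refine Eq.trans (b := 0) ?_ (Finset.sum_eq_zero fun f _ => (f (Sum.inl 0)).elim0).symm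
      simp [wordShuffle, wordUnit]
    · refine Eq.trans (b := 0) ?_ (Finset.sum_eq_zero fun f _ => (f (Sum.inl 0)).elim0).symm
      simp [wordShuffle, wordUnit]
  | succ n ih =>
    rw [sum_shuffleSet_succ, wordShuffle, conv, splitSum_eq_sum, List.length_ofFn]
    refine Finset.sum_congr rfl fun a ha => ?_
    rw [splitSum_eq_sum, List.length_ofFn]
    refine Finset.sum_congr rfl fun b hb => ?_
    obtain ⟨l, rfl⟩ := Nat.exists_eq_add_of_le (Nat.lt_succ_iff.1 (Finset.mem_range.1 ha))
    obtain ⟨m, rfl⟩ := Nat.exists_eq_add_of_le (Nat.lt_succ_iff.1 (Finset.mem_range.1 hb))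
    rw [take_ofFn_add, take_ofFn_add, drop_ofFn_add, drop_ofFn_add, wordApp_ofFn, ih, wordDeg_ofFn,
      wordDeg_ofFn]
    rcases Nat.eq_zero_or_pos (a + b) with h0 | h0
    · obtain ⟨rfl, rfl⟩ : a = 0 ∧ b = 0 := by omega
      rw [show (⟨h 0 0 _ _, _⟩ : ε.ideal) = 0 from Subtype.ext (by
        simp [hh.zero_zero]), map_zero, LinearMap.zero_apply, smul_zero]
      refine (Finset.sum_eq_zero fun f hf => ?_).symm
      rw [Finset.mem_filter, Prod.mk.injEq, Finset.card_eq_zero, Finset.card_eq_zero] at hf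
      obtain ⟨c, hc⟩ := (mem_shuffleSet.1 hf.1).1 0
      rcases c with i | j
      · have : i ∈ leftFiber f 0 := Finset.mem_filter.2 ⟨Finset.mem_univ i, hc⟩
        simp [hf.2.1] at this
      · have : j ∈ rightFiber f 0 := Finset.mem_filter.2 ⟨Finset.mem_univ j, hc⟩
        simp [hf.2.2] at this
    · rw [sum_shuffleSet_fiber a b h0, map_sum, Finset.smul_sum]
      refine Finset.sum_congr rfl fun f _ => ?_
      rw [map_smul, smul_smul, ← signK_add, koszulExponent_shuffleCons, shuffleTerm_shuffleCons]

end ShuffleFormula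

/-! ### The homotopy shuffle product as a linear map -/

section Parity

variable {k : Type u} [Field k] (A : DGA.{u, v} k)

/-- The projection to the components whose degree has the parity of `e`. -/
def DGA.parityProj (e : ℤ) : A.carrier →ₗ[k] A.carrier :=
  DirectSum.toModule k ℤ A.carrier
    (fun p => if Even (p - e) then (A.deg p).subtype else 0) ∘ₗ
      (DirectSum.decomposeLinearEquiv A.deg).toLinearMap

theorem DGA.parityProj_of_mem (e : ℤ) {p : ℤ} {x : A} (hx : x ∈ A.deg p) :
    A.parityProj e x = if Even (p - e) then x else 0 := by
  simp only [DGA.parityProj, LinearMap.comp_apply, LinearEquiv.coe_coe,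
    DirectSum.decomposeLinearEquiv_apply]
  rw [DirectSum.decompose_of_mem _ hx]
  erw [DirectSum.toModule_lof]
  split_ifs <;> rfl

variable {A} (ε : Augmentation A)

theorem Augmentation.map_parityProj (e : ℤ) (x : A) :
    ε.toAlgHom (A.parityProj e x) = if Even e then ε.toAlgHom x else 0 := by
  refine A.ext_of_deg
    (f := (ε.toAlgHom.toLinearMap.toAddMonoidHom).comp (A.parityProj e).toAddMonoidHom)
    (g := if Even e then ε.toAlgHom.toLinearMap.toAddMonoidHom else 0) (fun p x hx => ?_) x |>.trans
    (by split_ifs <;> rfl)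
  change ε.toAlgHom (A.parityProj e x) = _
  rw [A.parityProj_of_mem e hx]
  by_cases hp : p = 0
  · subst hp
    simp only [zero_sub, even_neg]
    split_ifs
    · rfl
    · exact map_zero _
  · have h0 := ε.map_deg p x hp hx
    split_ifs
    · rfl
    · exact h0
    · exact (map_zero _).trans h0.symm
    · exact map_zero _

/-- The projection to the components whose degree has the parity of `e`, on the augmentation
ideal. -/
def Augmentation.parityProj (e : ℤ) : ε.ideal →ₗ[k] ε.ideal :=
  (A.parityProj e).restrict fun x hx => ε.mem_ideal.2 (by
    rw [ε.map_parityProj, ε.mem_ideal.1 hx, ite_self])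

theorem Augmentation.parityProj_of_mem (e : ℤ) {p : ℤ} {x : ε.ideal}
    (hx : (x : A.carrier) ∈ A.deg p) : ε.parityProj e x = if Even (p - e) then x else 0 := by
  refine Subtype.ext ?_
  change A.parityProj e x = _
  rw [A.parityProj_of_mem e hx]
  split_ifs <;> rfl

/-- The augmentation ideal is spanned by its homogeneous elements. -/
theorem Augmentation.span_homogeneous :
    Submodule.span k {x : ε.ideal | ∃ p, (x : A.carrier) ∈ A.deg p} = ⊤ := by
  classical
  refine eq_top_iff.2 fun x _ => ?_
  have hc : ∀ p, (DirectSum.decompose A.deg (x : A.carrier) p : A.carrier) ∈ ε.ideal := by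
    intro p
    rw [ε.mem_ideal]
    by_cases hp : p = 0
    · have hx := ε.mem_ideal.1 x.2
      rw [← DirectSum.sum_support_decompose A.deg (x : A.carrier), map_sum] at hx
      rw [← hx]
      subst hp
      by_cases h0 : 0 ∈ (DirectSum.decompose A.deg (x : A.carrier)).support
      · rw [Finset.sum_eq_single_of_mem 0 h0 fun q _ hq => ε.map_deg q _ hq (SetLike.coe_mem _)]
      · rw [DFinsupp.notMem_support_iff.1 h0, ZeroMemClass.coe_zero, map_zero]
        rw [Finset.sum_eq_zero fun q hq => ε.map_deg q _ (fun e => h0 (e ▸ hq)) (SetLike.coe_mem _)]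
    · exact ε.map_deg p _ hp (SetLike.coe_mem _)
  have hx : x = ∑ p ∈ (DirectSum.decompose A.deg (x : A.carrier)).support,
      (⟨_, hc p⟩ : ε.ideal) := by
    refine Subtype.ext ?_
    rw [AddSubmonoidClass.coe_finsetSum]
    exact (DirectSum.sum_support_decompose A.deg (x : A.carrier)).symm
  rw [hx]
  exact Submodule.sum_mem _ fun p _ => Submodule.subset_span ⟨p, SetLike.coe_mem _⟩

/-- The reduced bar complex is spanned by the homogeneous words. -/
theorem span_wordBar :
    Submodule.span k {z : Bar ε | ∃ X, IsHomogeneousWord X ∧ z = wordBar X} = ⊤ := by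
  set S := Submodule.span k {z : Bar ε | ∃ X, IsHomogeneousWord X ∧ z = wordBar X}
  have hS : ∀ (a : ε.ideal), ∀ z ∈ S, barCons ε a z ∈ S := by
    intro a z hz
    have ha : a ∈ Submodule.span k {x : ε.ideal | ∃ p, (x : A.carrier) ∈ A.deg p} := by
      rw [ε.span_homogeneous]; trivial
    refine Submodule.span_le (p := S.comap ((barCons ε).flip z)).2 ?_ ha
    rintro a ⟨p, hp⟩
    refine Submodule.span_le (p := S.comap (barCons ε a)).2 ?_ hz
    rintro _ ⟨X, hX, rfl⟩
    refine Submodule.subset_span ⟨(p, a) :: X, ?_, rfl⟩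
    intro c hc
    rcases List.mem_cons.1 hc with rfl | hc
    · exact hp
    · exact hX c hc
  have hT : ∀ (n : ℕ) (x : Fin n → ε.ideal), barIncl ε n (PiTensorProduct.tprod k x) ∈ S := by
    intro n
    induction n with
    | zero =>
      intro x
      rw [barIncl_zero_tprod]
      exact Submodule.subset_span ⟨[], by simp [IsHomogeneousWord], rfl⟩
    | succ n ih =>
      intro x
      rw [barIncl_succ_tprod]
      exact hS _ _ (ih _)
  have hq : S.mkQ = 0 := bar_ext ε fun n x => (Submodule.Quotient.mk_eq_zero S).2 (hT n x)
  rw [← S.ker_mkQ, hq, LinearMap.ker_zero]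

theorem wordD_congr {M : Type*} [AddCommGroup M] [Module k M] {X : List (Letter ε)}
    (hX : IsHomogeneousWord X) {f g : List (Letter ε) → M}
    (hfg : ∀ Z, IsHomogeneousWord Z → f Z = g Z) : wordD X f = wordD X g := by
  induction X generalizing f g with
  | nil => rfl
  | cons c X ih =>
    have hc := hX c (by simp)
    have hX' : IsHomogeneousWord X := fun c' hc' => hX c' (by simp [hc'])
    rw [wordD_cons, wordD_cons, hfg (c.d :: X), ih hX' (g := fun Z => g (c :: Z))]
    · congr 1
      rcases X with _ | ⟨c', X⟩
      · rfl
      · refine hfg _ ?_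
        intro b hb
        rcases List.mem_cons.1 hb with rfl | hb
        · exact SetLike.mul_mem_graded (A.sgn_mem hc) (hX' c' (by simp))
        · exact hX' b (by simp [hb])
    · intro Z hZ
      refine hfg _ fun b hb => ?_
      rcases List.mem_cons.1 hb with rfl | hb
      · exact hc
      · exact hZ b hb
    · intro b hb
      rcases List.mem_cons.1 hb with rfl | hb
      · exact A.d_mem hc
      · exact hX' b hb

end Parity

section ShuffleProductMap

variable {k : Type u} [Field k] {A : DGA.{u, v} k} (ε : Augmentation A) {h : ShuffleMaps A}
  (hI : h.PreservesIdeal ε)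

/-- The factors of the tensor `shuffleTerm ε hI f x y`. -/
def shuffleFactor {l m n : ℕ} (f : Fin l ⊕ Fin m → Fin n) (z : Fin l ⊕ Fin m → ε.ideal)
    (r : Fin n) : ε.ideal :=
  ⟨h (leftFiber f r).card (rightFiber f r).card
    (fun i => (z (Sum.inl ((leftFiber f r).orderEmbOfFin rfl i)) : A.carrier))
    (fun j => (z (Sum.inr ((rightFiber f r).orderEmbOfFin rfl j)) : A.carrier)),
    hI _ _ (fun i => z (Sum.inl ((leftFiber f r).orderEmbOfFin rfl i)))
      (fun j => z (Sum.inr ((rightFiber f r).orderEmbOfFin rfl j)))⟩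

theorem coe_update_comp {ι κ : Type*} [DecidableEq ι] [DecidableEq κ] (z : κ → ε.ideal) {ψ : ι → κ}
    (hψ : Function.Injective ψ) (i₀ : ι) (v : ε.ideal) :
    (fun i => (Function.update z (ψ i₀) v (ψ i) : A.carrier)) =
      Function.update (fun i => (z (ψ i) : A.carrier)) i₀ (v : A.carrier) := by
  funext i
  by_cases hi : i = i₀
  · subst hi; simp
  · rw [Function.update_of_ne hi, Function.update_of_ne (hψ.ne hi)]

theorem shuffleFactor_update {l m n : ℕ} (f : Fin l ⊕ Fin m → Fin n)
    (z : Fin l ⊕ Fin m → ε.ideal) (c : Fin l ⊕ Fin m) :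
    ∃ L : ε.ideal →ₗ[k] ε.ideal, ∀ v, shuffleFactor ε hI f (Function.update z c v) =
      Function.update (shuffleFactor ε hI f z) (f c) (L v) := by
  suffices hL : ∃ L : A.carrier →ₗ[k] A.carrier, ∀ v : ε.ideal,
      (shuffleFactor ε hI f (Function.update z c v) (f c) : A.carrier) = L v by
    obtain ⟨L, hL⟩ := hL
    refine ⟨L.restrict (p := ε.ideal) (q := ε.ideal) fun v hv => ?_, fun v => ?_⟩
    · rw [← hL ⟨v, hv⟩]; exact Subtype.coe_prop _
    · funext r
      by_cases hr : r = f c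
      · subst hr
        rw [Function.update_self]
        exact Subtype.ext (hL v)
      · rw [Function.update_of_ne hr]
        refine Subtype.ext ?_
        simp only [shuffleFactor]
        congr 2 <;> funext i <;> rw [Function.update_of_ne]
        · rintro rfl
          exact hr (Finset.mem_filter.1 (Finset.orderEmbOfFin_mem _ rfl i)).2.symm
        · rintro rfl
          exact hr (Finset.mem_filter.1 (Finset.orderEmbOfFin_mem _ rfl i)).2.symm
  set s := leftFiber f (f c) with hs
  set t := rightFiber f (f c) with ht
  set x : Fin s.card → A.carrier := fun i => z (Sum.inl (s.orderEmbOfFin rfl i))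
  set y : Fin t.card → A.carrier := fun j => z (Sum.inr (t.orderEmbOfFin rfl j))
  rcases c with i | j
  · obtain ⟨i₀, hi₀⟩ : i ∈ Set.range (s.orderEmbOfFin rfl) := by
      rw [Finset.range_orderEmbOfFin]; simp [hs, leftFiber]
    refine ⟨⟨⟨fun v => h s.card t.card (Function.update x i₀ v) y, fun v w => ?_⟩, fun a v => ?_⟩,
      fun v => ?_⟩
    · rw [MultilinearMap.map_update_add, add_apply]
    · exact DFunLike.congr_fun ((h s.card t.card).map_update_smul x i₀ a v) y
    · change h s.card t.card _ _ = h s.card t.card _ _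
      refine DFunLike.congr_fun (congrArg _ ?_) y
      have := coe_update_comp ε z (ψ := fun i => Sum.inl (s.orderEmbOfFin rfl i))
        (Sum.inl_injective.comp (s.orderEmbOfFin rfl).injective) i₀ v
      rwa [hi₀] at this
  · obtain ⟨j₀, hj₀⟩ : j ∈ Set.range (t.orderEmbOfFin rfl) := by
      rw [Finset.range_orderEmbOfFin]; simp [ht, rightFiber]
    refine ⟨(h s.card t.card x).toLinearMap y j₀, fun v => ?_⟩
    change h s.card t.card _ _ = h s.card t.card _ _
    refine congrArg _ ?_
    have := coe_update_comp ε z (ψ := fun j => Sum.inr (t.orderEmbOfFin rfl j))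
      (Sum.inr_injective.comp (t.orderEmbOfFin rfl).injective) j₀ v
    rwa [hj₀] at this

/-- The tensor `shuffleTerm ε hI f x y` as a multilinear map. -/
def shuffleMultilinear {l m n : ℕ} (f : Fin l ⊕ Fin m → Fin n) :
    MultilinearMap k (fun _ : Fin l ⊕ Fin m => ε.ideal) (⨂[k]^n ε.ideal) :=
  MultilinearMap.mk' (fun z => PiTensorProduct.tprod k (shuffleFactor ε hI f z))
    (fun z c v w => by
      obtain ⟨L, hL⟩ := shuffleFactor_update ε hI f z c
      simp only [hL, map_add, MultilinearMap.map_update_add])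
    (fun z c a v => by
      obtain ⟨L, hL⟩ := shuffleFactor_update ε hI f z c
      simp only [hL, map_smul, MultilinearMap.map_update_smul])

theorem shuffleMultilinear_apply {l m n : ℕ} (f : Fin l ⊕ Fin m → Fin n) (x : Fin l → ε.ideal)
    (y : Fin m → ε.ideal) :
    shuffleMultilinear ε hI f (Sum.elim x y) = shuffleTerm ε hI f x y := rfl

/-- The homotopy shuffle product on `(I[1])^{⊗ l} ⊗ (I[1])^{⊗ m}`. As the signs depend only on the
parities of the degrees, the formula for homogeneous elements extends to all elements by
means of the projections to the even and odd parts. -/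
def shuffleProductComponent (l m : ℕ) :
    MultilinearMap k (fun _ : Fin l ⊕ Fin m => ε.ideal) (Bar ε) :=
  ∑ n ∈ Finset.range (l + m + 1), ∑ f ∈ shuffleSet l m n, ∑ e : Fin l ⊕ Fin m → Fin 2,
    signK k (koszulExponent f (fun i => (e (Sum.inl i) : ℕ)) fun j => (e (Sum.inr j) : ℕ)) •
      ((barIncl ε n).compMultilinearMap (shuffleMultilinear ε hI f)).compLinearMap
        fun c => ε.parityProj (e c : ℕ)

theorem signK_koszulExponent_congr {l m n : ℕ} (f : Fin l ⊕ Fin m → Fin n) {p p' : Fin l → ℤ}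
    {q q' : Fin m → ℤ} (hp : ∀ i, Even (p i - p' i)) (hq : ∀ j, Even (q j - q' j)) :
    signK k (koszulExponent f p q) = signK k (koszulExponent f p' q') := by
  refine signK_eq ?_
  rw [koszulExponent, koszulExponent, ← Finset.sum_sub_distrib]
  refine Finset.even_sum _ fun i _ => ?_
  rw [← Finset.sum_sub_distrib]
  refine Finset.even_sum _ fun j _ => ?_
  split_ifs
  · rw [show (p i - 1) * (q j - 1) - (p' i - 1) * (q' j - 1) =
      (p i - p' i) * (q j - 1) + (p' i - 1) * (q j - q' j) by ring]
    exact ((hp i).mul_right _).add ((hq j).mul_left _)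
  · simp

theorem shuffleProductComponent_apply {l m : ℕ} {p : Fin l → ℤ} {q : Fin m → ℤ}
    {x : Fin l → ε.ideal} {y : Fin m → ε.ideal} (hx : ∀ i, (x i : A.carrier) ∈ A.deg (p i))
    (hy : ∀ j, (y j : A.carrier) ∈ A.deg (q j)) :
    shuffleProductComponent ε hI l m (Sum.elim x y) =
      ∑ n ∈ Finset.range (l + m + 1), ∑ f ∈ shuffleSet l m n,
        signK k (koszulExponent f p q) • barIncl ε n (shuffleTerm ε hI f x y) := by
  have hz : ∀ c, ((Sum.elim x y c : ε.ideal) : A.carrier) ∈ A.deg (Sum.elim p q c) := by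
    rintro (i | j)
    · exact hx i
    · exact hy j
  simp only [shuffleProductComponent, sum_apply, smul_apply,
    MultilinearMap.compLinearMap_apply, LinearMap.compMultilinearMap_apply]
  refine Finset.sum_congr rfl fun n _ => Finset.sum_congr rfl fun f _ => ?_
  -- Only the parities of the given degrees contribute.
  have hpar : ∀ a : ℤ, ∃ e : Fin 2, ∀ e' : Fin 2, Even (a - (e' : ℕ)) ↔ e' = e := by
    intro a
    rcases Int.even_or_odd a with ha | ha
    · refine ⟨0, fun e' => ?_⟩
      fin_cases e' <;> simp [ha]
    · refine ⟨1, fun e' => ?_⟩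
      fin_cases e' <;> simp [ha]
  choose par hpar using hpar
  rw [Finset.sum_eq_single fun c => par (Sum.elim p q c)]
  · rw [signK_koszulExponent_congr (k := k) f (p' := p) (q' := q)]
    · rw [← shuffleMultilinear_apply]
      congr 3
      funext c
      rw [ε.parityProj_of_mem _ (hz c), if_pos ((hpar _ _).2 rfl)]
    · intro i
      rw [← even_neg, neg_sub]
      exact (hpar _ _).2 rfl
    · intro j
      rw [← even_neg, neg_sub]
      exact (hpar _ _).2 rfl
  · intro e _ he
    obtain ⟨c, hc⟩ := Function.ne_iff.1 he
    rw [(shuffleMultilinear ε hI f).map_coord_zero c, map_zero, smul_zero]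
    rw [ε.parityProj_of_mem _ (hz c), if_neg (mt (hpar _ _).1 hc)]
  · exact fun hn => absurd (Finset.mem_univ _) hn

/-- The homotopy shuffle product. -/
def shuffleProduct : Bar ε ⊗[k] Bar ε →ₗ[k] Bar ε :=
  TensorProduct.lift (DirectSum.toModule k ℕ (Bar ε →ₗ[k] Bar ε) fun l =>
    LinearMap.flip (DirectSum.toModule k ℕ ((⨂[k]^l ε.ideal) →ₗ[k] Bar ε) fun m =>
      LinearMap.flip (TensorProduct.curry
        (PiTensorProduct.lift (shuffleProductComponent ε hI l m) ∘ₗ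
          (PiTensorProduct.tmulEquiv k ε.ideal).toLinearMap))))

theorem shuffleProduct_barIncl {l m : ℕ} (x : Fin l → ε.ideal) (y : Fin m → ε.ideal) :
    shuffleProduct ε hI (barIncl ε l (PiTensorProduct.tprod k x) ⊗ₜ[k]
      barIncl ε m (PiTensorProduct.tprod k y)) =
        shuffleProductComponent ε hI l m (Sum.elim x y) := by
  rw [shuffleProduct, TensorProduct.lift.tmul, barIncl, barIncl, DirectSum.toModule_lof,
    LinearMap.flip_apply, DirectSum.toModule_lof, LinearMap.flip_apply, TensorProduct.curry_apply,
    LinearMap.comp_apply, LinearEquiv.coe_coe, PiTensorProduct.tmulEquiv_apply,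
    PiTensorProduct.lift.tprod]

theorem isHomotopyShuffleProduct_shuffleProduct :
    IsHomotopyShuffleProduct ε hI (shuffleProduct ε hI) := by
  intro l m p q x y hx hy
  rw [shuffleProduct_barIncl, shuffleProductComponent_apply ε hI hx hy]
  refine Finset.sum_congr rfl fun n _ => Finset.sum_congr rfl fun f _ => ?_
  exact (negOnePow_smul_bar ε _ _).symm

theorem shuffleProduct_wordBar (hh : IsHomotopyShuffleSystem A h) {X Y : List (Letter ε)}
    (hX : IsHomogeneousWord X) (hY : IsHomogeneousWord Y) :
    shuffleProduct ε hI (wordBar X ⊗ₜ[k] wordBar Y) = wordProduct hI X Y := by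
  have hw : ∀ X : List (Letter ε), X = List.ofFn fun i => ((X.get i).1, (X.get i).2) :=
    fun X => (List.ofFn_get X).symm
  rw [hw X, hw Y, wordBar_ofFn, wordBar_ofFn, shuffleProduct_barIncl,
    shuffleProductComponent_apply ε hI (fun i => hX _ (List.get_mem X i))
      fun j => hY _ (List.get_mem Y j), wordProduct, List.length_ofFn, List.length_ofFn]
  exact Finset.sum_congr rfl fun n _ => (wordShuffle_ofFn hI hh n _ _ _ _).symm

/-- The homotopy shuffle product attached to a homotopy shuffle system is a morphism of
complexes. -/
theorem isBarComplexHom_shuffleProduct (hh : IsHomotopyShuffleSystem A h) :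
    IsBarComplexHom ε (shuffleProduct ε hI) := by
  constructor
  · intro r s z w hz hw
    induction hz using Submodule.span_induction with
    | zero => rw [TensorProduct.zero_tmul, map_zero]; exact zero_mem _
    | add z z' _ _ hz hz' => rw [TensorProduct.add_tmul, map_add]; exact add_mem hz hz'
    | smul a z _ hz =>
      rw [← TensorProduct.smul_tmul', map_smul]; exact Submodule.smul_mem _ a hz
    | mem z hz =>
    obtain ⟨l, p, x, hx, hp, rfl⟩ := hz
    induction hw using Submodule.span_induction with
    | zero => rw [TensorProduct.tmul_zero, map_zero]; exact zero_mem _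
    | add w w' _ _ hw hw' => rw [TensorProduct.tmul_add, map_add]; exact add_mem hw hw'
    | smul a w _ hw => rw [TensorProduct.tmul_smul, map_smul]; exact Submodule.smul_mem _ a hw
    | mem w hw =>
    obtain ⟨m, q, y, hy, hq, rfl⟩ := hw
    have hX := isHomogeneousWord_ofFn hx
    have hY := isHomogeneousWord_ofFn hy
    rw [← wordBar_ofFn p x, ← wordBar_ofFn q y, shuffleProduct_wordBar ε hI hh hX hY, ← hp, ← hq,
      ← wordDeg_ofFn p x, ← wordDeg_ofFn q y]
    exact Submodule.sum_mem _ fun n _ => wordShuffle_mem hI hh n hX hY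
  · refine TensorProduct.ext (LinearMap.ext_on (span_wordBar ε) ?_)
    rintro _ ⟨X, hX, rfl⟩
    refine LinearMap.ext_on (span_wordBar ε) ?_
    rintro _ ⟨Y, hY, rfl⟩
    change shuffleProduct ε hI (barTensorD ε (wordBar X ⊗ₜ[k] wordBar Y)) =
      barD ε (shuffleProduct ε hI (wordBar X ⊗ₜ[k] wordBar Y))
    rw [shuffleProduct_wordBar ε hI hh hX hY, barD_wordProduct hI hh hX hY, barTensorD,
      LinearMap.add_apply, TensorProduct.map_tmul, TensorProduct.map_tmul, LinearMap.id_apply,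
      barD_wordBar hX, barD_wordBar hY, barSgn_wordBar hX, map_add, biD, ← TensorProduct.smul_tmul',
      map_smul]
    congr 1
    · refine (map_wordD ((shuffleProduct ε hI) ∘ₗ (TensorProduct.mk k _ _).flip (wordBar Y))
        X wordBar).trans (wordD_congr ε hX fun Z hZ => ?_)
      exact shuffleProduct_wordBar ε hI hh hZ hY
    · congr 1
      refine (map_wordD ((shuffleProduct ε hI) ∘ₗ TensorProduct.mk k _ _ (wordBar X))
        Y wordBar).trans (wordD_congr ε hY fun Z hZ => ?_)
      exact shuffleProduct_wordBar ε hI hh hX hZ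

end ShuffleProductMap
end HomotopyShuffle
end

theorem mainTheorem4 (k : Type u) [Field k] :
    ∃ h : ∀ (I : Type w) [LinearOrder I] [Finite I] (A : StrictCosimplicialCDGA.{u, v, w} k I),
        ShuffleMaps (cech A),
      -- `h` is a homotopy shuffle system for each total differential graded algebra,
      (∀ (I : Type w) [LinearOrder I] [Finite I] (A : StrictCosimplicialCDGA.{u, v, w} k I),
        IsHomotopyShuffleSystem (cech A) (h I A)) ∧
      -- with `h^{l,m} = 0` for `l > 1`,
      (∀ (I : Type w) [LinearOrder I] [Finite I] (A : StrictCosimplicialCDGA.{u, v, w} k I)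
        (l m : ℕ), 1 < l → h I A l m = 0) ∧
      -- and `h^{l,m} = 0` for `l + m > 1` if `I` has at most one element;
      (∀ (I : Type w) [LinearOrder I] [Finite I] (A : StrictCosimplicialCDGA.{u, v, w} k I)
        (l m : ℕ), Nat.card I ≤ 1 → 1 < l + m → h I A l m = 0) ∧
      -- it is functorial,
      (∀ (I J : Type w) [LinearOrder I] [Finite I] [LinearOrder J] [Finite J] (φ : I →o J)
        (B : StrictCosimplicialCDGA.{u, v, w} k J) (A : StrictCosimplicialCDGA.{u, v, w} k I)
        (τ : PhiHom φ B A) (l m : ℕ) (x : Fin l → CechCarrier B) (y : Fin m → CechCarrier B),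
        τ.induced (h J B l m x y) =
          h I A l m (fun i => τ.induced (x i)) (fun j => τ.induced (y j))) ∧
      -- and the homotopy shuffle product attached to it is a morphism of complexes.
      (∀ (I : Type w) [LinearOrder I] [Finite I] (A : StrictCosimplicialCDGA.{u, v, w} k I)
        (ε : Augmentation (cech A)),
        ∃ hI : (h I A).PreservesIdeal ε, ∃ μ : Bar ε ⊗[k] Bar ε →ₗ[k] Bar ε,
          IsHomotopyShuffleProduct ε hI μ ∧ IsBarComplexHom ε μ) := by
  refine ⟨fun I _ _ A => cechShuffle A, fun I _ _ A => isHomotopyShuffleSystem_cechShuffle A,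
    fun I _ _ A l m hl => cechShuffle_of_one_lt hl m,
    fun I _ _ A l m hI hlm => cechShuffle_eq_zero_of_card_le_one hI hlm,
    fun I J _ _ _ _ φ B A τ l m x y => cechShuffle_functorial τ l m x y, fun I _ _ A ε =>
      ⟨cechShuffle_preservesIdeal ε, shuffleProduct ε (cechShuffle_preservesIdeal ε),
        isHomotopyShuffleProduct_shuffleProduct ε _,
        isBarComplexHom_shuffleProduct ε _ (isHomotopyShuffleSystem_cechShuffle A)⟩⟩
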